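/- **Setting.** Let $(\mathbf X_i,W_i,\mathbf Y_i^0,\mathbf Y_i^1)$, $i\ge 1$, be i.i.d. with $\mathbf X_i\in[0,1]^p$ ($p\ge 1$), $W_i\in\{0,1\}$, $\mathbf Y_i^w\in\mathbb R^d$; one observes $\mathbf Z_i=(\mathbf X_i,W_i,\mathbf Y_i)$ with $\mathbf Y_i=\mathbf Y_i^{W_i}$. Let $k$ be a bounded continuous positive definite kernel on $\mathbb R^d$ with reproducing kernel Hilbert space $\mathcal H$. For an $\mathcal H$-valued $\xi$ put $\mathrm{Var}(\xi)=\mathbb E\|\xi-\mathbb E\xi\|^2$. Let $Q_w(\mathbf t)$ be a regular version of the law of $\mathbf Y^w$ given $\mathbf X=\mathbf t$, let $\mu^{(w)}(\mathbf t)=\int k(\mathbf y,\cdot)\,Q_w(\mathbf t)(d\mathbf y)$, and fix $\mathbf x\in[0,1]^p$. Assume, for $w\in\{0,1\}$: * $\mathbf X$ has a density on $[0,1]^p$ bounded away from $0$ and $\infty$; for some $\varepsilon_0>0$, $\varepsilon_0<\mathbb P(W=1\mid\mathbf X)<1-\varepsilon_0$ a.s.; $(\mathbf Y^0,\mathbf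 Y^1)$ and $W$ are conditionally independent given $\mathbf X$. * On $[0,1]^p$ the maps $\mathbf t\mapsto\mu^{(w)}(\mathbf t)$, $\mathbf t\mapsto\int\|k(\mathbf y,\cdot)\|^2Q_w(\mathbf t)(d\mathbf y)$ and, for every $f\in\mathcal H\setminus\{0\}$, $\mathbf t\mapsto\int|f(\mathbf y)|^2Q_w(\mathbf t)(d\mathbf y)$ are Lipschitz. * $\int\|k(\mathbf y,\cdot)\|^2Q_w(\mathbf x)(d\mathbf y)-\|\mu^{(w)}(\mathbf x)\|^2>0$, and for every $f\in\mathcal H\setminus\{0\}$ the variance of $f$ under $Q_w(\mathbf x)$ is positive. **Trees.** Fix $0<\alpha\le 0.2$, an integer $\kappa\ge1$, $\pi>0$, and $\beta$ with $1>\beta>\bigl(1+\frac{\log((1-\alpha)^{-1})}{\log(\alpha^{-1})}\frac{\pi}{p}\bigr)^{-1}$; let $s_n\ge 1$ be integers with $|s_n-n^\beta|\le1$. For each $n$, a randomized procedure with auxiliary randomness $\mathcal E$ independent of the data grows a finite binary tree from $\mathcal Z_{s_n}=(\mathbf Z_1,\dots,\mathbf Z_{s_n})$ by splits $\{t_j<c\}$,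 $\{t_j\ge c\}$; $\mathcal E$ also selects a set $\mathcal I_2\subset\{1,\dots,s_n\}$ containing half of the indices (rounded up or down). Let $\mathcal L(\mathbf x)$ be the leaf cell containing $\mathbf x$, and for $i\in\mathcal I_2$ put $$S_{i1}=\frac{\mathbf 1\{\mathbf X_i\in\mathcal L(\mathbf x),W_i=1\}}{|\{j\in\mathcal I_2:\mathbf X_j\in\mathcal L(\mathbf x),W_j=1\}|},\qquad S_{i0}=-\frac{\mathbf 1\{\mathbf X_i\in\mathcal L(\mathbf x),W_i=0\}}{|\{j\in\mathcal I_2:\mathbf X_j\in\mathcal L(\mathbf x),W_j=0\}|}$$ (with $0/0=0$), and $S_{i1}=S_{i0}=0$ for $i\notin\mathcal I_2$; $S_i=S_{i1}+S_{i0}$. Assume: * (Honesty) the tree is a measurable function of $\mathcal E$ and the data that does not depend on $\mathbf Y_i$, $i\in\mathcal I_2$. * (Random split) given the data, the splits made at the ancestors of a node and that the node is split, each feature is used with conditional probability at least $\pi/p$. * (Symmetry) permuting the observations permutes the weights $(S_i)_{i\le s_n}$ without changing their joint law over $\mathcal E$. * ($\alpha$-regularity) call a split of a node admissible if each child contains at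 least a fraction $\alpha$ of the node's $\mathcal I_2$-observations and at least $\kappa$ $\mathcal I_2$-observations from each treatment group. Almost surely every split that is made is admissible, and a node is left unsplit only if for some feature $j$ no admissible split along $j$ exists. (This holds in particular if all splits respect the fraction $\alpha$ and every leaf contains between $\kappa$ and $2\kappa-1$ $\mathcal I_2$-observations from each treatment group.) Let $\Gamma(\mathcal Z_{s_n})=\mathbb E_{\mathcal E}\bigl[\sum_{i\le s_n}S_i\,k(\mathbf Y_i,\cdot)\bigr]$, let $\Gamma_n(\mathbf Z_1)=\mathbb E[\Gamma(\mathcal Z_{s_n})\mid\mathbf Z_1]-\mathbb E[\Gamma(\mathcal Z_{s_n})]$, and put, for $f\in\mathcal H\setminus\{0\}$, $$\sigma^2(\mathbf x,w)=\int\|k(\mathbf y,\cdot)-\mu^{(w)}(\mathbf x)\|^2Q_w(\mathbf x)(d\mathbf y),\qquad \sigma_f^2(\mathbf x,w)=\int|\langle f,k(\mathbf y,\cdot)\rangle-\langle f,\mu^{(w)}(\mathbf x)\rangle|^2Q_w(\mathbf x)(d\mathbf y).$$ Let $V_{n,w}=\mathrm{Var}(\mathbb E[S_{1w}\mid\mathbf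 X_1,W_1=w])$, the variance of $\mathbb E[S_{1w}\mid\mathbf X_1,W_1]$ under $\mathbb P(\cdot\mid W_1=w)$, and $\mathrm{Var}(\mathbb E[S_1\mid\mathbf X_1,W_1]\mid W_1)=V_{n,1}W_1+V_{n,0}(1-W_1)$. **Theorem.** For every $f\in\mathcal H\setminus\{0\}$ there is $\epsilon>0$ such that, as $n\to\infty$, $$\mathrm{Var}(\langle\Gamma_n(\mathbf Z_1),f\rangle)=\mathbb E\bigl[\mathrm{Var}(\mathbb E[S_1\mid\mathbf X_1,W_1]\mid W_1)\,\sigma_f^2(\mathbf x,W_1)\bigr]+o(s_n^{-(1+\epsilon)}),$$ $$\mathrm{Var}(\Gamma_n(\mathbf Z_1))=\mathbb E\bigl[\mathrm{Var}(\mathbb E[S_1\mid\mathbf X_1,W_1]\mid W_1)\,\sigma^2(\mathbf x,W_1)\bigr]+o(s_n^{-(1+\epsilon)}).$$ If, in addition, $V_{n,1}/V_{n,0}\to c$ for some $c\in[0,\infty]$, then $$\lim_{n\to\infty}\frac{\mathrm{Var}(\langle\Gamma_n(\mathbf Z_1),f\rangle)}{\mathrm{Var}(\Gamma_n(\mathbf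 Z_1))}=\frac{c\,\sigma_f^2(\mathbf x,1)\,\mathbb P(W=1)+\sigma_f^2(\mathbf x,0)\,\mathbb P(W=0)}{c\,\sigma^2(\mathbf x,1)\,\mathbb P(W=1)+\sigma^2(\mathbf x,0)\,\mathbb P(W=0)},$$ where for $c=\infty$ the right-hand side means $\sigma_f^2(\mathbf x,1)/\sigma^2(\mathbf x,1)$. -/

import Mathlib

open MeasureTheory ProbabilityTheory Filter Topology Asymptotics
open scoped ENNReal NNReal

noncomputable section

/-! ### Observations -/

/-- An observation `(X, W, Y)`: covariates in `ℝ^p`, treatment status, outcome in `ℝ^d`. -/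
abbrev Obs (p d : ℕ) : Type := (Fin p → ℝ) × Bool × (Fin d → ℝ)

/-- The covariates of an observation. -/
def cov {p d : ℕ} (z : Obs p d) : Fin p → ℝ := z.1

/-- The treatment status of an observation (`true` is treated, `false` is control). -/
def trt {p d : ℕ} (z : Obs p d) : Bool := z.2.1

/-- The outcome of an observation. -/
def out {p d : ℕ} (z : Obs p d) : Fin d → ℝ := z.2.2

/-! ### Trees with axis-parallel splits -/

/-- A finite binary tree. An inner node carries a splitting feature `j` and a splitting value `c`;
its left child receives the points with `t j < c`, its right child those with `c ≤ t j`. -/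
inductive SplitTree (p : ℕ) : Type
  | leaf : SplitTree p
  | node (j : Fin p) (c : ℝ) (left right : SplitTree p) : SplitTree p

namespace SplitTree

variable {p : ℕ}

/-- The cell of `ℝ^p` that belongs to the leaf into which the point `x` falls. -/
def leafAt : SplitTree p → (Fin p → ℝ) → Set (Fin p → ℝ)
  | leaf, _ => Set.univ
  | node j c l r, x =>
      if x j < c then {t | t j < c} ∩ l.leafAt x else {t | c ≤ t j} ∩ r.leafAt x

/-- Nodes are addressed by lists of directions read from the root (`false` is left, `true` is
right). This is the splitting feature used at the address `v`, or `none` if there is no inner node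
at `v`. -/
def splitDim : SplitTree p → List Bool → Option (Fin p)
  | leaf, _ => none
  | node j _ _ _, [] => some j
  | node _ _ l r, b :: v => if b then r.splitDim v else l.splitDim v

/-- The splitting value used at the address `v` (`0` if there is no inner node at `v`). -/
def splitThr : SplitTree p → List Bool → ℝ
  | leaf, _ => 0
  | node _ c _ _, [] => c
  | node _ _ l r, b :: v => if b then r.splitThr v else l.splitThr v

/-- The σ-algebra generated by what the tree does at the address `v`. -/
abbrev splitSigma (v : List Bool) : MeasurableSpace (SplitTree p) :=
  MeasurableSpace.comap (fun t : SplitTree p => t.splitDim v) ⊤ ⊔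
    MeasurableSpace.comap (fun t : SplitTree p => t.splitThr v) inferInstance

/-- The σ-algebra on trees generated by all splits. -/
instance : MeasurableSpace (SplitTree p) := ⨆ v : List Bool, splitSigma v

/-- The σ-algebra generated by the splits at the proper ancestors of the address `v`. -/
abbrev ancestorSigma (v : List Bool) : MeasurableSpace (SplitTree p) :=
  ⨆ u : List Bool, ⨆ _ : u <+: v ∧ u ≠ v, splitSigma u

end SplitTree

section Regularity

variable {p d s : ℕ}

/-- The members of `I` that are sent to the left by the split `(j, c)`. -/
def leftPart (z : Fin s → Obs p d) (I : Finset (Fin s)) (j : Fin p) (c : ℝ) : Finset (Fin s) :=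
  I.filter fun i => cov (z i) j < c

/-- The members of `I` that are sent to the right by the split `(j, c)`. -/
def rightPart (z : Fin s → Obs p d) (I : Finset (Fin s)) (j : Fin p) (c : ℝ) : Finset (Fin s) :=
  I.filter fun i => c ≤ cov (z i) j

/-- The number of members of `I` in the treatment group `w`. -/
def groupCount (z : Fin s → Obs p d) (I : Finset (Fin s)) (w : Bool) : ℕ :=
  (I.filter fun i => trt (z i) = w).card

/-- The split `(j, c)` of a node that holds the observations `I` leaves in each child at least the
fraction `α` of `I` and at least `κ` observations of each treatment group. -/
def AdmissibleSplit (α : ℝ) (κ : ℕ) (z : Fin s → Obs p d) (I : Finset (Fin s)) (j : Fin p)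
    (c : ℝ) : Prop :=
  α * (I.card : ℝ) ≤ ((leftPart z I j c).card : ℝ) ∧
  α * (I.card : ℝ) ≤ ((rightPart z I j c).card : ℝ) ∧
  ∀ w : Bool, κ ≤ groupCount z (leftPart z I j c) w ∧ κ ≤ groupCount z (rightPart z I j c) w

/-- `α`-regularity of a tree with respect to the observations `I`. Every split that is made leaves
in each child at least the fraction `α` of the parent's observations and at least `κ` observations
of each treatment group, and growth stops at a node only if there is a feature along which no such
split of the node exists. In particular, growth may stop at any node in which one treatment group
has at most `2 κ - 1` members, and a tree all of whose leaves contain between `κ` and `2 κ - 1`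
observations of each group and all of whose splits respect the fraction `α` is regular. -/
def SplitTree.IsRegular (α : ℝ) (κ : ℕ) (z : Fin s → Obs p d) :
    SplitTree p → Finset (Fin s) → Prop
  | .leaf, I => ∃ j : Fin p, ∀ c : ℝ, ¬ AdmissibleSplit α κ z I j c
  | .node j c l r, I => AdmissibleSplit α κ z I j c ∧
      SplitTree.IsRegular α κ z l (leftPart z I j c) ∧
      SplitTree.IsRegular α κ z r (rightPart z I j c)

end Regularity

/-! ### Randomized tree-growing procedures -/

/-- A randomized procedure that grows a tree from `s` observations. `e : 𝓔` is the auxiliary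
randomness. `second e` is the set of indices of the second half of the sample, which populates the
leaves; the other indices form the first half. -/
structure TreeProcedure (p d s : ℕ) (𝓔 : Type*) [MeasurableSpace 𝓔] where
  /-- The tree grown from given auxiliary randomness and data. -/
  tree : 𝓔 → (Fin s → Obs p d) → SplitTree p
  /-- The part of the sample that populates the leaves. -/
  second : 𝓔 → Finset (Fin s)
  measurable_tree : Measurable fun ez : 𝓔 × (Fin s → Obs p d) => tree ez.1 ez.2
  measurable_second : ∀ i : Fin s, MeasurableSet {e | i ∈ second e}

namespace TreeProcedure

variable {p d s : ℕ} {𝓔 : Type*} [MeasurableSpace 𝓔]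

/-- The number of observations of the second half that are in treatment group `w` and fall into
the leaf of `x`. -/
def leafCount (P : TreeProcedure p d s 𝓔) (x : Fin p → ℝ) (e : 𝓔) (z : Fin s → Obs p d)
    (w : Bool) : ℕ := by
  classical
  exact ((P.second e).filter fun i =>
    cov (z i) ∈ (P.tree e z).leafAt x ∧ trt (z i) = w).card

/-- The weight `S_{i1}` (for `w = true`) or `S_{i0}` (for `w = false`) of observation `i` at `x`
in the tree with auxiliary randomness `e`. -/
def groupWeight (P : TreeProcedure p d s 𝓔) (x : Fin p → ℝ) (e : 𝓔) (z : Fin s → Obs p d)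
    (w : Bool) (i : Fin s) : ℝ := by
  classical
  exact if i ∈ P.second e ∧ cov (z i) ∈ (P.tree e z).leafAt x ∧ trt (z i) = w then
    (if w then 1 else -1) / (P.leafCount x e z w : ℝ) else 0

/-- The weight `S_i = S_{i1} + S_{i0}` of observation `i`. -/
def weight (P : TreeProcedure p d s 𝓔) (x : Fin p → ℝ) (e : 𝓔) (z : Fin s → Obs p d)
    (i : Fin s) : ℝ :=
  P.groupWeight x e z true i + P.groupWeight x e z false i

/-- The weight `S_{i1}` or `S_{i0}` with the auxiliary randomness integrated out. -/
def meanGroupWeight (P : TreeProcedure p d s 𝓔) (ν : Measure 𝓔) (x : Fin p → ℝ)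
    (z : Fin s → Obs p d) (w : Bool) (i : Fin s) : ℝ :=
  ∫ e, P.groupWeight x e z w i ∂ν

/-- Honesty: the sample is split into two halves, and the tree does not depend on the outcomes of
the second half. It may depend on all other data. -/
def IsHonest (P : TreeProcedure p d s 𝓔) : Prop :=
  (∀ e, (P.second e).card = s / 2 ∨ (P.second e).card = (s + 1) / 2) ∧
  ∀ (e : 𝓔) (z z' : Fin s → Obs p d),
    (∀ i, cov (z i) = cov (z' i) ∧ trt (z i) = trt (z' i)) →
    (∀ i, i ∉ P.second e → out (z i) = out (z' i)) →
    P.tree e z = P.tree e z'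

/-- Random splits on the data `z`: at every node, given the splits made at its ancestors and that
the node is split, each feature is used with conditional probability at least `π / p`. -/
def IsRandomSplit (P : TreeProcedure p d s 𝓔) (ν : Measure 𝓔) (π : ℝ) (z : Fin s → Obs p d) :
    Prop :=
  ∀ (v : List Bool) (j : Fin p),
    (fun t => (π / p) *
        ((ν.map fun e => P.tree e z)⟦{t : SplitTree p | t.splitDim v ≠ none} |
          SplitTree.ancestorSigma v⟧) t)
      ≤ᵐ[ν.map fun e => P.tree e z]
    ((ν.map fun e => P.tree e z)⟦{t : SplitTree p | t.splitDim v = some j} |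
        SplitTree.ancestorSigma v⟧)

/-- Symmetry: reordering the observations does not change the law of the (randomized) weights that
the tree gives to the observations. -/
def IsSymmetric (P : TreeProcedure p d s 𝓔) (ν : Measure 𝓔) (x : Fin p → ℝ) : Prop :=
  ∀ (τ : Equiv.Perm (Fin s)) (z : Fin s → Obs p d),
    ν.map (fun e => fun i => P.weight x e (z ∘ τ) i) = ν.map (fun e => fun i => P.weight x e z (τ i))

/-- `α`-regularity, on the data `z`, with respect to the second half of the sample. -/
def IsAlphaRegular (P : TreeProcedure p d s 𝓔) (ν : Measure 𝓔) (α : ℝ) (κ : ℕ)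
    (z : Fin s → Obs p d) : Prop :=
  ∀ᵐ e ∂ν, (P.tree e z).IsRegular α κ z (P.second e)

end TreeProcedure

/-! ### The kernel and the tree estimate -/

section Kernel

variable {d : ℕ} (H : Type*) [NormedAddCommGroup H] [InnerProductSpace ℝ H] [CompleteSpace H]
  [RKHS ℝ H (Fin d → ℝ) ℝ]

/-- The canonical feature `k(y, ·)` in the reproducing kernel Hilbert space `H`. -/
def feature (y : Fin d → ℝ) : H := RKHS.kerFun H y (1 : ℝ)

/-- The scalar reproducing kernel `k(y, y')` of `H`. -/
def scalarKernel (y y' : Fin d → ℝ) : ℝ := RKHS.kernel H y y' (1 : ℝ)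

/-- The causal tree `Γ` at `x`, auxiliary randomness integrated out: the mean of
`∑ i, S_i • k(Y_i, ·)`. -/
def causalTree {p s : ℕ} {𝓔 : Type*} [MeasurableSpace 𝓔] (P : TreeProcedure p d s 𝓔)
    (ν : Measure 𝓔) (x : Fin p → ℝ) (z : Fin s → Obs p d) : H :=
  ∫ e, ∑ i, P.weight x e z i • feature H (out (z i)) ∂ν

/-- The conditional mean embedding `E[k(Y, ·) | X = t]`, where `Q t` is the law of `Y` given
`X = t`. -/
def meanEmbedding {p : ℕ} (Q : Kernel (Fin p → ℝ) (Fin d → ℝ)) (t : Fin p → ℝ) : H :=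
  ∫ y, feature H y ∂(Q t)

/-- `σ²(x, w)`, the conditional expectation of `‖k(Y, ·) - μ^{(w)}(x)‖²` given `X = x`, `W = w`,
where `Q w t` is the law of the potential outcome `Y^w` given `X = t`. (Since `Y = Y^w` on `W = w`
and treatment is unconfounded, `Q w x` is the law of `Y` given `X = x` and `W = w`.) -/
def sigmaSq {p : ℕ} (Q : Bool → Kernel (Fin p → ℝ) (Fin d → ℝ)) (x : Fin p → ℝ) (w : Bool) : ℝ :=
  ∫ y, ‖feature H y - meanEmbedding H (Q w) x‖ ^ 2 ∂(Q w x)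

variable {H} in
/-- `σ_f²(x, w)`, the conditional expectation of `|⟨f, k(Y, ·)⟩ - ⟨f, μ^{(w)}(x)⟩|²` given `X = x`,
`W = w`. -/
def sigmaSqOf {p : ℕ} (Q : Bool → Kernel (Fin p → ℝ) (Fin d → ℝ)) (f : H) (x : Fin p → ℝ)
    (w : Bool) : ℝ :=
  ∫ y, |inner ℝ f (feature H y) - inner ℝ f (meanEmbedding H (Q w) x)| ^ 2 ∂(Q w x)

end Kernel

/-! ### Probability -/

section Prob

variable {Ω : Type*} [MeasurableSpace Ω]

/-- The variance `E ‖ξ - E ξ‖²` of a Hilbert space valued random element. -/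
def hilbertVar {H : Type*} [NormedAddCommGroup H] [InnerProductSpace ℝ H]
    (μ : Measure Ω) (ξ : Ω → H) : ℝ :=
  ∫ ω, ‖ξ ω - ∫ ω', ξ ω' ∂μ‖ ^ 2 ∂μ

/-- The Hájek projection `E[G | Z] - E[G]`. -/
def hajek {H α : Type*} [NormedAddCommGroup H] [InnerProductSpace ℝ H] [CompleteSpace H]
    [mα : MeasurableSpace α] (μ : Measure Ω) (G : Ω → H) (Z : Ω → α) : Ω → H :=
  fun ω => (μ[G | mα.comap Z]) ω - ∫ ω', G ω' ∂μ

/-- Conditional independence of `U` and `V` given `T`. -/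
def CondIndepGiven {α β γ : Type*} [MeasurableSpace α] [MeasurableSpace β]
    [mγ : MeasurableSpace γ] (μ : Measure Ω) (U : Ω → α) (V : Ω → β) (T : Ω → γ) : Prop :=
  ∀ (A : Set α) (B : Set β), MeasurableSet A → MeasurableSet B →
    μ⟦U ⁻¹' A ∩ V ⁻¹' B | mγ.comap T⟧ =ᵐ[μ]
      fun ω => (μ⟦U ⁻¹' A | mγ.comap T⟧) ω * (μ⟦V ⁻¹' B | mγ.comap T⟧) ω

/-- The law `ρ` lives on the unit cube and has there a density bounded away from `0` and `∞`. -/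
def HasBoundedDensityOnCube {p : ℕ} (ρ : Measure (Fin p → ℝ)) : Prop :=
  ∃ (g : (Fin p → ℝ) → ℝ≥0∞) (a b : ℝ≥0), Measurable g ∧ 0 < a ∧
    (∀ t ∈ Set.Icc (0 : Fin p → ℝ) 1, (a : ℝ≥0∞) ≤ g t ∧ g t ≤ b) ∧
    ρ = (volume.restrict (Set.Icc (0 : Fin p → ℝ) 1)).withDensity g

/-- The map `m` is Lipschitz on the unit cube. (All norms on `ℝ^p` are equivalent, so it does not
matter that `Fin p → ℝ` carries the supremum norm.) -/
def LipschitzOnCube {p : ℕ} {E : Type*} [PseudoEMetricSpace E] (m : (Fin p → ℝ) → E) : Prop :=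
  ∃ L : ℝ≥0, LipschitzOnWith L m (Set.Icc (0 : Fin p → ℝ) 1)

/-- The observed data point `(X_i, W_i, Y_i)`, with `Y_i = Y_i^{W_i}`. -/
def observed {p d : ℕ} (X : ℕ → Ω → Fin p → ℝ) (W : ℕ → Ω → Bool)
    (Y : Bool → ℕ → Ω → Fin d → ℝ) (i : ℕ) (ω : Ω) : Obs p d :=
  (X i ω, W i ω, Y (W i ω) i ω)

/-- The sample of the first `s` observed data points. -/
def sample {p d : ℕ} (X : ℕ → Ω → Fin p → ℝ) (W : ℕ → Ω → Bool)
    (Y : Bool → ℕ → Ω → Fin d → ℝ) (s : ℕ) (ω : Ω) : Fin s → Obs p d :=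
  fun i => observed X W Y i ω

/-- `Var(E[S | X, W = w])`, that is, the variance of `E[S | X, W]` under the conditional
probability given `W = w`. -/
def groupVar {α : Type*} [MeasurableSpace α] (μ : Measure Ω) (S : Ω → ℝ) (X : Ω → α)
    (W : Ω → Bool) (w : Bool) : ℝ :=
  Var[μ[S | MeasurableSpace.comap (fun ω => (X ω, W ω)) inferInstance]; μ[|W ⁻¹' {w}]]

end Prob

/-- The value of `(c a₁ q₁ + a₀ q₀) / (c b₁ q₁ + b₀ q₀)` at `c ∈ [0, ∞]`, which for `c = ∞` is its
limit `a₁ / b₁` as `c → ∞`. -/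
def limitRatio (c : ℝ≥0∞) (a b : Bool → ℝ) (q : Bool → ℝ) : ℝ :=
  if c = ∞ then a true / b true
  else (c.toReal * a true * q true + a false * q false) /
    (c.toReal * b true * q true + b false * q false)

end

/-! Averaging over the auxiliary randomness makes the tree a symmetric statistic `weightedSum`, the
sum of S̄_i k(Y_i, ·), where S̄_i is the `meanWeight` of observation i. Split k(Y_i, ·) into its
conditional mean given (X_i, W_i) and a residual. By honesty S̄_i does not depend on Y_i, so given
Z_1 every residual summand except the first has mean zero. The projection of the residual part is
therefore exactly ψ(Z_1) times the residual of Y_1, with ψ = `condWeight` the mean weight given the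
observation (`coordMean_weightedSum_residual`). By symmetry E|ψ| is of order at most 1/s, since the
weights of one group have total mass at most 1 and are shared by s exchangeable observations; as |ψ|
≤ 1, the same bound holds for E ψ².

The conditional mean part is within a multiple of `spread` + `defect` of the constant μ¹(x) - μ⁰(x).
Here `spread` is the weighted distance of the contributing observations from x, and `defect` is the
probability mass on which a treatment group is missing from the leaf. A Bessel inequality for
symmetric statistics (`mul_integral_norm_coordMean_sub_sq_le`) gives its projection a variance of at
most 1/s times E ‖part - constant‖², which is O(E[spread + defect] / s). If E[spread + defect] =
O(s^(-2ε)), Young's inequality with parameter s^(-ε) bounds the cross term by O(s^(-1-ε)). Replacing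
the conditional variance at X_1 by that at x costs O(spread / s), and centring ψ within each group
costs O(1/s²). This is `abs_projectionVar_sub_le`.

For the decay of spread and defect, Chernoff bounds on a grid make the counts in all boxes
comparable to their volumes, up to a small additive error. A node with more than a threshold number
of observations then has an admissible median split along every feature, so growth cannot stop
there. Each split along j discards a child with at least the fraction α of the observations, which
removes a fixed fraction of the side along j. Random splits hit j with conditional probability at
least π/p at each level, so the expected side decays geometrically with the depth
(`integral_pathWeight_le`), while regularity guarantees depth of order log s
(`exists_rate_integral_spread_add_defect`).

The limit of the ratio also needs the variance of ψ within a group not to be negligible against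
s^(-1-ε). A leaf of x holds few observations, so it lies in a box of volume about s^(-γ), and its
points satisfy ∏ |t_j - x_j| ≤ s^(-γ) up to constants. That set has volume O(s^(-γ²)) for every γ <
1. As |ψ| has mass about 1/s on so small a set, Cauchy–Schwarz yields E ψ² of order at least
s^(γ²-2), and γ close to 1 suffices (`weightVar_ge`, `exists_weightVar_ge`). -/

/-! ### Addresses in a tree and measurability of leaves -/

namespace SplitTree

variable {p : ℕ}

/-- The point `t` is sent by the tree to the address `v`, all proper prefixes of which are inner
nodes. -/
def Reaches : SplitTree p → (Fin p → ℝ) → List Bool → Prop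
  | _, _, [] => True
  | leaf, _, _ :: _ => False
  | node j c l r, t, b :: v => if b then c ≤ t j ∧ r.Reaches t v else t j < c ∧ l.Reaches t v

/-- There are only countably many addresses, so describing the leaf through them reduces its joint
measurability in tree and point to single splits. -/
theorem mem_leafAt_iff (T : SplitTree p) (t x : Fin p → ℝ) :
    t ∈ T.leafAt x ↔ ∀ v, T.Reaches x v → T.Reaches t v := by
  induction T with
  | leaf =>
    simp only [leafAt, Set.mem_univ, true_iff]
    rintro (_ | ⟨b, v⟩) h <;> simp_all [Reaches]
  | node j c l r ihl ihr =>
    by_cases hx : x j < c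
    · simp only [leafAt, hx, if_true, Set.mem_inter_iff, Set.mem_ofPred_eq, ihl]
      constructor
      · rintro ⟨h1, h2⟩ (_ | ⟨b, v⟩) h
        · trivial
        · cases b
          · simp only [Reaches, Bool.false_eq_true, if_false] at h ⊢
            exact ⟨h1, h2 v h.2⟩
          · simp only [Reaches, if_true] at h
            exact absurd h.1 (not_le.2 hx)
      · intro h
        refine ⟨?_, fun v hv => ?_⟩
        · have := h [false] (by simp [Reaches, hx])
          simpa [Reaches] using this
        · have := h (false :: v) (by simp [Reaches, hx, hv])
          simp only [Reaches, Bool.false_eq_true, if_false] at this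
          exact this.2
    · simp only [leafAt, hx, if_false, Set.mem_inter_iff, Set.mem_ofPred_eq, ihr]
      have hx' := not_lt.1 hx
      constructor
      · rintro ⟨h1, h2⟩ (_ | ⟨b, v⟩) h
        · trivial
        · cases b
          · simp only [Reaches, Bool.false_eq_true, if_false] at h
            exact absurd h.1 hx
          · simp only [Reaches, if_true] at h ⊢
            exact ⟨h1, h2 v h.2⟩
      · intro h
        refine ⟨?_, fun v hv => ?_⟩
        · have := h [true] (by simp [Reaches, hx'])
          simpa [Reaches] using this
        · have := h (true :: v) (by simp [Reaches, hx', hv])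
          simp only [Reaches, if_true] at this
          exact this.2

/-- The recursion peels off the last direction instead of the first, because `ancestorSigma` grows
along prefixes of an address. -/
theorem reaches_append_singleton (T : SplitTree p) (t : Fin p → ℝ) (v : List Bool) (b : Bool) :
    T.Reaches t (v ++ [b]) ↔ T.Reaches t v ∧
      ∃ j, T.splitDim v = some j ∧ (if b then T.splitThr v ≤ t j else t j < T.splitThr v) := by
  induction T generalizing v with
  | leaf => cases v <;> simp [Reaches, splitDim]
  | node j c l r ihl ihr =>
    rcases v with _ | ⟨b', v⟩
    · cases b <;> simp [Reaches, splitDim, splitThr]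
    · cases b' <;> simp [Reaches, splitDim, splitThr, ihl, ihr, and_assoc]

theorem splitSigma_le (v : List Bool) :
    (splitSigma v : MeasurableSpace (SplitTree p)) ≤
      (inferInstance : MeasurableSpace (SplitTree p)) :=
  le_iSup (fun v => (splitSigma v : MeasurableSpace (SplitTree p))) v

theorem ancestorSigma_le (v : List Bool) :
    (ancestorSigma v : MeasurableSpace (SplitTree p)) ≤
      (inferInstance : MeasurableSpace (SplitTree p)) :=
  iSup₂_le fun u _ => splitSigma_le u

theorem ancestorSigma_mono_append (v : List Bool) (b : Bool) :
    (ancestorSigma v : MeasurableSpace (SplitTree p)) ≤ ancestorSigma (v ++ [b]) := by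
  refine iSup₂_le fun u hu => le_iSup₂_of_le u ⟨hu.1.trans (List.prefix_append _ _), ?_⟩ le_rfl
  rintro rfl
  have := hu.1.length_le
  simp at this

theorem splitSigma_le_ancestorSigma_append (v : List Bool) (b : Bool) :
    (splitSigma v : MeasurableSpace (SplitTree p)) ≤ ancestorSigma (v ++ [b]) :=
  le_iSup₂_of_le v ⟨List.prefix_append _ _, by simp⟩ le_rfl

theorem measurable_splitDim (v : List Bool) :
    Measurable[splitSigma v, ⊤] fun T : SplitTree p => T.splitDim v :=
  Measurable.mono (comap_measurable _) le_sup_left le_rfl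

theorem measurable_splitThr (v : List Bool) :
    Measurable[splitSigma v] fun T : SplitTree p => T.splitThr v :=
  Measurable.mono (comap_measurable _) le_sup_right le_rfl

theorem measurableSet_splitDim (v : List Bool) (A : Set (Option (Fin p))) :
    MeasurableSet[splitSigma v] {T : SplitTree p | T.splitDim v ∈ A} :=
  measurable_splitDim v trivial

theorem measurableSet_goes (v : List Bool) (b : Bool) (x : Fin p → ℝ) :
    MeasurableSet[splitSigma v] {T : SplitTree p | ∃ j, T.splitDim v = some j ∧
      (if b then T.splitThr v ≤ x j else x j < T.splitThr v)} := by
  have : {T : SplitTree p | ∃ j, T.splitDim v = some j ∧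
      (if b then T.splitThr v ≤ x j else x j < T.splitThr v)} =
      ⋃ j, ({T : SplitTree p | T.splitDim v ∈ ({some j} : Set (Option (Fin p)))} ∩
        {T | if b then T.splitThr v ≤ x j else x j < T.splitThr v}) := by
    ext T; simp
  rw [this]
  refine MeasurableSet.iUnion fun j => (measurableSet_splitDim v _).inter ?_
  cases b
  · simpa using measurableSet_lt measurable_const (measurable_splitThr v)
  · simpa using measurableSet_le (measurable_splitThr v) measurable_const

theorem measurableSet_reaches (x : Fin p → ℝ) (v : List Bool) :
    MeasurableSet[ancestorSigma v] {T : SplitTree p | T.Reaches x v} := by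
  induction v using List.reverseRecOn with
  | nil => simp [Reaches]
  | append_singleton v b ih =>
    simp only [reaches_append_singleton]
    exact (ancestorSigma_mono_append v b _ ih).inter
      (splitSigma_le_ancestorSigma_append v b _ (measurableSet_goes v b x))

theorem measurableSet_reaches_prod (v : List Bool) :
    MeasurableSet {a : SplitTree p × (Fin p → ℝ) | a.1.Reaches a.2 v} := by
  induction v using List.reverseRecOn with
  | nil => simp [Reaches]
  | append_singleton v b ih =>
    simp only [reaches_append_singleton]
    refine ih.inter ?_
    have : {a : SplitTree p × (Fin p → ℝ) | ∃ j, a.1.splitDim v = some j ∧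
        (if b then a.1.splitThr v ≤ a.2 j else a.2 j < a.1.splitThr v)} =
        ⋃ j, (Prod.fst ⁻¹' {T : SplitTree p | T.splitDim v ∈ ({some j} : Set (Option (Fin p)))} ∩
          {a : SplitTree p × (Fin p → ℝ) |
            if b then a.1.splitThr v ≤ a.2 j else a.2 j < a.1.splitThr v}) := by
      ext T; simp
    have h1 : Measurable fun a : SplitTree p × (Fin p → ℝ) => a.1.splitThr v :=
      ((measurable_splitThr v).mono (splitSigma_le v) le_rfl).comp measurable_fst
    refine (congrArg MeasurableSet this).mpr ?_
    refine MeasurableSet.iUnion fun j =>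
      (measurable_fst (splitSigma_le v _ (measurableSet_splitDim v _))).inter ?_
    have h2 : Measurable fun a : SplitTree p × (Fin p → ℝ) => a.2 j :=
      (measurable_pi_apply j).comp measurable_snd
    cases b
    · simpa using measurableSet_lt h2 h1
    · simpa using measurableSet_le h1 h2

theorem measurableSet_mem_leafAt (x : Fin p → ℝ) :
    MeasurableSet {a : SplitTree p × (Fin p → ℝ) | a.2 ∈ a.1.leafAt x} := by
  have : {a : SplitTree p × (Fin p → ℝ) | a.2 ∈ a.1.leafAt x} =
      ⋂ v : List Bool, ((Prod.fst ⁻¹' {T : SplitTree p | T.Reaches x v})ᶜ ∪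
        {a | a.1.Reaches a.2 v}) := by
    ext a
    simp only [Set.mem_ofPred_eq, mem_leafAt_iff, Set.mem_iInter, Set.mem_union, Set.mem_compl_iff,
      Set.mem_preimage]
    exact forall_congr' fun v => imp_iff_not_or
  rw [this]
  exact MeasurableSet.iInter fun v =>
    (measurable_fst (ancestorSigma_le v _ (measurableSet_reaches x v))).compl.union
      (measurableSet_reaches_prod v)

end SplitTree

/-! ### Weights: measurability, normalisation, symmetry, honesty -/

theorem measurable_cov {p d : ℕ} : Measurable (cov : Obs p d → Fin p → ℝ) := measurable_fst

theorem measurable_trt {p d : ℕ} : Measurable (trt : Obs p d → Bool) :=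
  measurable_fst.comp measurable_snd

theorem measurable_out {p d : ℕ} : Measurable (out : Obs p d → Fin d → ℝ) :=
  measurable_snd.comp measurable_snd

namespace TreeProcedure

variable {p d s : ℕ} {𝓔 : Type*} [MeasurableSpace 𝓔]

/-- Observation `i` belongs to the second half, to the leaf of `x` and to the group `w`. -/
def InLeaf (P : TreeProcedure p d s 𝓔) (x : Fin p → ℝ) (w : Bool) (i : Fin s)
    (a : 𝓔 × (Fin s → Obs p d)) : Prop :=
  i ∈ P.second a.1 ∧ cov (a.2 i) ∈ (P.tree a.1 a.2).leafAt x ∧ trt (a.2 i) = w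

theorem measurableSet_inLeaf (P : TreeProcedure p d s 𝓔) (x : Fin p → ℝ) (w : Bool) (i : Fin s) :
    MeasurableSet {a | P.InLeaf x w i a} := by
  refine (measurable_fst (P.measurable_second i)).inter (MeasurableSet.inter ?_ ?_)
  · exact (P.measurable_tree.prodMk
      (measurable_cov.comp ((measurable_pi_apply i).comp measurable_snd)))
      (SplitTree.measurableSet_mem_leafAt x)
  · exact (measurable_trt.comp ((measurable_pi_apply i).comp measurable_snd))
      (measurableSet_singleton w)

open Classical in
theorem leafCount_eq_sum (P : TreeProcedure p d s 𝓔) (x : Fin p → ℝ) (e : 𝓔)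
    (z : Fin s → Obs p d) (w : Bool) :
    (P.leafCount x e z w : ℝ) = ∑ i, if P.InLeaf x w i (e, z) then (1 : ℝ) else 0 := by
  rw [Finset.sum_boole, leafCount]
  congr 2
  ext i
  rw [Finset.mem_filter, Finset.mem_filter]
  exact ⟨fun h => ⟨Finset.mem_univ _, h.1, h.2⟩, fun h => ⟨h.2.1, h.2.2⟩⟩

theorem measurable_leafCount (P : TreeProcedure p d s 𝓔) (x : Fin p → ℝ) (w : Bool) :
    Measurable fun a : 𝓔 × (Fin s → Obs p d) => (P.leafCount x a.1 a.2 w : ℝ) := by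
  classical
  simp only [leafCount_eq_sum]
  exact Finset.measurable_sum _ fun i _ =>
    Measurable.ite (P.measurableSet_inLeaf x w i) measurable_const measurable_const

open Classical in
theorem groupWeight_eq (P : TreeProcedure p d s 𝓔) (x : Fin p → ℝ) (e : 𝓔)
    (z : Fin s → Obs p d) (w : Bool) (i : Fin s) :
    P.groupWeight x e z w i = if P.InLeaf x w i (e, z) then
      (if w then 1 else -1) / (P.leafCount x e z w : ℝ) else 0 := by
  rw [groupWeight]
  exact if_congr Iff.rfl rfl rfl

theorem measurable_groupWeight (P : TreeProcedure p d s 𝓔) (x : Fin p → ℝ) (w : Bool)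
    (i : Fin s) : Measurable fun a : 𝓔 × (Fin s → Obs p d) => P.groupWeight x a.1 a.2 w i := by
  classical
  simp only [groupWeight_eq]
  exact Measurable.ite (P.measurableSet_inLeaf x w i)
    (measurable_const.div (P.measurable_leafCount x w)) measurable_const

theorem measurable_weight (P : TreeProcedure p d s 𝓔) (x : Fin p → ℝ)
    (i : Fin s) : Measurable fun a : 𝓔 × (Fin s → Obs p d) => P.weight x a.1 a.2 i :=
  (P.measurable_groupWeight x true i).add (P.measurable_groupWeight x false i)

/-- The sign of the weights of a treatment group. -/
def groupSign (w : Bool) : ℝ := if w then 1 else -1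

theorem groupSign_mul_self (w : Bool) : groupSign w * groupSign w = 1 := by
  cases w <;> simp [groupSign]

theorem abs_groupSign (w : Bool) : |groupSign w| = 1 := by
  cases w <;> simp [groupSign]

theorem groupSign_mul_groupWeight_nonneg (P : TreeProcedure p d s 𝓔) (x : Fin p → ℝ) (e : 𝓔)
    (z : Fin s → Obs p d) (w : Bool) (i : Fin s) :
    0 ≤ groupSign w * P.groupWeight x e z w i := by
  classical
  rw [groupWeight_eq]
  change 0 ≤ groupSign w * (if P.InLeaf x w i (e, z) then
      groupSign w / (P.leafCount x e z w : ℝ) else 0)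
  split_ifs
  · rw [← mul_div_assoc, groupSign_mul_self]; positivity
  · simp

theorem sum_groupSign_mul_groupWeight (P : TreeProcedure p d s 𝓔) (x : Fin p → ℝ) (e : 𝓔)
    (z : Fin s → Obs p d) (w : Bool) :
    ∑ i, groupSign w * P.groupWeight x e z w i = if P.leafCount x e z w = 0 then 0 else 1 := by
  classical
  have h : ∀ i, groupSign w * P.groupWeight x e z w i =
      (if P.InLeaf x w i (e, z) then (1 : ℝ) else 0) / P.leafCount x e z w := by
    intro i
    rw [groupWeight_eq]
    change groupSign w * (if P.InLeaf x w i (e, z) then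
      groupSign w / (P.leafCount x e z w : ℝ) else 0) = _
    split_ifs
    · rw [← mul_div_assoc, groupSign_mul_self]
    · simp
  simp only [h]
  rw [← Finset.sum_div, ← leafCount_eq_sum]
  split_ifs with h0
  · simp [h0]
  · exact div_self (Nat.cast_ne_zero.2 h0)

theorem sum_groupSign_mul_groupWeight_le (P : TreeProcedure p d s 𝓔) (x : Fin p → ℝ) (e : 𝓔)
    (z : Fin s → Obs p d) (w : Bool) :
    ∑ i, groupSign w * P.groupWeight x e z w i ≤ 1 := by
  rw [sum_groupSign_mul_groupWeight]; split_ifs <;> norm_num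

theorem abs_groupWeight_le (P : TreeProcedure p d s 𝓔) (x : Fin p → ℝ) (e : 𝓔)
    (z : Fin s → Obs p d) (w : Bool) (i : Fin s) : |P.groupWeight x e z w i| ≤ 1 := by
  have h := P.sum_groupSign_mul_groupWeight_le x e z w
  have h1 := Finset.single_le_sum (fun i _ => P.groupSign_mul_groupWeight_nonneg x e z w i)
    (Finset.mem_univ i)
  have h2 := P.groupSign_mul_groupWeight_nonneg x e z w i
  calc |P.groupWeight x e z w i| = |groupSign w * P.groupWeight x e z w i| := by
        rw [abs_mul, abs_groupSign, one_mul]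
    _ ≤ 1 := by rw [abs_of_nonneg h2]; exact h1.trans h

theorem groupWeight_eq_zero_of_trt_ne (P : TreeProcedure p d s 𝓔) (x : Fin p → ℝ) (e : 𝓔)
    (z : Fin s → Obs p d) {w : Bool} {i : Fin s} (h : trt (z i) ≠ w) :
    P.groupWeight x e z w i = 0 := by
  classical
  rw [groupWeight_eq, if_neg]
  exact fun h' => h h'.2.2

theorem weight_eq_groupWeight (P : TreeProcedure p d s 𝓔) (x : Fin p → ℝ) (e : 𝓔)
    (z : Fin s → Obs p d) (i : Fin s) : P.weight x e z i = P.groupWeight x e z (trt (z i)) i := by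
  unfold weight
  cases h : trt (z i)
  · rw [P.groupWeight_eq_zero_of_trt_ne x e z (w := true) (by simp [h]), zero_add]
  · rw [P.groupWeight_eq_zero_of_trt_ne x e z (w := false) (by simp [h]), add_zero]

theorem groupWeight_eq_ite (P : TreeProcedure p d s 𝓔) (x : Fin p → ℝ) (e : 𝓔)
    (z : Fin s → Obs p d) (w : Bool) (i : Fin s) :
    P.groupWeight x e z w i = if trt (z i) = w then P.weight x e z i else 0 := by
  split_ifs with h
  · rw [weight_eq_groupWeight, h]
  · exact P.groupWeight_eq_zero_of_trt_ne x e z h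

theorem abs_weight_le (P : TreeProcedure p d s 𝓔) (x : Fin p → ℝ) (e : 𝓔)
    (z : Fin s → Obs p d) (i : Fin s) : |P.weight x e z i| ≤ 1 := by
  rw [weight_eq_groupWeight]; exact P.abs_groupWeight_le x e z _ i

section Mean

set_option linter.unusedSectionVars false

variable (P : TreeProcedure p d s 𝓔) (ν : Measure 𝓔) [IsProbabilityMeasure ν] (x : Fin p → ℝ)

/-- The weight of observation `i`, averaged over the auxiliary randomness. -/
noncomputable def meanWeight (z : Fin s → Obs p d) (i : Fin s) : ℝ := ∫ e, P.weight x e z i ∂ν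

theorem integrable_groupWeight (z : Fin s → Obs p d) (w : Bool) (i : Fin s) :
    Integrable (fun e => P.groupWeight x e z w i) ν :=
  Integrable.of_bound ((P.measurable_groupWeight x w i).comp
    (measurable_id.prodMk measurable_const)).aestronglyMeasurable 1
    (Eventually.of_forall fun e => P.abs_groupWeight_le x e z w i)

theorem integrable_weight (z : Fin s → Obs p d) (i : Fin s) :
    Integrable (fun e => P.weight x e z i) ν :=
  (P.integrable_groupWeight ν x z true i).add (P.integrable_groupWeight ν x z false i)

theorem measurable_meanGroupWeight (w : Bool) (i : Fin s) :
    Measurable fun z => P.meanGroupWeight ν x z w i :=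
  ((P.measurable_groupWeight x w i).comp measurable_swap).stronglyMeasurable.integral_prod_right'
    |>.measurable

theorem measurable_meanWeight (i : Fin s) : Measurable fun z => P.meanWeight ν x z i :=
  ((P.measurable_weight x i).comp measurable_swap).stronglyMeasurable.integral_prod_right'
    |>.measurable

theorem meanGroupWeight_eq_ite (z : Fin s → Obs p d) (w : Bool) (i : Fin s) :
    P.meanGroupWeight ν x z w i = if trt (z i) = w then P.meanWeight ν x z i else 0 := by
  simp only [meanGroupWeight, groupWeight_eq_ite, meanWeight]
  split_ifs <;> simp

theorem meanWeight_sign (z : Fin s → Obs p d) (i : Fin s) :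
    0 ≤ groupSign (trt (z i)) * P.meanWeight ν x z i := by
  rw [meanWeight, ← integral_const_mul]
  refine integral_nonneg fun e => ?_
  simp only [weight_eq_groupWeight]
  exact P.groupSign_mul_groupWeight_nonneg x e z _ i

theorem abs_meanWeight_eq (z : Fin s → Obs p d) (i : Fin s) :
    |P.meanWeight ν x z i| = groupSign (trt (z i)) * P.meanWeight ν x z i := by
  rw [← abs_of_nonneg (P.meanWeight_sign ν x z i), abs_mul, abs_groupSign, one_mul]

/-- Weights within a group share one sign, so absolute values commute with averaging over the
auxiliary randomness. For fixed randomness the group's weights sum to one in absolute value unless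
the group is absent from the leaf. -/
theorem sum_abs_meanWeight_group (z : Fin s → Obs p d) (w : Bool) :
    ∑ i, (if trt (z i) = w then |P.meanWeight ν x z i| else 0) =
      ν.real {e | P.leafCount x e z w ≠ 0} := by
  have h1 : ∀ i, (if trt (z i) = w then |P.meanWeight ν x z i| else 0) =
      ∫ e, groupSign w * P.groupWeight x e z w i ∂ν := by
    intro i
    simp only [groupWeight_eq_ite]
    split_ifs with h
    · rw [abs_meanWeight_eq, h, meanWeight, integral_const_mul]
    · simp
  simp only [h1]
  rw [← integral_finsetSum _ fun i _ => (P.integrable_groupWeight ν x z w i).const_mul _]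
  simp only [sum_groupSign_mul_groupWeight]
  have hm : MeasurableSet {e | P.leafCount x e z w ≠ 0} := by
    have := ((P.measurable_leafCount x w).comp
      (measurable_id.prodMk (measurable_const (a := z)))) (measurableSet_singleton (0 : ℝ)).compl
    convert this using 1
    ext e; simp
  rw [← integral_indicator_one hm]
  congr 1
  ext e
  by_cases h : P.leafCount x e z w = 0 <;> simp [h]

theorem sum_abs_meanWeight_group_le (z : Fin s → Obs p d) (w : Bool) :
    ∑ i, (if trt (z i) = w then |P.meanWeight ν x z i| else 0) ≤ 1 := by
  rw [sum_abs_meanWeight_group]; exact measureReal_le_one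

theorem abs_meanWeight_le (z : Fin s → Obs p d) (i : Fin s) : |P.meanWeight ν x z i| ≤ 1 := by
  have h := Finset.single_le_sum (f := fun k => if trt (z k) = trt (z i) then
    |P.meanWeight ν x z k| else 0) (fun k _ => by positivity) (Finset.mem_univ i)
  simp only [if_true] at h
  exact h.trans (P.sum_abs_meanWeight_group_le ν x z _)

theorem meanWeight_symm (hP : P.IsSymmetric ν x) (τ : Equiv.Perm (Fin s)) (z : Fin s → Obs p d)
    (i : Fin s) : P.meanWeight ν x (z ∘ τ) i = P.meanWeight ν x z (τ i) := by
  have h := hP τ z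
  have hm : ∀ z : Fin s → Obs p d, ∀ i, Measurable fun e => P.weight x e z i := fun z i =>
    (P.measurable_weight x i).comp (measurable_id.prodMk measurable_const)
  have h1 : ∀ u : 𝓔 → Fin s → ℝ, Measurable u →
      ∫ e, u e i ∂ν = ∫ y, y i ∂(ν.map u) := by
    intro u hu
    rw [integral_map hu.aemeasurable (measurable_pi_apply i).aestronglyMeasurable]
  rw [meanWeight, h1 (fun e i => P.weight x e (z ∘ τ) i) (measurable_pi_lambda _ (hm _)), h,
    ← h1 _ (measurable_pi_lambda _ fun i => hm z (τ i))]
  rfl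

theorem tree_update_out (hP : P.IsHonest) (e : 𝓔) (z : Fin s → Obs p d) (i : Fin s)
    (hi : i ∈ P.second e) {a b : Obs p d} (h1 : cov a = cov b) (h2 : trt a = trt b) :
    P.tree e (Function.update z i a) = P.tree e (Function.update z i b) := by
  refine hP.2 e _ _ (fun k => ?_) fun k hk => ?_
  · by_cases h : k = i
    · subst h; simp [h1, h2]
    · simp [h]
  · have : k ≠ i := fun h => hk (h ▸ hi)
    simp [this]

/-- If i is in the second half, honesty keeps the tree unchanged when Y_i changes; otherwise the
weight of i is zero in both cases. -/
theorem meanWeight_update_out (hP : P.IsHonest) (z : Fin s → Obs p d) (i : Fin s)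
    {a b : Obs p d} (h1 : cov a = cov b) (h2 : trt a = trt b) :
    P.meanWeight ν x (Function.update z i a) i = P.meanWeight ν x (Function.update z i b) i := by
  classical
  unfold meanWeight
  congr 1
  ext e
  have hcov : ∀ k, cov (Function.update z i a k) = cov (Function.update z i b k) := fun k => by
    by_cases h : k = i
    · subst h; simp [h1]
    · simp [h]
  have htrt : ∀ k, trt (Function.update z i a k) = trt (Function.update z i b k) := fun k => by
    by_cases h : k = i
    · subst h; simp [h2]
    · simp [h]
  by_cases hi : i ∈ P.second e
  · have ht := P.tree_update_out hP e z i hi h1 h2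
    have hin : ∀ w k, P.InLeaf x w k (e, Function.update z i a) ↔
        P.InLeaf x w k (e, Function.update z i b) := fun w k => by
      simp only [InLeaf, hcov, htrt, ht]
    have hc : ∀ w, (P.leafCount x e (Function.update z i a) w : ℝ) =
        P.leafCount x e (Function.update z i b) w := fun w => by
      simp only [leafCount_eq_sum, hin]
    simp only [weight, groupWeight_eq, hin, hc]
  · have hin : ∀ w z, ¬ P.InLeaf x w i (e, z) := fun w z h => hi h.1
    simp [weight, groupWeight_eq, hin]

end Mean

end TreeProcedure

/-! ### Random splits: geometric decay of path weights -/

namespace SplitTree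

variable {p : ℕ}

open Classical in
/-- The factor `r` if a split uses the feature `j`, else `1`. -/
noncomputable def splitFactor (r : ℝ) (j j' : Fin p) : ℝ := if j' = j then r else 1

/-- The product of `r` over the splits along `j` among the first `k` splits on the way of `x`,
and `0` if there are fewer than `k` splits. -/
noncomputable def pathWeight (r : ℝ) (j : Fin p) (x : Fin p → ℝ) : SplitTree p → ℕ → ℝ
  | _, 0 => 1
  | leaf, _ + 1 => 0
  | node j' c lt rt, k + 1 => splitFactor r j j' *
      (if x j' < c then pathWeight r j x lt k else pathWeight r j x rt k)

/-- The part of `pathWeight` that comes from the address `v`. -/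
noncomputable def addressWeight (r : ℝ) (j : Fin p) (x : Fin p → ℝ) :
    SplitTree p → List Bool → ℝ
  | _, [] => 1
  | leaf, _ :: _ => 0
  | node j' c lt rt, b :: v => splitFactor r j j' *
      (if b then (if x j' < c then 0 else addressWeight r j x rt v)
        else (if x j' < c then addressWeight r j x lt v else 0))

/-- The sum over all addresses of length `k`. -/
def addressSum : ℕ → (List Bool → ℝ) → ℝ
  | 0, g => g []
  | k + 1, g => addressSum k (fun v => g (true :: v)) + addressSum k (fun v => g (false :: v))

/-- The new direction is appended at the end, so that the weight of v is measurable with respect to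
the ancestors of v when the split at v is considered. -/
theorem addressSum_succ' (k : ℕ) (g : List Bool → ℝ) :
    addressSum (k + 1) g = addressSum k fun v => g (v ++ [true]) + g (v ++ [false]) := by
  induction k generalizing g with
  | zero => rfl
  | succ k ih =>
    rw [addressSum, ih, ih]
    rfl

theorem addressSum_mono (k : ℕ) {g h : List Bool → ℝ} (hgh : ∀ v, g v ≤ h v) :
    addressSum k g ≤ addressSum k h := by
  induction k generalizing g h with
  | zero => exact hgh _
  | succ k ih => exact add_le_add (ih fun v => hgh _) (ih fun v => hgh _)

theorem addressSum_mul_left (k : ℕ) (a : ℝ) (g : List Bool → ℝ) :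
    addressSum k (fun v => a * g v) = a * addressSum k g := by
  induction k generalizing g with
  | zero => rfl
  | succ k ih => simp only [addressSum, ih, mul_add]

theorem addressSum_zero (k : ℕ) : addressSum k (fun _ => 0) = 0 := by
  induction k with
  | zero => rfl
  | succ k ih => simp [addressSum, ih]

theorem integrable_addressSum {α : Type*} [MeasurableSpace α] {μ : Measure α} (k : ℕ)
    {g : α → List Bool → ℝ} (hg : ∀ v, Integrable (fun a => g a v) μ) :
    Integrable (fun a => addressSum k (g a)) μ := by
  induction k generalizing g with
  | zero => exact hg _
  | succ k ih => exact (ih fun v => hg _).add (ih fun v => hg _)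

theorem integral_addressSum {α : Type*} [MeasurableSpace α] {μ : Measure α} (k : ℕ)
    {g : α → List Bool → ℝ} (hg : ∀ v, Integrable (fun a => g a v) μ) :
    ∫ a, addressSum k (g a) ∂μ = addressSum k fun v => ∫ a, g a v ∂μ := by
  induction k generalizing g with
  | zero => rfl
  | succ k ih =>
    simp only [addressSum]
    rw [integral_add (integrable_addressSum k fun v => hg _)
      (integrable_addressSum k fun v => hg _), ih fun v => hg _, ih fun v => hg _]

/-- At most one address of length k lies on the way of x, so at most one term is nonzero. The random
path becomes a sum over deterministic addresses, to which the conditional split probabilities apply.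
-/
theorem pathWeight_eq_addressSum (r : ℝ) (j : Fin p) (x : Fin p → ℝ) (T : SplitTree p) (k : ℕ) :
    pathWeight r j x T k = addressSum k (addressWeight r j x T) := by
  induction k generalizing T with
  | zero => cases T <;> rfl
  | succ k ih =>
    cases T with
    | leaf => simp [pathWeight, addressSum, addressWeight, addressSum_zero]
    | node j' c lt rt =>
      by_cases h : x j' < c <;>
      simp [pathWeight, addressSum, addressWeight, h, addressSum_mul_left, addressSum_zero, ih]

theorem addressWeight_append (r : ℝ) (j : Fin p) (x : Fin p → ℝ) (T : SplitTree p)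
    (v : List Bool) (b : Bool) : addressWeight r j x T (v ++ [b]) =
      addressWeight r j x T v * ((T.splitDim v).elim 0 (splitFactor r j)) *
        {T : SplitTree p | ∃ j, T.splitDim v = some j ∧
          (if b then T.splitThr v ≤ x j else x j < T.splitThr v)}.indicator 1 T := by
  induction T generalizing v with
  | leaf => cases v <;> simp [addressWeight, splitDim]
  | node j' c l r ihl ihr =>
    rcases v with _ | ⟨b', v⟩
    · cases b <;> by_cases h : x j' < c <;>
        simp [addressWeight, splitDim, splitThr, Set.indicator, h, not_lt.1, not_le.2]
    · cases b' <;> by_cases h : x j' < c <;>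
        simp [addressWeight, splitDim, splitThr, Set.indicator, h, ihl, ihr, mul_assoc]

/-- The point x takes exactly one of the two directions at an inner node, so the thresholds drop out
and only the feature of the split remains. -/
theorem addressWeight_append_add (r : ℝ) (j : Fin p) (x : Fin p → ℝ) (T : SplitTree p)
    (v : List Bool) : addressWeight r j x T (v ++ [true]) + addressWeight r j x T (v ++ [false]) =
      addressWeight r j x T v * ((T.splitDim v).elim 0 (splitFactor r j)) := by
  rw [addressWeight_append, addressWeight_append, ← mul_add]
  cases h : T.splitDim v with
  | none => simp
  | some j' =>
    by_cases h' : x j' < T.splitThr v <;>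
    simp [Set.indicator, h, h', not_lt.1, not_le.2]

theorem stronglyMeasurable_addressWeight (r : ℝ) (j : Fin p) (x : Fin p → ℝ) (v : List Bool) :
    StronglyMeasurable[ancestorSigma v] fun T : SplitTree p => addressWeight r j x T v := by
  induction v using List.reverseRecOn with
  | nil =>
    have : (fun T : SplitTree p => addressWeight r j x T []) = fun _ => 1 := by
      ext T; cases T <;> rfl
    rw [this]; exact stronglyMeasurable_const
  | append_singleton v b ih =>
    simp only [addressWeight_append]
    refine ((ih.mono (ancestorSigma_mono_append v b)).mul ?_).mul ?_
    · refine StronglyMeasurable.mono ?_ (splitSigma_le_ancestorSigma_append v b)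
      refine Measurable.stronglyMeasurable ?_
      exact (measurable_from_top
        (f := fun o : Option (Fin p) => o.elim (0 : ℝ) (splitFactor r j))).comp
        (measurable_splitDim v)
    · exact stronglyMeasurable_one.indicator
        (splitSigma_le_ancestorSigma_append v b _ (measurableSet_goes v b x))

theorem splitFactor_mem {r : ℝ} (h0 : 0 ≤ r) (h1 : r ≤ 1) (j j' : Fin p) :
    0 ≤ splitFactor r j j' ∧ splitFactor r j j' ≤ 1 := by
  unfold splitFactor; split_ifs <;> constructor <;> linarith

theorem addressWeight_mem {r : ℝ} (h0 : 0 ≤ r) (h1 : r ≤ 1) (j : Fin p) (x : Fin p → ℝ)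
    (T : SplitTree p) (v : List Bool) :
    0 ≤ addressWeight r j x T v ∧ addressWeight r j x T v ≤ 1 := by
  induction v generalizing T with
  | nil => cases T <;> simp [addressWeight]
  | cons b v ih =>
    cases T with
    | leaf => simp [addressWeight]
    | node j' c lt rt =>
      have hf := splitFactor_mem h0 h1 j j'
      have hl := ih lt
      have hr := ih rt
      have key : ∀ y : ℝ, 0 ≤ y ∧ y ≤ 1 →
          0 ≤ splitFactor r j j' * y ∧ splitFactor r j j' * y ≤ 1 := fun y hy =>
        ⟨mul_nonneg hf.1 hy.1, mul_le_one₀ hf.2 hy.1 hy.2⟩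
      rw [addressWeight]
      apply key
      split_ifs <;> simp_all

theorem pathWeight_nonneg {r : ℝ} (h0 : 0 ≤ r) (j : Fin p) (x : Fin p → ℝ)
    (T : SplitTree p) (k : ℕ) : 0 ≤ pathWeight r j x T k := by
  induction k generalizing T with
  | zero => cases T <;> simp [pathWeight]
  | succ k ih =>
    cases T with
    | leaf => simp [pathWeight]
    | node j' c lt rt =>
      rw [pathWeight]
      refine mul_nonneg ?_ ?_
      · unfold splitFactor; split_ifs <;> linarith
      · split_ifs
        exacts [ih _, ih _]

theorem integrable_addressWeight (l : Measure (SplitTree p)) [IsProbabilityMeasure l] {r : ℝ}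
    (h0 : 0 ≤ r) (h1 : r ≤ 1) (j : Fin p) (x : Fin p → ℝ) (v : List Bool) :
    Integrable (fun T => addressWeight r j x T v) l :=
  Integrable.of_bound ((stronglyMeasurable_addressWeight r j x v).mono
    (ancestorSigma_le v)).aestronglyMeasurable 1 (Eventually.of_forall fun T => by
      have := addressWeight_mem h0 h1 j x T v
      rw [Real.norm_eq_abs, abs_of_nonneg this.1]; exact this.2)

theorem integrable_pathWeight (l : Measure (SplitTree p)) [IsProbabilityMeasure l] {r : ℝ}
    (h0 : 0 ≤ r) (h1 : r ≤ 1) (j : Fin p) (x : Fin p → ℝ) (k : ℕ) :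
    Integrable (fun T => pathWeight r j x T k) l := by
  simp only [pathWeight_eq_addressSum]
  exact integrable_addressSum k (integrable_addressWeight l h0 h1 j x)

theorem integral_mul_condExp_indicator {α : Type*} {m m0 : MeasurableSpace α} (hm : m ≤ m0)
    (l : Measure α) [IsProbabilityMeasure l] {g : α → ℝ} (hg : StronglyMeasurable[m] g)
    (hb : ∀ a, |g a| ≤ 1) {A : Set α} (hA : MeasurableSet A) :
    Integrable (fun a => g a * (l⟦A|m⟧) a) l ∧
      ∫ a, g a * (l⟦A|m⟧) a ∂l = ∫ a, g a * A.indicator (fun _ => 1) a ∂l := by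
  have hi : Integrable (A.indicator fun _ => (1 : ℝ)) l := (integrable_const 1).indicator hA
  have hgi : Integrable (g * A.indicator fun _ => (1 : ℝ)) l :=
    hi.bdd_mul (hg.mono hm).aestronglyMeasurable
      (Eventually.of_forall fun a => by rw [Real.norm_eq_abs]; exact hb a)
  have h := condExp_mul_of_stronglyMeasurable_left hg hgi hi
  constructor
  · exact (integrable_condExp.congr h)
  · calc ∫ a, g a * (l⟦A|m⟧) a ∂l = ∫ a, (l[g * A.indicator (fun _ => (1 : ℝ))|m]) a ∂l :=
        (integral_congr_ae h).symm
      _ = _ := integral_condExp hm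

/-- Given the ancestors of a node, a further split has feature j with probability at least q, so one
more level multiplies the expected weight by at most 1 - (1 - r) q. Paths that end too early carry
weight zero and only help. -/
theorem integral_pathWeight_le (l : Measure (SplitTree p)) [IsProbabilityMeasure l] {r q π₀ : ℝ}
    (h0 : 0 ≤ r) (h1 : r ≤ 1) (hq : q ≤ π₀) (hq1 : q ≤ 1) (hq0 : 0 ≤ q)
    (j : Fin p) (x : Fin p → ℝ)
    (hl : ∀ v : List Bool, (fun t => π₀ * (l⟦{t : SplitTree p | t.splitDim v ≠ none} |
        ancestorSigma v⟧) t) ≤ᵐ[l] (l⟦{t : SplitTree p | t.splitDim v = some j} |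
        ancestorSigma v⟧)) (k : ℕ) :
    ∫ T, pathWeight r j x T k ∂l ≤ (1 - (1 - r) * q) ^ k := by
  induction k with
  | zero =>
    have : ∀ T : SplitTree p, pathWeight r j x T 0 = 1 := fun T => by cases T <;> rfl
    simp [this]
  | succ k ih =>
    have hI := integrable_addressWeight l h0 h1 j x
    have hr : 0 ≤ 1 - (1 - r) * q := by nlinarith
    have hm : ∀ v : List Bool, ∀ A : Set (Option (Fin p)),
        MeasurableSet {T : SplitTree p | T.splitDim v ∈ A} := fun v A =>
      splitSigma_le v _ (measurableSet_splitDim v A)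
    have step : ∀ v : List Bool, ∫ T, (addressWeight r j x T (v ++ [true]) +
        addressWeight r j x T (v ++ [false])) ∂l ≤
        (1 - (1 - r) * q) * ∫ T, addressWeight r j x T v ∂l := by
      intro v
      have hb : ∀ T : SplitTree p, |addressWeight r j x T v| ≤ 1 := fun T => by
        have := addressWeight_mem h0 h1 j x T v
        rw [abs_of_nonneg this.1]; exact this.2
      obtain ⟨i1, e1⟩ := integral_mul_condExp_indicator (ancestorSigma_le v) l
        (stronglyMeasurable_addressWeight r j x v) hb (hm v {none}ᶜ)
      obtain ⟨i2, e2⟩ := integral_mul_condExp_indicator (ancestorSigma_le v) l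
        (stronglyMeasurable_addressWeight r j x v) hb (hm v {some j})
      have hpos : 0 ≤ ∫ T, addressWeight r j x T v *
          {T : SplitTree p | T.splitDim v ∈ ({none}ᶜ : Set (Option (Fin p)))}.indicator
            (fun _ => (1 : ℝ)) T ∂l := integral_nonneg fun T =>
        mul_nonneg (addressWeight_mem h0 h1 j x T v).1 (Set.indicator_nonneg (fun _ _ => by simp) _)
      have hle : ∫ T, addressWeight r j x T v *
          {T : SplitTree p | T.splitDim v ∈ ({none}ᶜ : Set (Option (Fin p)))}.indicator
            (fun _ => (1 : ℝ)) T ∂l ≤ ∫ T, addressWeight r j x T v ∂l := by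
        refine integral_mono_of_nonneg (Eventually.of_forall fun T => mul_nonneg
          (addressWeight_mem h0 h1 j x T v).1 (Set.indicator_nonneg (fun _ _ => by simp) _)) (hI v)
          (Eventually.of_forall fun T => ?_)
        refine mul_le_of_le_one_right (addressWeight_mem h0 h1 j x T v).1 ?_
        exact Set.indicator_le_self' (fun _ _ => by simp) _ |>.trans le_rfl
      -- The weight at v is measurable with respect to the ancestors of v; pulling it into the
      -- conditional expectations turns the pointwise random-split inequality into an inequality of
      -- integrals.
      have hcmp : q * ∫ T, addressWeight r j x T v *
          {T : SplitTree p | T.splitDim v ∈ ({none}ᶜ : Set (Option (Fin p)))}.indicator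
            (fun _ => (1 : ℝ)) T ∂l ≤ ∫ T, addressWeight r j x T v *
          {T : SplitTree p | T.splitDim v ∈ ({some j} : Set (Option (Fin p)))}.indicator
            (fun _ => (1 : ℝ)) T ∂l := by
        refine (mul_le_mul_of_nonneg_right hq hpos).trans ?_
        rw [← e1, ← e2, ← integral_const_mul]
        refine integral_mono_ae (i1.const_mul _) i2 ?_
        filter_upwards [hl v] with T hT
        have := mul_le_mul_of_nonneg_left hT (addressWeight_mem h0 h1 j x T v).1
        calc _ = addressWeight r j x T v * (π₀ *
            (l⟦{t : SplitTree p | t.splitDim v ≠ none} | ancestorSigma v⟧) T) := by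
              rw [mul_left_comm]; rfl
          _ ≤ _ := this
      have hii : ∀ A : Set (Option (Fin p)), Integrable (fun T => addressWeight r j x T v *
          {T : SplitTree p | T.splitDim v ∈ A}.indicator (fun _ => (1 : ℝ)) T) l := fun A =>
        ((integrable_const (1 : ℝ)).indicator (hm v A)).bdd_mul (hI v).aestronglyMeasurable
          (Eventually.of_forall fun T => by rw [Real.norm_eq_abs]; exact hb T)
      -- At an inner node the split factor is 1 - (1 - r) 1{feature j}; at a leaf it is 0.
      have heq : ∀ T : SplitTree p, addressWeight r j x T (v ++ [true]) +
          addressWeight r j x T (v ++ [false]) = addressWeight r j x T v *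
          {T : SplitTree p | T.splitDim v ∈ ({none}ᶜ : Set (Option (Fin p)))}.indicator
            (fun _ => (1 : ℝ)) T - (1 - r) * (addressWeight r j x T v *
          {T : SplitTree p | T.splitDim v ∈ ({some j} : Set (Option (Fin p)))}.indicator
            (fun _ => (1 : ℝ)) T) := by
        intro T
        rw [addressWeight_append_add]
        cases h : T.splitDim v with
        | none => simp [Set.indicator, h]
        | some j' => by_cases hj : j' = j <;> simp [Set.indicator, h, hj, splitFactor]; ring
      simp only [heq]
      rw [integral_sub (hii _) ((hii _).const_mul _), integral_const_mul]
      nlinarith [mul_le_mul_of_nonneg_left hcmp (sub_nonneg.2 h1)]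
    calc ∫ T, pathWeight r j x T (k + 1) ∂l
        = addressSum k fun v => ∫ T, (addressWeight r j x T (v ++ [true]) +
            addressWeight r j x T (v ++ [false])) ∂l := by
          simp only [pathWeight_eq_addressSum, addressSum_succ']
          exact integral_addressSum k fun v => (hI _).add (hI _)
      _ ≤ (1 - (1 - r) * q) * addressSum k fun v => ∫ T, addressWeight r j x T v ∂l := by
          rw [← addressSum_mul_left]; exact addressSum_mono k step
      _ = (1 - (1 - r) * q) * ∫ T, pathWeight r j x T k ∂l := by
          simp only [pathWeight_eq_addressSum]
          rw [integral_addressSum k hI]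
      _ ≤ _ := by rw [pow_succ']; exact mul_le_mul_of_nonneg_left ih hr

end SplitTree

/-! ### Boxes, admissible splits and the shrinking of leaves -/

section Geometry

variable {p d s : ℕ}

/-- The volume of the box with corners `lo` and `hi`. -/
def boxVol (lo hi : Fin p → ℝ) : ℝ := ∏ j, (hi j - lo j)

theorem boxVol_eq_mul (lo hi : Fin p → ℝ) (j : Fin p) :
    boxVol lo hi = (hi j - lo j) * ∏ k ∈ Finset.univ.erase j, (hi k - lo k) :=
  (Finset.mul_prod_erase Finset.univ _ (Finset.mem_univ j)).symm

theorem boxVol_update_hi (lo hi : Fin p → ℝ) (j : Fin p) (c : ℝ) :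
    boxVol lo (Function.update hi j c) =
      (c - lo j) * ∏ k ∈ Finset.univ.erase j, (hi k - lo k) := by
  rw [boxVol_eq_mul lo _ j, Function.update_self]
  congr 1
  exact Finset.prod_congr rfl fun k hk => by
    rw [Function.update_of_ne (Finset.ne_of_mem_erase hk)]

theorem boxVol_update_lo (lo hi : Fin p → ℝ) (j : Fin p) (c : ℝ) :
    boxVol (Function.update lo j c) hi =
      (hi j - c) * ∏ k ∈ Finset.univ.erase j, (hi k - lo k) := by
  rw [boxVol_eq_mul _ hi j, Function.update_self]
  congr 1
  exact Finset.prod_congr rfl fun k hk => by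
    rw [Function.update_of_ne (Finset.ne_of_mem_erase hk)]

theorem boxVol_nonneg {lo hi : Fin p → ℝ} (h : lo ≤ hi) : 0 ≤ boxVol lo hi :=
  Finset.prod_nonneg fun j _ => sub_nonneg.2 (h j)

open Classical in
/-- The number of observations in each box of the unit cube is comparable to the volume of the
box, up to an additive error `U`, and so are the sizes of the treatment groups. -/
structure BoxRegular (z : Fin s → Obs p d) (I₀ : Finset (Fin s)) (A B U : ℝ) : Prop where
  upper : ∀ lo hi : Fin p → ℝ, 0 ≤ lo → lo ≤ hi → hi ≤ 1 →
    ((I₀.filter fun i => lo ≤ cov (z i) ∧ cov (z i) ≤ hi).card : ℝ) ≤ B * boxVol lo hi + U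
  lower : ∀ lo hi : Fin p → ℝ, 0 ≤ lo → lo ≤ hi → hi ≤ 1 → ∀ w : Bool,
    A * boxVol lo hi - U ≤ ((I₀.filter fun i =>
      (∀ j, lo j < cov (z i) j ∧ cov (z i) j < hi j) ∧ trt (z i) = w).card : ℝ)

/-- `J` consists of the members of `I₀` in a cell whose closure is the box with corners `lo` and
`hi`. -/
structure NodeBox (z : Fin s → Obs p d) (I₀ J : Finset (Fin s)) (lo hi : Fin p → ℝ) : Prop where
  subset : J ⊆ I₀
  nonneg : 0 ≤ lo
  le : lo ≤ hi
  le_one : hi ≤ 1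
  mem_box : ∀ i ∈ J, lo ≤ cov (z i) ∧ cov (z i) ≤ hi
  mem_of : ∀ i ∈ I₀, (∀ j, lo j < cov (z i) j ∧ cov (z i) j < hi j) → i ∈ J

theorem NodeBox.root {z : Fin s → Obs p d} {I₀ : Finset (Fin s)}
    (hz : ∀ i, cov (z i) ∈ Set.Icc (0 : Fin p → ℝ) 1) : NodeBox z I₀ I₀ 0 1 where
  subset := subset_rfl
  nonneg := le_rfl
  le := zero_le_one
  le_one := le_rfl
  mem_box i _ := hz i
  mem_of _ hi _ := hi

namespace NodeBox

variable {z : Fin s → Obs p d} {I₀ J : Finset (Fin s)} {lo hi : Fin p → ℝ} {A B U : ℝ}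

theorem card_le (h : NodeBox z I₀ J lo hi) (hb : BoxRegular z I₀ A B U) :
    (J.card : ℝ) ≤ B * boxVol lo hi + U := by
  classical
  refine le_trans ?_ (hb.upper lo hi h.nonneg h.le h.le_one)
  exact_mod_cast Finset.card_le_card fun i hi =>
    Finset.mem_filter.2 ⟨h.subset hi, h.mem_box i hi⟩

theorem le_groupCount (h : NodeBox z I₀ J lo hi) (hb : BoxRegular z I₀ A B U) (w : Bool) :
    A * boxVol lo hi - U ≤ (groupCount z J w : ℝ) := by
  classical
  refine (hb.lower lo hi h.nonneg h.le h.le_one w).trans ?_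
  have : ∀ i, i ∈ I₀.filter (fun i =>
      (∀ j, lo j < cov (z i) j ∧ cov (z i) j < hi j) ∧ trt (z i) = w) →
      i ∈ J.filter fun i => trt (z i) = w := fun i hi => by
    obtain ⟨h1, h2, h3⟩ := Finset.mem_filter.1 hi
    exact Finset.mem_filter.2 ⟨h.mem_of i h1 h2, h3⟩
  exact_mod_cast Finset.card_le_card this

theorem le_card (h : NodeBox z I₀ J lo hi) (hb : BoxRegular z I₀ A B U) :
    A * boxVol lo hi - U ≤ (J.card : ℝ) :=
  (h.le_groupCount hb true).trans (by exact_mod_cast Finset.card_filter_le _ _)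

/-- The splitting value `c`, moved into the interval that is split. -/
noncomputable def clip (lo hi : Fin p → ℝ) (j : Fin p) (c : ℝ) : ℝ := max (lo j) (min c (hi j))

theorem le_clip (lo hi : Fin p → ℝ) (j : Fin p) (c : ℝ) : lo j ≤ clip lo hi j c := le_max_left _ _

theorem clip_le {lo hi : Fin p → ℝ} (h : lo ≤ hi) (j : Fin p) (c : ℝ) : clip lo hi j c ≤ hi j :=
  max_le (h j) (min_le_right _ _)

theorem left (h : NodeBox z I₀ J lo hi) (j : Fin p) (c : ℝ) :
    NodeBox z I₀ (leftPart z J j c) lo (Function.update hi j (clip lo hi j c)) where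
  subset := (Finset.filter_subset _ _).trans h.subset
  nonneg := h.nonneg
  le k := by
    by_cases hk : k = j
    · subst hk; simpa using le_clip lo hi k c
    · simpa [hk] using h.le k
  le_one k := by
    by_cases hk : k = j
    · subst hk; simpa using (clip_le h.le k c).trans (h.le_one k)
    · simpa [hk] using h.le_one k
  mem_box i hi' := by
    obtain ⟨h1, h2⟩ := Finset.mem_filter.1 hi'
    obtain ⟨h3, h4⟩ := h.mem_box i h1
    refine ⟨h3, fun k => ?_⟩
    by_cases hk : k = j
    · subst hk; simpa [clip] using Or.inr ⟨h2.le, h4 k⟩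
    · simpa [hk] using h4 k
  mem_of i hi' hlt := by
    have hj := hlt j
    simp only [Function.update_self, clip, lt_max_iff, lt_min_iff] at hj
    rcases hj with ⟨h1, h2 | ⟨h2, h3⟩⟩
    · exact absurd h2 (not_lt.2 h1.le)
    refine Finset.mem_filter.2 ⟨h.mem_of i hi' fun k => ?_, h2⟩
    by_cases hk : k = j
    · subst hk; exact ⟨h1, h3⟩
    · simpa [hk] using hlt k

theorem right (h : NodeBox z I₀ J lo hi) (j : Fin p) (c : ℝ) :
    NodeBox z I₀ (rightPart z J j c) (Function.update lo j (clip lo hi j c)) hi where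
  subset := (Finset.filter_subset _ _).trans h.subset
  nonneg k := by
    by_cases hk : k = j
    · subst hk; simpa using (h.nonneg k).trans (le_clip lo hi k c)
    · simpa [hk] using h.nonneg k
  le k := by
    by_cases hk : k = j
    · subst hk; simpa using clip_le h.le k c
    · simpa [hk] using h.le k
  le_one := h.le_one
  mem_box i hi' := by
    obtain ⟨h1, h2⟩ := Finset.mem_filter.1 hi'
    obtain ⟨h3, h4⟩ := h.mem_box i h1
    refine ⟨fun k => ?_, h4⟩
    by_cases hk : k = j
    · subst hk; simpa [clip] using ⟨h3 k, Or.inl h2⟩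
    · simpa [hk] using h3 k
  mem_of i hi' hlt := by
    have hj := hlt j
    simp only [Function.update_self, clip, max_lt_iff, min_lt_iff] at hj
    obtain ⟨⟨h1, h2 | h2⟩, h3⟩ := hj
    · refine Finset.mem_filter.2 ⟨h.mem_of i hi' fun k => ?_, h2.le⟩
      by_cases hk : k = j
      · subst hk; exact ⟨h1, h3⟩
      · simpa [hk] using hlt k
    · exact absurd h2 (not_lt.2 h3.le)

theorem leftPart_card_add (z : Fin s → Obs p d) (J : Finset (Fin s)) (j : Fin p) (c : ℝ) :
    (leftPart z J j c).card + (rightPart z J j c).card = J.card := by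
  rw [leftPart, rightPart, ← Finset.card_filter_add_card_filter_not (s := J)
    (fun i => cov (z i) j < c)]
  simp only [not_lt]

/-- The slice {t_j = c} of the node's box is a closed box of volume zero, so the upper count leaves
only the additive error. This controls ties at a median. -/
theorem card_eq_le (h : NodeBox z I₀ J lo hi) (hb : BoxRegular z I₀ A B U) (j : Fin p) (c : ℝ)
    (hU : 0 ≤ U) : ((J.filter fun i => cov (z i) j = c).card : ℝ) ≤ U := by
  classical
  by_cases hc : lo j ≤ c ∧ c ≤ hi j
  · have hle : Function.update lo j c ≤ Function.update hi j c := fun k => by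
      by_cases hk : k = j
      · subst hk; simp
      · simpa [hk] using h.le k
    have h0 : 0 ≤ Function.update lo j c := fun k => by
      by_cases hk : k = j
      · subst hk; simpa using (h.nonneg k).trans hc.1
      · simpa [hk] using h.nonneg k
    have h1 : Function.update hi j c ≤ 1 := fun k => by
      by_cases hk : k = j
      · subst hk; simpa using hc.2.trans (h.le_one k)
      · simpa [hk] using h.le_one k
    have hv : boxVol (Function.update lo j c) (Function.update hi j c) = 0 :=
      Finset.prod_eq_zero (Finset.mem_univ j) (by simp)
    have := hb.upper _ _ h0 hle h1
    rw [hv, mul_zero, zero_add] at this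
    refine le_trans ?_ this
    have : ∀ i, i ∈ J.filter (fun i => cov (z i) j = c) → i ∈ I₀.filter fun i =>
        Function.update lo j c ≤ cov (z i) ∧ cov (z i) ≤ Function.update hi j c := fun i hi' => by
      obtain ⟨h2, h3⟩ := Finset.mem_filter.1 hi'
      obtain ⟨h4, h5⟩ := h.mem_box i h2
      refine Finset.mem_filter.2 ⟨h.subset h2, fun k => ?_, fun k => ?_⟩
      · by_cases hk : k = j
        · subst hk; simp [h3]
        · simpa [hk] using h4 k
      · by_cases hk : k = j
        · subst hk; simp [h3]
        · simpa [hk] using h5 k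
    exact_mod_cast Finset.card_le_card this
  · rw [Finset.filter_false_of_mem]
    · simpa using hU
    · rintro i hi' rfl
      exact hc ⟨(h.mem_box i hi').1 j, (h.mem_box i hi').2 j⟩

/-- A finite set of reals with multiplicities has a median. -/
theorem exists_median {ι : Type*} (J : Finset ι) (hJ : J.Nonempty) (f : ι → ℝ) :
    ∃ c, 2 * (J.filter fun i => f i < c).card ≤ J.card ∧
      J.card ≤ 2 * (J.filter fun i => f i ≤ c).card := by
  classical
  -- The median is the largest observed value with at most half of the values strictly below it. If
  -- fewer than half were ≤ c, the next observed value would also belong to this set.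
  let S := (J.image f).filter fun c => 2 * (J.filter fun i => f i < c).card ≤ J.card
  have hS : S.Nonempty := by
    refine ⟨(J.image f).min' (hJ.image f), Finset.mem_filter.2 ⟨Finset.min'_mem _ _, ?_⟩⟩
    rw [Finset.filter_false_of_mem]
    · simp
    · exact fun i hi => not_lt.2 (Finset.min'_le _ _ (Finset.mem_image_of_mem f hi))
  refine ⟨S.max' hS, (Finset.mem_filter.1 (S.max'_mem hS)).2, ?_⟩
  by_contra! hlt
  set c := S.max' hS
  have hne : (J.filter fun i => c < f i).Nonempty := by
    rw [Finset.nonempty_iff_ne_empty]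
    intro h
    have : J.filter (fun i => f i ≤ c) = J := Finset.filter_true_of_mem fun i hi => by
      by_contra! h'
      exact (Finset.notMem_empty i) (h ▸ Finset.mem_filter.2 ⟨hi, h'⟩)
    rw [this] at hlt; omega
  obtain ⟨i₀, hi₀, hmin⟩ := Finset.exists_min_image _ f hne
  obtain ⟨hi1, hi2⟩ := Finset.mem_filter.1 hi₀
  have hmem : f i₀ ∈ S := by
    refine Finset.mem_filter.2 ⟨Finset.mem_image_of_mem f hi1, ?_⟩
    have : (J.filter fun i => f i < f i₀) ⊆ J.filter fun i => f i ≤ c := fun i hi => by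
      obtain ⟨h1, h2⟩ := Finset.mem_filter.1 hi
      refine Finset.mem_filter.2 ⟨h1, ?_⟩
      by_contra! h'
      exact absurd (hmin i (Finset.mem_filter.2 ⟨h1, h'⟩)) (not_le.2 h2)
    have := Finset.card_le_card this
    omega
  exact absurd (S.le_max' _ hmem) (not_le.2 hi2)

/-- A node with many observations has admissible splits along all features. -/
theorem exists_admissible (h : NodeBox z I₀ J lo hi) (hb : BoxRegular z I₀ A B U) {α K : ℝ} {κ : ℕ}
    (hA : 0 ≤ A) (hB : 0 < B) (hU : 0 ≤ U) (hα : α ≤ 0.2) (hK0 : 0 < K) (hK2 : U ≤ 0.3 * K)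
    (hK3 : κ + U ≤ A / B * (0.2 * K - U)) (hJ : K ≤ J.card) (j : Fin p) :
    ∃ c, AdmissibleSplit α κ z J j c := by
  classical
  have hne : J.Nonempty := by
    rw [← Finset.card_pos]
    exact_mod_cast hK0.trans_le hJ
  obtain ⟨c, hc1, hc2⟩ := exists_median J hne fun i => cov (z i) j
  refine ⟨c, ?_⟩
  have hadd := leftPart_card_add z J j c
  have heq := h.card_eq_le hb j c hU
  have hle : (J.filter fun i => cov (z i) j ≤ c).card ≤
      (leftPart z J j c).card + (J.filter fun i => cov (z i) j = c).card := by
    refine le_trans (Finset.card_le_card fun i hi => ?_) (Finset.card_union_le _ _)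
    obtain ⟨h1, h2⟩ := Finset.mem_filter.1 hi
    rcases h2.lt_or_eq with h2 | h2
    · exact Finset.mem_union_left _ (Finset.mem_filter.2 ⟨h1, h2⟩)
    · exact Finset.mem_union_right _ (Finset.mem_filter.2 ⟨h1, h2⟩)
  -- At least half of the values are ≤ c and at most U ≤ 0.3 K of them equal c, which leaves 0.2 of
  -- the node strictly to the left.
  have hl : 0.2 * (J.card : ℝ) ≤ (leftPart z J j c).card := by
    have h1 : (J.card : ℝ) ≤ 2 * ((leftPart z J j c).card +
        (J.filter fun i => cov (z i) j = c).card) := by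
      exact_mod_cast hc2.trans (Nat.mul_le_mul_left 2 hle)
    linarith
  have hr : 0.2 * (J.card : ℝ) ≤ (rightPart z J j c).card := by
    have h1 : 2 * ((leftPart z J j c).card : ℝ) ≤ J.card := by exact_mod_cast hc1
    have h2 : ((leftPart z J j c).card : ℝ) + (rightPart z J j c).card = J.card := by
      exact_mod_cast hadd
    have : (0 : ℝ) ≤ J.card := Nat.cast_nonneg _
    linarith
  have hαJ : α * J.card ≤ 0.2 * J.card := mul_le_mul_of_nonneg_right hα (Nat.cast_nonneg _)
  -- A child with 0.2 K observations has volume at least (0.2 K - U) / B, and the lower count then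
  -- supplies κ members of each group.
  have hgroup : ∀ J' lo' hi', NodeBox z I₀ J' lo' hi' → 0.2 * (J.card : ℝ) ≤ J'.card → ∀ w,
      κ ≤ groupCount z J' w := by
    intro J' lo' hi' h' hJ' w
    have h1 := h'.card_le hb
    have h2 := h'.le_groupCount hb w
    have h3 : (0.2 * K - U) / B ≤ boxVol lo' hi' := by
      rw [div_le_iff₀ hB]; linarith
    have h4 : A / B * (0.2 * K - U) ≤ A * boxVol lo' hi' := by
      calc A / B * (0.2 * K - U) = A * ((0.2 * K - U) / B) := by ring
        _ ≤ _ := mul_le_mul_of_nonneg_left h3 hA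
    have : (κ : ℝ) ≤ groupCount z J' w := by linarith
    exact_mod_cast this
  exact ⟨hαJ.trans hl, hαJ.trans hr, fun w =>
    ⟨hgroup _ _ _ (h.left j c) hl w, hgroup _ _ _ (h.right j c) hr w⟩⟩

/-- If the part of a node on one side of a split keeps a fraction of the observations, then the
side of the other part is shorter by a constant factor. -/
theorem length_le (h : NodeBox z I₀ J lo hi) (hb : BoxRegular z I₀ A B U) {J' : Finset (Fin s)}
    {lo' hi' : Fin p → ℝ} (h' : NodeBox z I₀ J' lo' hi') {α K l : ℝ} {j : Fin p} (hα : 0 < α)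
    (hα1 : α ≤ 1)
    (hv : boxVol lo' hi' = l * ∏ k ∈ Finset.univ.erase j, (hi k - lo k))
    (hB : 0 < B) (hK0 : 0 < K) (hK1 : 2 * U ≤ α * K) (hJ : K ≤ J.card)
    (hJ' : α * J.card ≤ J'.card) :
    α * A / (4 * B) * (hi j - lo j) ≤ l := by
  have h1 := h'.card_le hb
  have h2 := h.le_card hb
  have hv2 := boxVol_eq_mul lo hi j
  set Q := ∏ k ∈ Finset.univ.erase j, (hi k - lo k)
  have hQ : 0 ≤ Q := Finset.prod_nonneg fun k _ => sub_nonneg.2 (h.le k)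
  have h3 : α * K ≤ α * J.card := mul_le_mul_of_nonneg_left hJ hα.le
  -- The additive error U is at most α K / 2 ≤ α |J| / 2, so it is absorbed at the price of the
  -- factor 2.
  have h4 : α * J.card ≤ 2 * (B * (l * Q)) := by rw [← hv]; linarith
  have hJ0 : (0 : ℝ) < J.card := hK0.trans_le hJ
  have hUJ : U ≤ J.card := by nlinarith
  have h5 : A * boxVol lo hi ≤ 2 * J.card := by linarith
  have h6 : α * (A * boxVol lo hi) ≤ 4 * (B * (l * Q)) := by
    nlinarith [mul_le_mul_of_nonneg_left h5 hα.le]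
  have hpos : 0 < l * Q := by
    have : 0 < α * (J.card : ℝ) := mul_pos hα hJ0
    by_contra! hneg
    nlinarith
  have hQ0 : 0 < Q := lt_of_le_of_ne hQ fun h0 => by rw [← h0, mul_zero] at hpos; exact hpos.false
  rw [hv2] at h6
  rw [div_mul_eq_mul_div, div_le_iff₀ (by positivity)]
  have : (α * A * (hi j - lo j)) * Q ≤ (l * (4 * B)) * Q := by linarith
  exact le_of_mul_le_mul_right this hQ0

end NodeBox

open Classical in
/-- The members of `J` whose covariates lie in the leaf of `x`. -/
noncomputable def leafPart (z : Fin s → Obs p d) (J : Finset (Fin s)) (T : SplitTree p)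
    (x : Fin p → ℝ) : Finset (Fin s) := J.filter fun i => cov (z i) ∈ T.leafAt x

open Classical in
theorem mem_leafPart {z : Fin s → Obs p d} {J : Finset (Fin s)} {T : SplitTree p}
    {x : Fin p → ℝ} {i : Fin s} : i ∈ leafPart z J T x ↔ i ∈ J ∧ cov (z i) ∈ T.leafAt x := by
  rw [leafPart, Finset.mem_filter]

theorem leafPart_leaf (z : Fin s → Obs p d) (J : Finset (Fin s)) (x : Fin p → ℝ) :
    leafPart z J .leaf x = J := by
  ext i; simp [mem_leafPart, SplitTree.leafAt]

theorem leafPart_node_left (z : Fin s → Obs p d) (J : Finset (Fin s)) {x : Fin p → ℝ} {j : Fin p}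
    {c : ℝ} (l r : SplitTree p) (h : x j < c) :
    leafPart z J (.node j c l r) x = leafPart z (leftPart z J j c) l x := by
  ext i; simp [mem_leafPart, SplitTree.leafAt, h, leftPart, and_assoc]

theorem leafPart_node_right (z : Fin s → Obs p d) (J : Finset (Fin s)) {x : Fin p → ℝ} {j : Fin p}
    {c : ℝ} (l r : SplitTree p) (h : ¬ x j < c) :
    leafPart z J (.node j c l r) x = leafPart z (rightPart z J j c) r x := by
  ext i; simp [mem_leafPart, SplitTree.leafAt, h, rightPart, and_assoc]

theorem mem_box_left {lo hi x : Fin p → ℝ} {j : Fin p} {c : ℝ} (hx : lo ≤ x ∧ x ≤ hi)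
    (h : x j < c) : lo ≤ x ∧ x ≤ Function.update hi j (NodeBox.clip lo hi j c) := by
  refine ⟨hx.1, fun k => ?_⟩
  by_cases hk : k = j
  · subst hk; simpa [NodeBox.clip] using Or.inr ⟨h.le, hx.2 k⟩
  · simpa [hk] using hx.2 k

theorem mem_box_right {lo hi x : Fin p → ℝ} {j : Fin p} {c : ℝ} (hx : lo ≤ x ∧ x ≤ hi)
    (h : ¬ x j < c) : Function.update lo j (NodeBox.clip lo hi j c) ≤ x ∧ x ≤ hi := by
  refine ⟨fun k => ?_, hx.2⟩
  by_cases hk : k = j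
  · subst hk; simpa [NodeBox.clip] using ⟨hx.1 k, Or.inl (not_lt.1 h)⟩
  · simpa [hk] using hx.1 k

variable {z : Fin s → Obs p d} {I₀ : Finset (Fin s)} {A B U α K : ℝ} {κ : ℕ}

/-- A leaf with at least K observations would have an admissible split along every feature,
contradicting the stopping rule. Following x down the tree also produces a box containing x and all
observations in its leaf. -/
theorem SplitTree.IsRegular.leaf_box (hb : BoxRegular z I₀ A B U)
    (hA : 0 ≤ A) (hB : 0 < B) (hU : 0 ≤ U) (hα : α ≤ 0.2) (hK0 : 0 < K) (hK2 : U ≤ 0.3 * K)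
    (hK3 : κ + U ≤ A / B * (0.2 * K - U)) (x : Fin p → ℝ) (T : SplitTree p) :
    ∀ (J : Finset (Fin s)) (lo hi : Fin p → ℝ), NodeBox z I₀ J lo hi → lo ≤ x ∧ x ≤ hi →
      T.IsRegular α κ z J → ∃ lo' hi', NodeBox z I₀ (leafPart z J T x) lo' hi' ∧
        (lo' ≤ x ∧ x ≤ hi') ∧ ((leafPart z J T x).card : ℝ) < K := by
  induction T with
  | leaf =>
    intro J lo hi hJ hx hT
    rw [leafPart_leaf]
    refine ⟨lo, hi, hJ, hx, ?_⟩
    by_contra! hK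
    obtain ⟨j, hj⟩ := hT
    obtain ⟨c, hc⟩ := hJ.exists_admissible hb hA hB hU hα hK0 hK2 hK3 hK j
    exact hj c hc
  | node j c l r ihl ihr =>
    intro J lo hi hJ hx hT
    by_cases h : x j < c
    · rw [leafPart_node_left z J l r h]
      exact ihl _ _ _ (hJ.left j c) (mem_box_left hx h) hT.2.1
    · rw [leafPart_node_right z J l r h]
      exact ihr _ _ _ (hJ.right j c) (mem_box_right hx h) hT.2.2

/-- Only the root needs the assumption: every admissible split already leaves κ members of each
group in both children. -/
theorem SplitTree.IsRegular.le_groupCount_leafPart (x : Fin p → ℝ) (w : Bool) (T : SplitTree p) :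
    ∀ (J : Finset (Fin s)), T.IsRegular α κ z J → κ ≤ groupCount z J w →
      κ ≤ groupCount z (leafPart z J T x) w := by
  induction T with
  | leaf => intro J _ h; rwa [leafPart_leaf]
  | node j c l r ihl ihr =>
    intro J hT _
    by_cases h : x j < c
    · rw [leafPart_node_left z J l r h]
      exact ihl _ hT.2.1 (hT.1.2.2 w).1
    · rw [leafPart_node_right z J l r h]
      exact ihr _ hT.2.2 (hT.1.2.2 w).2

/-- The leaf of `x` is short in each direction. -/
theorem SplitTree.IsRegular.abs_sub_le_pathWeight (hb : BoxRegular z I₀ A B U)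
    (hA : 0 ≤ A) (hB : 0 < B) (hU : 0 ≤ U) (hα0 : 0 < α) (hα : α ≤ 0.2) (hK0 : 0 < K)
    (hK1 : 2 * U ≤ α * K) (hK2 : U ≤ 0.3 * K)
    (hK3 : κ + U ≤ A / B * (0.2 * K - U)) (hr : α * A / (4 * B) ≤ 1) (x : Fin p → ℝ) (j : Fin p)
    (k : ℕ) :
    ∀ (T : SplitTree p) (J : Finset (Fin s)) (lo hi : Fin p → ℝ), NodeBox z I₀ J lo hi →
      lo ≤ x ∧ x ≤ hi → T.IsRegular α κ z J → K ≤ α ^ k * J.card → ∀ i ∈ leafPart z J T x,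
        |cov (z i) j - x j| ≤
          SplitTree.pathWeight (1 - α * A / (4 * B)) j x T k * (hi j - lo j) := by
  have hα1 : α ≤ 1 := by norm_num at hα; linarith
  induction k with
  | zero =>
    intro T J lo hi hJ hx hT _ i hi'
    have hw : SplitTree.pathWeight (1 - α * A / (4 * B)) j x T 0 = 1 := by cases T <;> rfl
    obtain ⟨h1, h2⟩ := hJ.mem_box i (mem_leafPart.1 hi').1
    rw [hw, one_mul, abs_le]
    have := h1 j; have := h2 j; have := hx.1 j; have := hx.2 j
    constructor <;> linarith
  | succ k ih =>
    intro T J lo hi hJ hx hT hk i hi'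
    have hKJ : K ≤ J.card := by
      have : α ^ (k + 1) * J.card ≤ 1 * J.card :=
        mul_le_mul_of_nonneg_right (pow_le_one₀ hα0.le hα1) (Nat.cast_nonneg _)
      linarith
    cases T with
    | leaf =>
      obtain ⟨j', hj'⟩ := hT
      obtain ⟨c, hc⟩ := hJ.exists_admissible hb hA hB hU hα hK0 hK2 hK3 hKJ j'
      exact absurd hc (hj' c)
    | node j' c l r =>
      have hw := hT.1
      -- Each split costs at most the factor α in node size, which pays for one level of the
      -- remaining depth.
      have hkα : ∀ J' : Finset (Fin s), α * J.card ≤ J'.card → K ≤ α ^ k * J'.card := by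
        intro J' hJ'
        have := mul_le_mul_of_nonneg_left hJ' (pow_nonneg hα0.le k)
        rw [pow_succ, mul_assoc] at hk
        linarith
      have hj0 := hJ.le j
      -- Here L is the new side length on the side of x and J' is the sibling that is discarded. The
      -- sibling keeps the fraction α of the observations, so its own side has a definite length, by
      -- which the side of x shrinks.
      have hcmp : ∀ (J' : Finset (Fin s)) (lo' hi' : Fin p → ℝ) (L : ℝ), (j' = j →
          NodeBox z I₀ J' lo' hi' ∧ α * J.card ≤ J'.card ∧
            boxVol lo' hi' = (hi j - lo j - L) * ∏ k ∈ Finset.univ.erase j, (hi k - lo k)) →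
          (j' ≠ j → L = hi j - lo j) →
          L ≤ SplitTree.splitFactor (1 - α * A / (4 * B)) j j' * (hi j - lo j) := by
        intro J' lo' hi' L h1 h2
        by_cases hjj : j' = j
        · obtain ⟨h3, h4, h5⟩ := h1 hjj
          have := hJ.length_le hb h3 hα0 hα1 h5 hB hK0 hK1 hKJ h4
          simp only [SplitTree.splitFactor, hjj, if_true]
          linarith
        · simp [SplitTree.splitFactor, hjj, h2 hjj]
      by_cases h : x j' < c
      · rw [leafPart_node_left z J l r h] at hi'
        refine (ih l _ _ _ (hJ.left j' c) (mem_box_left hx h) hT.2.1 (hkα _ hw.1) i hi').trans ?_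
        rw [SplitTree.pathWeight, if_pos h, mul_comm (SplitTree.splitFactor _ _ _), mul_assoc]
        refine mul_le_mul_of_nonneg_left ?_
          (SplitTree.pathWeight_nonneg (sub_nonneg.2 hr) j x l k)
        refine hcmp _ _ _ _ (fun hjj => ⟨hJ.right j' c, hw.2.1, ?_⟩) fun hjj => by
          simp [Ne.symm hjj]
        subst hjj
        rw [boxVol_update_lo, Function.update_self]
        congr 1; ring
      · rw [leafPart_node_right z J l r h] at hi'
        refine (ih r _ _ _ (hJ.right j' c) (mem_box_right hx h) hT.2.2 (hkα _ hw.2.1) i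
          hi').trans ?_
        rw [SplitTree.pathWeight, if_neg h, mul_comm (SplitTree.splitFactor _ _ _), mul_assoc]
        refine mul_le_mul_of_nonneg_left ?_
          (SplitTree.pathWeight_nonneg (sub_nonneg.2 hr) j x r k)
        refine hcmp _ _ _ _ (fun hjj => ⟨hJ.left j' c, hw.1, ?_⟩) fun hjj => by
          simp [Ne.symm hjj]
        subst hjj
        rw [boxVol_update_hi, Function.update_self]
        congr 1; ring

end Geometry

/-! ### Chernoff bounds for counts -/

section Concentration

/-- Changing one factor at a time, with all others in [0, 1], costs at most the change of that
factor. This compares the volume of a box with that of its grid approximation. -/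
theorem prod_sub_prod_le_sum {ι : Type*} (S : Finset ι) (f g : ι → ℝ) (h0 : ∀ i ∈ S, 0 ≤ f i)
    (hfg : ∀ i ∈ S, f i ≤ g i) (h1 : ∀ i ∈ S, g i ≤ 1) :
    ∏ i ∈ S, g i - ∏ i ∈ S, f i ≤ ∑ i ∈ S, (g i - f i) := by
  classical
  induction S using Finset.induction_on with
  | empty => simp
  | insert a S ha ih =>
    rw [Finset.prod_insert ha, Finset.prod_insert ha, Finset.sum_insert ha]
    have ih' := ih (fun i hi => h0 i (Finset.mem_insert_of_mem hi))
      (fun i hi => hfg i (Finset.mem_insert_of_mem hi))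
      (fun i hi => h1 i (Finset.mem_insert_of_mem hi))
    have hg1 : ∏ i ∈ S, g i ≤ 1 := Finset.prod_le_one
      (fun i hi => (h0 i (Finset.mem_insert_of_mem hi)).trans
        (hfg i (Finset.mem_insert_of_mem hi))) fun i hi => h1 i (Finset.mem_insert_of_mem hi)
    have hg0 : 0 ≤ ∏ i ∈ S, f i := Finset.prod_nonneg fun i hi => h0 i (Finset.mem_insert_of_mem hi)
    have hle : ∏ i ∈ S, f i ≤ ∏ i ∈ S, g i := Finset.prod_le_prod
      (fun i hi => h0 i (Finset.mem_insert_of_mem hi))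
      fun i hi => hfg i (Finset.mem_insert_of_mem hi)
    have ha0 := h0 a (Finset.mem_insert_self _ _)
    have ha1 := hfg a (Finset.mem_insert_self _ _)
    have ha2 := h1 a (Finset.mem_insert_self _ _)
    nlinarith

set_option linter.unusedSectionVars false

variable {Z : Type*} [MeasurableSpace Z] {s : ℕ}

open Classical in
/-- The number of indices in `I` whose observation lies in `A`. -/
noncomputable def countIn (I : Finset (Fin s)) (A : Set Z) (z : Fin s → Z) : ℕ :=
  (I.filter fun i => z i ∈ A).card

theorem pow_countIn (I : Finset (Fin s)) (A : Set Z) (z : Fin s → Z) (t : ℝ) :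
    t ^ countIn I A z =
      ∏ i, (if i ∈ I then 1 + A.indicator (fun _ => t - 1) (z i) else 1) := by
  classical
  rw [Finset.prod_ite_mem, Finset.univ_inter, countIn, ← Finset.prod_const, Finset.prod_filter]
  refine Finset.prod_congr rfl fun i _ => ?_
  by_cases h : z i ∈ A <;> simp [h]

theorem measurable_countIn (I : Finset (Fin s)) {A : Set Z} (hA : MeasurableSet A) :
    Measurable fun z : Fin s → Z => (countIn I A z : ℝ) := by
  classical
  have : (fun z : Fin s → Z => (countIn I A z : ℝ)) = fun z =>
      ∑ i ∈ I, A.indicator (fun _ => (1 : ℝ)) (z i) := by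
    ext z
    rw [countIn, Finset.card_filter]
    push_cast
    exact Finset.sum_congr rfl fun i _ => by by_cases h : z i ∈ A <;> simp [h]
  rw [this]
  exact Finset.measurable_sum _ fun i _ =>
    (measurable_const.indicator hA).comp (measurable_pi_apply i)

theorem integral_pow_countIn (ρ : Measure Z) [IsProbabilityMeasure ρ] (I : Finset (Fin s))
    {A : Set Z} (hA : MeasurableSet A) (t : ℝ) :
    ∫ z, t ^ countIn I A z ∂(Measure.pi fun _ : Fin s => ρ) =
      (1 + (t - 1) * ρ.real A) ^ I.card := by
  simp only [pow_countIn]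
  rw [integral_fintype_prod_eq_prod (𝕜 := ℝ)
    (f := fun i a => if i ∈ I then 1 + A.indicator (fun _ => t - 1) a else 1)]
  have : ∀ i, ∫ a, (if i ∈ I then 1 + A.indicator (fun _ => t - 1) a else 1) ∂ρ =
      if i ∈ I then 1 + (t - 1) * ρ.real A else 1 := by
    intro i
    split_ifs
    · rw [integral_add (integrable_const _) ((integrable_const _).indicator hA),
        integral_indicator_const _ hA]
      simp [mul_comm]
    · simp
  simp only [this]
  rw [Finset.prod_ite_mem, Finset.univ_inter, Finset.prod_const]

theorem integrable_pow_countIn (ρ : Measure Z) [IsProbabilityMeasure ρ] (I : Finset (Fin s))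
    {A : Set Z} (hA : MeasurableSet A) {t : ℝ} (ht : 0 < t) :
    Integrable (fun z => t ^ countIn I A z) (Measure.pi fun _ : Fin s => ρ) := by
  have hm : Measurable fun z : Fin s → Z => t ^ countIn I A z := by
    have : ∀ z : Fin s → Z, t ^ countIn I A z = t ^ (countIn I A z : ℝ) := fun z => by simp
    simp only [this]
    exact measurable_const.pow (measurable_countIn I hA)
  refine Integrable.of_bound hm.aestronglyMeasurable (max 1 t ^ s)
    (Eventually.of_forall fun z => ?_)
  rw [Real.norm_eq_abs, abs_of_nonneg (by positivity)]
  calc t ^ countIn I A z ≤ max 1 t ^ countIn I A z :=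
        pow_le_pow_left₀ ht.le (le_max_right _ _) _
    _ ≤ _ := pow_le_pow_right₀ (le_max_left _ _)
        ((Finset.card_le_univ _).trans (by simp))

theorem four_pow_ge_exp {y : ℝ} (hy : 0 ≤ y) : Real.exp y ≤ 2 ^ (2 * y) := by
  rw [Real.rpow_def_of_pos (by norm_num)]
  refine Real.exp_le_exp.2 ?_
  have := Real.log_two_gt_d9
  nlinarith

theorem two_rpow_le_exp {y : ℝ} (hy : 0 ≤ y) : (2 : ℝ) ^ y ≤ Real.exp y := by
  rw [Real.rpow_def_of_pos (by norm_num)]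
  refine Real.exp_le_exp.2 ?_
  have := Real.log_two_lt_d9
  nlinarith

/-- Markov's inequality for 2^count, whose mean factorises by independence: (1 + ρ(A))^n ≤ e^(qn) ≤
2^(2qn). The base 2 gives the clean tail 2^(-u) at the price of a factor 2 in the mean. -/
theorem measure_countIn_gt_le (ρ : Measure Z) [IsProbabilityMeasure ρ] (I : Finset (Fin s))
    {A : Set Z} (hA : MeasurableSet A) {q : ℝ} (hq : ρ.real A ≤ q) (u : ℝ) :
    (Measure.pi fun _ : Fin s => ρ).real {z | 2 * q * I.card + u < countIn I A z} ≤
      2 ^ (-u) := by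
  set π := Measure.pi fun _ : Fin s => ρ
  have hq0 : 0 ≤ q := measureReal_nonneg.trans hq
  have hn : (0 : ℝ) ≤ I.card := Nat.cast_nonneg _
  set M : ℝ := 2 ^ (2 * q * I.card + u)
  have hM : 0 < M := by positivity
  have h1 := mul_meas_ge_le_integral_of_nonneg (μ := π) (f := fun z => (2 : ℝ) ^ countIn I A z)
    (Eventually.of_forall fun z => by positivity) (integrable_pow_countIn ρ I hA two_pos) M
  rw [integral_pow_countIn ρ I hA] at h1
  have h2 : π.real {z | 2 * q * I.card + u < countIn I A z} ≤
      π.real {z | M ≤ (2 : ℝ) ^ countIn I A z} := by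
    refine measureReal_mono fun z hz => ?_
    have hz' : 2 * q * I.card + u < countIn I A z := hz
    change M ≤ (2 : ℝ) ^ countIn I A z
    rw [← Real.rpow_natCast]
    exact Real.rpow_le_rpow_of_exponent_le (by norm_num) hz'.le
  have h3 : (1 + (2 - 1) * ρ.real A) ^ I.card ≤ 2 ^ (2 * q * I.card) := by
    calc (1 + (2 - 1) * ρ.real A) ^ I.card ≤ Real.exp q ^ I.card := by
          refine pow_le_pow_left₀ (by have := measureReal_nonneg (μ := ρ) (s := A); linarith) ?_ _
          have := Real.add_one_le_exp q; linarith
      _ = Real.exp (q * I.card) := by rw [mul_comm, ← Real.exp_nat_mul]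
      _ ≤ _ := by rw [mul_assoc]; exact four_pow_ge_exp (by positivity)
  have h4 : (2 : ℝ) ^ (2 * q * I.card) = M * 2 ^ (-u) := by
    rw [← Real.rpow_add two_pos]; congr 1; ring
  have h5 : M * π.real {z | M ≤ (2 : ℝ) ^ countIn I A z} ≤ M * 2 ^ (-u) :=
    h1.trans (h3.trans h4.le)
  exact h2.trans (le_of_mul_le_mul_left h5 hM)

/-- Markov's inequality for (1/2)^count, with (1 - ρ(A)/2)^n ≤ e^(-qn/2) ≤ 2^(-qn/4). -/
theorem measure_countIn_lt_le (ρ : Measure Z) [IsProbabilityMeasure ρ] (I : Finset (Fin s))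
    {A : Set Z} (hA : MeasurableSet A) {q : ℝ} (hq0 : 0 ≤ q) (hq : q ≤ ρ.real A) (u : ℝ) :
    (Measure.pi fun _ : Fin s => ρ).real {z | (countIn I A z : ℝ) < q / 4 * I.card - u} ≤
      2 ^ (-u) := by
  set π := Measure.pi fun _ : Fin s => ρ
  have hn : (0 : ℝ) ≤ I.card := Nat.cast_nonneg _
  set M : ℝ := 2 ^ (u - q / 4 * I.card)
  have hM : 0 < M := by positivity
  have h1 := mul_meas_ge_le_integral_of_nonneg (μ := π) (f := fun z => (1 / 2 : ℝ) ^ countIn I A z)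
    (Eventually.of_forall fun z => by positivity) (integrable_pow_countIn ρ I hA (by norm_num)) M
  rw [integral_pow_countIn ρ I hA] at h1
  have h2 : π.real {z | (countIn I A z : ℝ) < q / 4 * I.card - u} ≤
      π.real {z | M ≤ (1 / 2 : ℝ) ^ countIn I A z} := by
    refine measureReal_mono fun z hz => ?_
    have hz' : (countIn I A z : ℝ) < q / 4 * I.card - u := hz
    change M ≤ (1 / 2 : ℝ) ^ countIn I A z
    rw [one_div, ← Real.rpow_natCast, Real.inv_rpow (by norm_num), ← Real.rpow_neg (by norm_num)]
    exact Real.rpow_le_rpow_of_exponent_le (by norm_num) (by linarith)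
  have h3 : (1 + (1 / 2 - 1) * ρ.real A) ^ I.card ≤ 2 ^ (-(q / 4 * I.card)) := by
    calc (1 + (1 / 2 - 1) * ρ.real A) ^ I.card ≤ Real.exp (-(q / 2)) ^ I.card := by
          refine pow_le_pow_left₀ (by
            have := measureReal_le_one (μ := ρ) (s := A); linarith) ?_ _
          have := Real.add_one_le_exp (-(q / 2)); linarith
      _ = Real.exp (-(q / 2 * I.card)) := by rw [← Real.exp_nat_mul]; congr 1; ring
      _ ≤ _ := by
        rw [Real.exp_neg, Real.rpow_neg (by norm_num)]
        refine inv_anti₀ (by positivity) ((two_rpow_le_exp (by positivity)).trans ?_)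
        refine Real.exp_le_exp.2 ?_
        nlinarith [mul_nonneg hq0 hn]
  have h4 : (2 : ℝ) ^ (-(q / 4 * I.card)) = M * 2 ^ (-u) := by
    rw [← Real.rpow_add two_pos]; congr 1; ring
  have h5 : M * π.real {z | M ≤ (1 / 2 : ℝ) ^ countIn I A z} ≤ M * 2 ^ (-u) :=
    h1.trans (h3.trans h4.le)
  exact h2.trans (le_of_mul_le_mul_left h5 hM)

end Concentration

/-! ### From grid boxes to all boxes -/

section Grid

variable {p d s : ℕ}

/-- Observations with covariates in a closed box. -/
def closedBox (d : ℕ) (lo hi : Fin p → ℝ) : Set (Obs p d) := {a | lo ≤ cov a ∧ cov a ≤ hi}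

/-- Observations of the treatment group `w` with covariates in an open box. -/
def openBox (d : ℕ) (lo hi : Fin p → ℝ) (w : Bool) : Set (Obs p d) :=
  {a | (∀ j, lo j < cov a j ∧ cov a j < hi j) ∧ trt a = w}

theorem measurableSet_closedBox (lo hi : Fin p → ℝ) : MeasurableSet (closedBox d lo hi) :=
  measurable_cov (measurableSet_Icc (a := lo) (b := hi))

theorem measurableSet_openBox (lo hi : Fin p → ℝ) (w : Bool) :
    MeasurableSet (openBox d lo hi w) := by
  have : openBox d lo hi w = (⋂ j, {a : Obs p d | lo j < cov a j} ∩ {a | cov a j < hi j}) ∩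
      {a | trt a = w} := by ext a; simp [openBox]
  rw [this]
  have hc : ∀ j, Measurable fun a : Obs p d => cov a j := fun j =>
    (measurable_pi_apply j).comp measurable_cov
  exact (MeasurableSet.iInter fun j => (measurableSet_lt measurable_const (hc j)).inter
    (measurableSet_lt (hc j) measurable_const)).inter (measurable_trt (measurableSet_singleton w))

/-- The mass that `ρ` gives to boxes in the unit cube, and to the treatment groups in them, is
comparable to the volume. -/
structure BoxMass (ρ : Measure (Obs p d)) (a b : ℝ) : Prop where
  cube : ∀ᵐ o ∂ρ, cov o ∈ Set.Icc (0 : Fin p → ℝ) 1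
  upper : ∀ lo hi : Fin p → ℝ, 0 ≤ lo → lo ≤ hi → hi ≤ 1 →
    ρ.real (closedBox d lo hi) ≤ b * boxVol lo hi
  lower : ∀ lo hi : Fin p → ℝ, 0 ≤ lo → lo ≤ hi → hi ≤ 1 → ∀ w,
    a * boxVol lo hi ≤ ρ.real (openBox d lo hi w)

/-- A point of the grid of mesh `1 / m`. -/
noncomputable def gridPoint (m : ℕ) (k : Fin p → Fin (m + 1)) : Fin p → ℝ := fun j => (k j : ℝ) / m

/-- The samples whose numbers of observations in grid boxes are as expected. -/
def gridGood (a b u : ℝ) (m : ℕ) (I : Finset (Fin s)) : Set (Fin s → Obs p d) :=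
  ⋂ k : Fin p → Fin (m + 1), ⋂ l : Fin p → Fin (m + 1), ⋂ _ : k ≤ l,
    {z | (countIn I (closedBox d (gridPoint m k) (gridPoint m l)) z : ℝ) ≤
      2 * (b * boxVol (gridPoint m k) (gridPoint m l)) * I.card + u} ∩
    ⋂ w : Bool, {z | a * boxVol (gridPoint m k) (gridPoint m l) / 4 * I.card - u ≤
      (countIn I (openBox d (gridPoint m k) (gridPoint m l) w) z : ℝ)}

theorem measurableSet_gridGood (a b u : ℝ) (m : ℕ) (I : Finset (Fin s)) :
    MeasurableSet (gridGood (p := p) (d := d) a b u m I) := by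
  refine MeasurableSet.iInter fun k => MeasurableSet.iInter fun l =>
    MeasurableSet.iInter fun _ => ?_
  refine (measurableSet_le (measurable_countIn I (measurableSet_closedBox _ _))
    measurable_const).inter (MeasurableSet.iInter fun w => ?_)
  exact measurableSet_le measurable_const (measurable_countIn I (measurableSet_openBox _ _ w))

theorem gridPoint_nonneg (m : ℕ) (k : Fin p → Fin (m + 1)) : 0 ≤ gridPoint m k := fun j => by
  unfold gridPoint; positivity

theorem gridPoint_le_one (m : ℕ) (k : Fin p → Fin (m + 1)) : gridPoint m k ≤ 1 := fun j => by
  have : ((k j : ℕ) : ℝ) ≤ m := by exact_mod_cast Fin.is_le (k j)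
  exact div_le_one_of_le₀ this (Nat.cast_nonneg _)

theorem gridPoint_mono {m : ℕ} {k l : Fin p → Fin (m + 1)} (h : k ≤ l) :
    gridPoint m k ≤ gridPoint m l := fun j => by
  have : ((k j : ℕ) : ℝ) ≤ (l j : ℕ) := by exact_mod_cast h j
  exact div_le_div_of_nonneg_right this (Nat.cast_nonneg _)

/-- A union bound over the (m + 1)^(2p) pairs of grid corners; each pair contributes one upper event
and a lower event for each of the two groups, hence the 3. -/
theorem measure_compl_gridGood_le {ρ : Measure (Obs p d)} [IsProbabilityMeasure ρ] {a b : ℝ}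
    (hρ : BoxMass ρ a b) (ha : 0 ≤ a) (u : ℝ) (m : ℕ) (I : Finset (Fin s)) :
    (Measure.pi fun _ : Fin s => ρ).real (gridGood a b u m I)ᶜ ≤
      3 * ((m + 1 : ℝ) ^ p) ^ 2 * 2 ^ (-u) := by
  set π := Measure.pi fun _ : Fin s => ρ
  have h1 : ∀ k l : Fin p → Fin (m + 1), k ≤ l →
      π.real {z | (countIn I (closedBox d (gridPoint m k) (gridPoint m l)) z : ℝ) ≤
        2 * (b * boxVol (gridPoint m k) (gridPoint m l)) * I.card + u}ᶜ ≤ 2 ^ (-u) := by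
    intro k l hkl
    have := measure_countIn_gt_le ρ I (measurableSet_closedBox (d := d) (gridPoint m k)
      (gridPoint m l)) (hρ.upper _ _ (gridPoint_nonneg m k) (gridPoint_mono hkl)
      (gridPoint_le_one m l)) u
    refine le_trans (le_of_eq ?_) this
    congr 1
    ext z; simp
  have h2 : ∀ k l : Fin p → Fin (m + 1), k ≤ l → ∀ w,
      π.real {z | a * boxVol (gridPoint m k) (gridPoint m l) / 4 * I.card - u ≤
      (countIn I (openBox d (gridPoint m k) (gridPoint m l) w) z : ℝ)}ᶜ ≤ 2 ^ (-u) := by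
    intro k l hkl w
    have := measure_countIn_lt_le ρ I (measurableSet_openBox (d := d) (gridPoint m k)
      (gridPoint m l) w) (mul_nonneg ha (boxVol_nonneg (gridPoint_mono hkl)))
      (hρ.lower _ _ (gridPoint_nonneg m k) (gridPoint_mono hkl) (gridPoint_le_one m l) w) u
    refine le_trans (le_of_eq ?_) this
    congr 1
    ext z; simp [lt_sub_iff_add_lt]
  have hu : (0 : ℝ) ≤ 2 ^ (-u) := by positivity
  have h3 : ∀ k l : Fin p → Fin (m + 1), π.real (⋂ _ : k ≤ l,
    {z | (countIn I (closedBox d (gridPoint m k) (gridPoint m l)) z : ℝ) ≤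
      2 * (b * boxVol (gridPoint m k) (gridPoint m l)) * I.card + u} ∩
    ⋂ w : Bool, {z | a * boxVol (gridPoint m k) (gridPoint m l) / 4 * I.card - u ≤
      (countIn I (openBox d (gridPoint m k) (gridPoint m l) w) z : ℝ)})ᶜ ≤ 3 * 2 ^ (-u) := by
    intro k l
    by_cases hkl : k ≤ l
    · simp only [hkl, Set.iInter_true, Set.compl_inter, Set.compl_iInter]
      refine (measureReal_union_le _ _).trans ?_
      have h4 := measureReal_iUnion_fintype_le (μ := π) fun w : Bool =>
        {z | a * boxVol (gridPoint m k) (gridPoint m l) / 4 * I.card - u ≤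
        (countIn I (openBox d (gridPoint m k) (gridPoint m l) w) z : ℝ)}ᶜ
      rw [Fintype.sum_bool] at h4
      have := h1 k l hkl
      have := h2 k l hkl true
      have := h2 k l hkl false
      linarith
    · simp only [hkl, Set.iInter_false, Set.compl_univ, measureReal_empty]
      positivity
  rw [gridGood]
  simp only [Set.compl_iInter (ι := Fin p → Fin (m + 1))]
  calc _ ≤ ∑ k : Fin p → Fin (m + 1), ∑ l : Fin p → Fin (m + 1), 3 * (2 : ℝ) ^ (-u) := by
        refine (measureReal_iUnion_fintype_le _).trans (Finset.sum_le_sum fun k _ => ?_)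
        exact (measureReal_iUnion_fintype_le _).trans (Finset.sum_le_sum fun l _ => h3 k l)
    _ = _ := by
        simp only [Finset.sum_const, Finset.card_univ, Fintype.card_pi, Fintype.card_fin,
          Finset.prod_const, nsmul_eq_mul]
        push_cast
        ring

/-- Round a box outwards to the grid for the upper count and inwards for the lower one. Either
rounding changes the volume by at most 2p/m, and as |I| ≤ m this amounts to a bounded number of
observations, absorbed in the additive error. -/
theorem boxRegular_of_mem_gridGood (hp : 0 < p) {a b u : ℝ} {m : ℕ} {I : Finset (Fin s)}
    (ha : 0 ≤ a) (hb : 0 ≤ b) (hu : 0 ≤ u) (hm : 0 < m) (hI : I.card ≤ m)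
    {z : Fin s → Obs p d} (hz : z ∈ gridGood a b u m I) :
    BoxRegular z I (a / 4 * I.card) (2 * b * I.card) (p * (4 * b + a) + u) := by
  classical
  have hm' : (0 : ℝ) < m := Nat.cast_pos.2 hm
  have hIm : (I.card : ℝ) ≤ m := by exact_mod_cast hI
  have hgood : ∀ k l : Fin p → Fin (m + 1), k ≤ l →
      ((countIn I (closedBox d (gridPoint m k) (gridPoint m l)) z : ℝ) ≤
        2 * (b * boxVol (gridPoint m k) (gridPoint m l)) * I.card + u) ∧
      ∀ w, a * boxVol (gridPoint m k) (gridPoint m l) / 4 * I.card - u ≤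
        (countIn I (openBox d (gridPoint m k) (gridPoint m l) w) z : ℝ) := by
    intro k l hkl
    simp only [gridGood, Set.mem_iInter] at hz
    have := hz k l hkl
    exact ⟨this.1, fun w => Set.mem_iInter.1 this.2 w⟩
  have hn2 : (I.card : ℝ) * (p * (2 / m)) ≤ 2 * p := by
    have : (I.card : ℝ) / m ≤ 1 := div_le_one_of_le₀ hIm hm'.le
    calc (I.card : ℝ) * (p * (2 / m)) = 2 * p * (I.card / m) := by ring
      _ ≤ 2 * p * 1 := mul_le_mul_of_nonneg_left this (by positivity)
      _ = _ := mul_one _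
  have hn0 : (0 : ℝ) ≤ I.card := Nat.cast_nonneg _
  constructor
  · intro lo hi h0 hle h1
    let k : Fin p → Fin (m + 1) := fun j => ⟨⌊(m : ℝ) * lo j⌋₊, by
      have h : (m : ℝ) * lo j ≤ m := by
        have := (hle j).trans (h1 j); simp only [Pi.one_apply] at this; nlinarith
      have := Nat.floor_le_floor h
      rw [Nat.floor_natCast] at this; omega⟩
    let l : Fin p → Fin (m + 1) := fun j => ⟨⌈(m : ℝ) * hi j⌉₊, by
      have h : (m : ℝ) * hi j ≤ m := by
        have := h1 j; simp only [Pi.one_apply] at this; nlinarith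
      have := Nat.ceil_le_ceil h
      rw [Nat.ceil_natCast] at this; omega⟩
    have hk : ∀ j, gridPoint m k j ≤ lo j ∧ lo j - 1 / m ≤ gridPoint m k j := by
      intro j
      have h2 := Nat.floor_le (mul_nonneg hm'.le (h0 j))
      have h3 := (Nat.lt_floor_add_one ((m : ℝ) * lo j)).le
      change (⌊(m : ℝ) * lo j⌋₊ : ℝ) / m ≤ _ ∧ _ ≤ (⌊(m : ℝ) * lo j⌋₊ : ℝ) / m
      refine ⟨by rw [div_le_iff₀ hm']; linarith, ?_⟩
      rw [le_div_iff₀ hm', sub_mul, one_div, inv_mul_cancel₀ hm'.ne']; linarith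
    have hl : ∀ j, hi j ≤ gridPoint m l j ∧ gridPoint m l j ≤ hi j + 1 / m := by
      intro j
      have h2 := Nat.le_ceil ((m : ℝ) * hi j)
      have h3 := (Nat.ceil_lt_add_one (mul_nonneg hm'.le ((h0 j).trans (hle j)))).le
      change _ ≤ (⌈(m : ℝ) * hi j⌉₊ : ℝ) / m ∧ (⌈(m : ℝ) * hi j⌉₊ : ℝ) / m ≤ _
      refine ⟨by rw [le_div_iff₀ hm']; linarith, ?_⟩
      rw [div_le_iff₀ hm', add_mul, one_div, inv_mul_cancel₀ hm'.ne']; linarith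
    have hkl : k ≤ l := fun j => by
      have h2 : gridPoint m k j ≤ gridPoint m l j := (hk j).1.trans ((hle j).trans (hl j).1)
      have h3 : ((k j : ℕ) : ℝ) ≤ (l j : ℕ) := by
        simpa [gridPoint, div_le_div_iff_of_pos_right hm'] using h2
      exact_mod_cast h3
    have hvol : boxVol (gridPoint m k) (gridPoint m l) ≤ boxVol lo hi + p * (2 / m) := by
      have := prod_sub_prod_le_sum Finset.univ (fun j => hi j - lo j)
        (fun j => gridPoint m l j - gridPoint m k j) (fun j _ => sub_nonneg.2 (hle j))
        (fun j _ => by have := hk j; have := hl j; linarith)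
        (fun j _ => by
          have := gridPoint_nonneg m k j; have := gridPoint_le_one m l j
          simp only [Pi.zero_apply, Pi.one_apply] at *; linarith)
      have h4 : ∑ j : Fin p, (gridPoint m l j - gridPoint m k j - (hi j - lo j)) ≤
          ∑ j : Fin p, (2 / m : ℝ) := Finset.sum_le_sum fun j _ => by
        have := hk j; have := hl j
        have : (2 / m : ℝ) = 1 / m + 1 / m := by ring
        linarith
      rw [Finset.sum_const, Finset.card_univ, Fintype.card_fin, nsmul_eq_mul] at h4
      unfold boxVol; linarith
    have hcount := (hgood k l hkl).1
    have hsub : (I.filter fun i => lo ≤ cov (z i) ∧ cov (z i) ≤ hi).card ≤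
        countIn I (closedBox d (gridPoint m k) (gridPoint m l)) z := by
      refine Finset.card_le_card fun i hi' => ?_
      obtain ⟨h2, h3, h4⟩ := Finset.mem_filter.1 hi'
      exact Finset.mem_filter.2 ⟨h2, fun j => (hk j).1.trans (h3 j), fun j => (h4 j).trans (hl j).1⟩
    have hsub' : ((I.filter fun i => lo ≤ cov (z i) ∧ cov (z i) ≤ hi).card : ℝ) ≤
        countIn I (closedBox d (gridPoint m k) (gridPoint m l)) z := by exact_mod_cast hsub
    have h5 : 2 * (b * boxVol (gridPoint m k) (gridPoint m l)) * I.card ≤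
        2 * b * I.card * boxVol lo hi + 4 * b * p := by
      have h6 := mul_le_mul_of_nonneg_left hvol (by positivity : 0 ≤ 2 * b * I.card)
      have h7 := mul_le_mul_of_nonneg_left hn2 (by positivity : 0 ≤ 2 * b)
      nlinarith
    have : 0 ≤ (p : ℝ) * a := by positivity
    linarith
  · intro lo hi h0 hle h1 w
    have hv0 := boxVol_nonneg hle
    have hfl : ∀ j, ⌊(m : ℝ) * hi j⌋₊ < m + 1 := fun j => by
      have h : (m : ℝ) * hi j ≤ m := by
        have := h1 j; simp only [Pi.one_apply] at this; nlinarith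
      have := Nat.floor_le_floor h
      rw [Nat.floor_natCast] at this; omega
    by_cases hall : ∀ j, ⌈(m : ℝ) * lo j⌉₊ ≤ ⌊(m : ℝ) * hi j⌋₊
    · let l : Fin p → Fin (m + 1) := fun j => ⟨⌊(m : ℝ) * hi j⌋₊, hfl j⟩
      let k : Fin p → Fin (m + 1) := fun j => ⟨⌈(m : ℝ) * lo j⌉₊, (hall j).trans_lt (hfl j)⟩
      have hkl : k ≤ l := fun j => hall j
      have hk : ∀ j, lo j ≤ gridPoint m k j ∧ gridPoint m k j ≤ lo j + 1 / m := by
        intro j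
        have h2 := Nat.le_ceil ((m : ℝ) * lo j)
        have h3 := (Nat.ceil_lt_add_one (mul_nonneg hm'.le (h0 j))).le
        change _ ≤ (⌈(m : ℝ) * lo j⌉₊ : ℝ) / m ∧ (⌈(m : ℝ) * lo j⌉₊ : ℝ) / m ≤ _
        refine ⟨by rw [le_div_iff₀ hm']; linarith, ?_⟩
        rw [div_le_iff₀ hm', add_mul, one_div, inv_mul_cancel₀ hm'.ne']; linarith
      have hl : ∀ j, gridPoint m l j ≤ hi j ∧ hi j - 1 / m ≤ gridPoint m l j := by
        intro j
        have h2 := Nat.floor_le (mul_nonneg hm'.le ((h0 j).trans (hle j)))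
        have h3 := (Nat.lt_floor_add_one ((m : ℝ) * hi j)).le
        change (⌊(m : ℝ) * hi j⌋₊ : ℝ) / m ≤ _ ∧ _ ≤ (⌊(m : ℝ) * hi j⌋₊ : ℝ) / m
        refine ⟨by rw [div_le_iff₀ hm']; linarith, ?_⟩
        rw [le_div_iff₀ hm', sub_mul, one_div, inv_mul_cancel₀ hm'.ne']; linarith
      have hvol : boxVol lo hi - p * (2 / m) ≤ boxVol (gridPoint m k) (gridPoint m l) := by
        have := prod_sub_prod_le_sum Finset.univ (fun j => gridPoint m l j - gridPoint m k j)
          (fun j => hi j - lo j) (fun j _ => sub_nonneg.2 (gridPoint_mono hkl j))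
          (fun j _ => by have := hk j; have := hl j; linarith)
          (fun j _ => by
            have := h0 j; have := h1 j
            simp only [Pi.zero_apply, Pi.one_apply] at *; linarith)
        have h4 : ∑ j : Fin p, (hi j - lo j - (gridPoint m l j - gridPoint m k j)) ≤
            ∑ j : Fin p, (2 / m : ℝ) := Finset.sum_le_sum fun j _ => by
          have := hk j; have := hl j
          have : (2 / m : ℝ) = 1 / m + 1 / m := by ring
          linarith
        rw [Finset.sum_const, Finset.card_univ, Fintype.card_fin, nsmul_eq_mul] at h4
        unfold boxVol; linarith
      have hcount := (hgood k l hkl).2 w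
      have hsub : countIn I (openBox d (gridPoint m k) (gridPoint m l) w) z ≤
          (I.filter fun i => (∀ j, lo j < cov (z i) j ∧ cov (z i) j < hi j) ∧
            trt (z i) = w).card := by
        refine Finset.card_le_card fun i hi' => ?_
        obtain ⟨h2, h3, h4⟩ := Finset.mem_filter.1 hi'
        exact Finset.mem_filter.2 ⟨h2, fun j => ⟨(hk j).1.trans_lt (h3 j).1,
          (h3 j).2.trans_le (hl j).1⟩, h4⟩
      have hsub' : (countIn I (openBox d (gridPoint m k) (gridPoint m l) w) z : ℝ) ≤
          ((I.filter fun i => (∀ j, lo j < cov (z i) j ∧ cov (z i) j < hi j) ∧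
            trt (z i) = w).card : ℝ) := by exact_mod_cast hsub
      have h5 : a / 4 * I.card * boxVol lo hi - a * p ≤
          a * boxVol (gridPoint m k) (gridPoint m l) / 4 * I.card := by
        have h6 := mul_le_mul_of_nonneg_left hvol (by positivity : 0 ≤ a / 4 * I.card)
        have h7 := mul_le_mul_of_nonneg_left hn2 (by positivity : 0 ≤ a / 4)
        have : 0 ≤ a * p := by positivity
        nlinarith
      have : 0 ≤ (p : ℝ) * b := by positivity
      linarith
    -- No grid box fits inside along feature j. Then that side is at most 2/m, the volume is so
    -- small that the claimed lower bound is not positive, and there is nothing to count.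
    · push Not at hall
      obtain ⟨j, hj⟩ := hall
      have h2 : (m : ℝ) * hi j - m * lo j ≤ 2 := by
        have h3 := (Nat.lt_floor_add_one ((m : ℝ) * hi j)).le
        have h4 := (Nat.ceil_lt_add_one (mul_nonneg hm'.le (h0 j))).le
        have h5 : (⌊(m : ℝ) * hi j⌋₊ : ℝ) + 1 ≤ ⌈(m : ℝ) * lo j⌉₊ := by exact_mod_cast hj
        linarith
      have hv : boxVol lo hi ≤ 2 / m := by
        rw [boxVol_eq_mul lo hi j]
        have h3 : ∏ k ∈ Finset.univ.erase j, (hi k - lo k) ≤ 1 :=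
          Finset.prod_le_one (fun k _ => sub_nonneg.2 (hle k)) fun k _ => by
            have := h0 k; have := h1 k
            simp only [Pi.zero_apply, Pi.one_apply] at *; linarith
        have h4 : hi j - lo j ≤ 2 / m := by rw [le_div_iff₀ hm']; linarith
        exact (mul_le_of_le_one_right (sub_nonneg.2 (hle j)) h3).trans h4
      have hp1 : (1 : ℝ) ≤ p := by exact_mod_cast hp
      have h6 : (I.card : ℝ) * boxVol lo hi ≤ 2 * p := by
        refine le_trans (mul_le_mul_of_nonneg_left ?_ hn0) hn2
        have : 0 ≤ (2 : ℝ) / m := by positivity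
        nlinarith
      have h7 := mul_le_mul_of_nonneg_left h6 (by positivity : 0 ≤ a / 4)
      have : 0 ≤ (p : ℝ) * b := by positivity
      have : 0 ≤ (p : ℝ) * a := by positivity
      have h8 : (0 : ℝ) ≤ (I.filter fun i => (∀ j, lo j < cov (z i) j ∧ cov (z i) j < hi j) ∧
            trt (z i) = w).card := Nat.cast_nonneg _
      linarith

end Grid

/-! ### Leaves on the good event, and the probability of the bad event -/

section Leaf

variable {p d s : ℕ} {𝓔 : Type*} [MeasurableSpace 𝓔]

/-- The numerical constants for the additive error `U` and the threshold `K` of node sizes. -/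
structure Threshold (α : ℝ) (κ : ℕ) (R U K : ℝ) : Prop where
  pos : 0 < K
  error_nonneg : 0 ≤ U
  two_mul_le : 2 * U ≤ α * K
  le : U ≤ 0.3 * K
  count_le : κ + U ≤ R * (0.2 * K - U)

/-- The threshold is a constant multiple of U. Its summand 2/α covers `two_mul_le`, the 10 covers
`le` and the U subtracted in `count_le`, and the last summand supplies (κ + 1) U ≥ κ + U, which is
where 1 ≤ U enters. -/
theorem exists_threshold {α : ℝ} {κ : ℕ} {R : ℝ} (hα : 0 < α) (hR : 0 < R) {U : ℝ} (hU : 0 ≤ U)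
    (hU1 : 1 ≤ U) :
    Threshold α κ R U ((2 / α + 10 + 5 * (κ + 1) / R) * U) := by
  have h1 : 0 ≤ 2 / α := by positivity
  have h2 : 0 ≤ 5 * ((κ : ℝ) + 1) / R := by positivity
  refine ⟨by positivity, hU, ?_, ?_, ?_⟩
  · have : α * ((2 / α + 10 + 5 * (κ + 1) / R) * U) =
        2 * U + α * ((10 + 5 * (κ + 1) / R) * U) := by field_simp; ring
    rw [this]
    have : 0 ≤ α * ((10 + 5 * (κ + 1) / R) * U) := by positivity
    linarith
  · nlinarith [mul_nonneg h1 hU, mul_nonneg h2 hU]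
  · have : R * (0.2 * ((2 / α + 10 + 5 * (κ + 1) / R) * U) - U) =
        (κ + 1) * U + R * U * (0.4 / α + 1) := by field_simp; ring
    rw [this]
    have : 0 ≤ R * U * (0.4 / α + 1) := by positivity
    have : (κ : ℝ) ≤ κ * U := le_mul_of_one_le_right (Nat.cast_nonneg _) hU1
    linarith

namespace TreeProcedure

variable (P : TreeProcedure p d s 𝓔) {x : Fin p → ℝ} {e : 𝓔} {z : Fin s → Obs p d}

theorem inLeaf_iff {w : Bool} {i : Fin s} : P.InLeaf x w i (e, z) ↔
    i ∈ leafPart z (P.second e) (P.tree e z) x ∧ trt (z i) = w := by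
  rw [mem_leafPart]; exact (and_assoc).symm

open Classical in
theorem leafCount_eq_groupCount (x : Fin p → ℝ) (e : 𝓔) (z : Fin s → Obs p d) (w : Bool) :
    P.leafCount x e z w = groupCount z (leafPart z (P.second e) (P.tree e z) x) w := by
  rw [leafCount, groupCount]
  congr 1
  ext i
  rw [Finset.mem_filter, Finset.mem_filter, mem_leafPart, and_assoc]

variable {α a b u K : ℝ} {κ : ℕ}

/-- The tree is regular, its data are in the cube and behave well in grid boxes. -/
structure GoodAt (P : TreeProcedure p d s 𝓔) (α : ℝ) (κ : ℕ) (a b u : ℝ) (e : 𝓔)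
    (z : Fin s → Obs p d) : Prop where
  regular : (P.tree e z).IsRegular α κ z (P.second e)
  cube : ∀ i, cov (z i) ∈ Set.Icc (0 : Fin p → ℝ) 1
  grid : z ∈ gridGood a b u s (P.second e)

variable {P}

theorem GoodAt.boxRegular (h : P.GoodAt α κ a b u e z) (hp : 0 < p) (hs : 0 < s) (ha : 0 < a)
    (hb : 0 < b) (hu : 0 ≤ u) : BoxRegular z (P.second e) (a / 4 * (P.second e).card)
      (2 * b * (P.second e).card) (p * (4 * b + a) + u) :=
  boxRegular_of_mem_gridGood hp ha.le hb.le hu hs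
    ((Finset.card_le_univ _).trans (by simp)) h.grid

theorem ratio_eq {a b n : ℝ} (hn : 0 < n) (hb : 0 < b) :
    a / 4 * n / (2 * b * n) = a / (8 * b) := by field_simp; ring

/-- The root is large enough to have an admissible split, so it already contains κ members of each
group; regularity passes them down to the leaf of x. -/
theorem GoodAt.leafCount_ne_zero (h : P.GoodAt α κ a b u e z) (hp : 0 < p) (hs : 0 < s) (ha : 0 < a)
    (hb : 0 < b) (hu : 0 ≤ u) (hα : α ≤ 0.2) (hκ : 0 < κ)
    (hK : Threshold α κ (a / (8 * b)) (p * (4 * b + a) + u) K)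
    (hn : K ≤ (P.second e).card) (w : Bool) : P.leafCount x e z w ≠ 0 := by
  have hbox := h.boxRegular hp hs ha hb hu
  have hn0 : (0 : ℝ) < (P.second e).card := hK.pos.trans_le hn
  obtain ⟨c, hc⟩ := (NodeBox.root h.cube).exists_admissible hbox (by positivity) (by positivity)
    hK.error_nonneg hα hK.pos hK.le (by rw [ratio_eq hn0 hb]; exact hK.count_le) hn ⟨0, hp⟩
  have h1 : κ ≤ groupCount z (P.second e) w := (hc.2.2 w).1.trans (Finset.card_le_card
    (Finset.filter_subset_filter _ (Finset.filter_subset _ _)))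
  have := SplitTree.IsRegular.le_groupCount_leafPart x w _ _ h.regular h1
  rw [leafCount_eq_groupCount]
  omega

theorem GoodAt.abs_sub_le (h : P.GoodAt α κ a b u e z) (hp : 0 < p) (hs : 0 < s) (ha : 0 < a)
    (hb : 0 < b) (hab : a ≤ b) (hu : 0 ≤ u) (hα0 : 0 < α) (hα : α ≤ 0.2)
    (hx : x ∈ Set.Icc (0 : Fin p → ℝ) 1)
    (hK : Threshold α κ (a / (8 * b)) (p * (4 * b + a) + u) K) {k : ℕ}
    (hn : K ≤ α ^ k * (P.second e).card) {w : Bool} {i : Fin s} (hi : P.InLeaf x w i (e, z))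
    (j : Fin p) :
    |cov (z i) j - x j| ≤ (P.tree e z).pathWeight (1 - α * (a / (32 * b))) j x k := by
  have hbox := h.boxRegular hp hs ha hb hu
  have hn0 : (0 : ℝ) < (P.second e).card := by
    have := hK.pos.trans_le hn
    by_contra! h'
    have := mul_nonpos_of_nonneg_of_nonpos (pow_nonneg hα0.le k) h'
    linarith
  have hr : α * (a / 4 * (P.second e).card) / (4 * (2 * b * (P.second e).card)) =
      α * (a / (32 * b)) := by field_simp; ring
  have hr1 : α * (a / (32 * b)) ≤ 1 := by
    have h1 : a / (32 * b) ≤ 1 := div_le_one_of_le₀ (by linarith) (by positivity)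
    have h2 : α ≤ 1 := by norm_num at hα; linarith
    exact mul_le_one₀ h2 (by positivity) h1
  have := SplitTree.IsRegular.abs_sub_le_pathWeight hbox (by positivity) (by positivity)
    hK.error_nonneg hα0 hα hK.pos hK.two_mul_le hK.le (by rw [ratio_eq hn0 hb]; exact hK.count_le)
    (by rw [hr]; exact hr1) x j k _ _ 0 1 (NodeBox.root h.cube) hx h.regular hn i
    (P.inLeaf_iff.1 hi).1
  rw [hr] at this
  simpa using this

/-- The leaf of x lies in a box with fewer than K observations, so its volume is bounded through the
lower count. Both x and X_i lie in that box, hence the product of coordinate distances is at most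
its volume. -/
theorem GoodAt.prod_abs_sub_le (h : P.GoodAt α κ a b u e z) (hp : 0 < p) (hs : 0 < s) (ha : 0 < a)
    (hb : 0 < b) (hu : 0 ≤ u) (hα : α ≤ 0.2)
    (hx : x ∈ Set.Icc (0 : Fin p → ℝ) 1)
    (hK : Threshold α κ (a / (8 * b)) (p * (4 * b + a) + u) K) {w : Bool} {i : Fin s}
    (hi : P.InLeaf x w i (e, z)) :
    a / 4 * (P.second e).card * ∏ j, |cov (z i) j - x j| ≤ K + (p * (4 * b + a) + u) := by
  have hbox := h.boxRegular hp hs ha hb hu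
  have hn0 : (0 : ℝ) < (P.second e).card := by
    exact_mod_cast Finset.card_pos.2 ⟨i, hi.1⟩
  obtain ⟨lo, hi', h1, h2, h3⟩ := SplitTree.IsRegular.leaf_box hbox (by positivity)
    (by positivity) hK.error_nonneg hα hK.pos hK.le
    (by rw [ratio_eq hn0 hb]; exact hK.count_le) x _ _ 0 1 (NodeBox.root h.cube) hx h.regular
  have h4 := h1.le_card hbox
  have h5 := h1.mem_box i (P.inLeaf_iff.1 hi).1
  have h6 : ∏ j, |cov (z i) j - x j| ≤ boxVol lo hi' :=
    Finset.prod_le_prod (fun _ _ => abs_nonneg _) fun j _ => by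
      have := h5.1 j; have := h5.2 j; have := h2.1 j; have := h2.2 j
      rw [abs_le]; constructor <;> linarith
  have h7 := mul_le_mul_of_nonneg_left h6 (by positivity : 0 ≤ a / 4 * ((P.second e).card : ℝ))
  linarith

/-- The set of auxiliary randomness and data where the data behave badly in grid boxes. -/
def badSet (P : TreeProcedure p d s 𝓔) (a b u : ℝ) : Set (𝓔 × (Fin s → Obs p d)) :=
  {q | q.2 ∉ gridGood a b u s (P.second q.1)}

theorem measurableSet_second_eq (P : TreeProcedure p d s 𝓔) (I : Finset (Fin s)) :
    MeasurableSet {e | P.second e = I} := by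
  have : {e | P.second e = I} = ⋂ i, {e | i ∈ P.second e ↔ i ∈ I} := by
    ext e; simp [Finset.ext_iff]
  rw [this]
  refine MeasurableSet.iInter fun i => ?_
  by_cases h : i ∈ I
  · simpa [h] using P.measurable_second i
  · convert (P.measurable_second i).compl using 1
    ext e; simp [h]

theorem measurableSet_badSet (P : TreeProcedure p d s 𝓔) (a b u : ℝ) :
    MeasurableSet (P.badSet a b u) := by
  have : P.badSet a b u = ⋃ I : Finset (Fin s),
      (Prod.fst ⁻¹' {e | P.second e = I}) ∩ Prod.snd ⁻¹' (gridGood a b u s I)ᶜ := by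
    ext q; simp [badSet]
  rw [this]
  exact MeasurableSet.iUnion fun I => (measurable_fst (P.measurableSet_second_eq I)).inter
    (measurable_snd (measurableSet_gridGood a b u s I).compl)

variable {Ω : Type*} [MeasurableSpace Ω] {μ : Measure Ω} [IsProbabilityMeasure μ]
  {ν : Measure 𝓔} [IsProbabilityMeasure ν] {ρ : Measure (Obs p d)} [IsProbabilityMeasure ρ]
  {ζ : Ω → Fin s → Obs p d}

theorem measurable_badSet_section (P : TreeProcedure p d s 𝓔) (a b u : ℝ) :
    Measurable fun z => ν.real {e | (e, z) ∈ P.badSet a b u} :=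
  (measurable_measure_prodMk_right (μ := ν) (P.measurableSet_badSet a b u)).ennreal_toReal

/-- The half-sample depends on the auxiliary randomness e. By Fubini e may be fixed first, and then
the index set is deterministic and the union bound applies. -/
theorem integral_badSet_le (P : TreeProcedure p d s 𝓔) (hρ : BoxMass ρ a b) (ha : 0 ≤ a) (u : ℝ)
    (hζ : Measurable ζ) (hlaw : μ.map ζ = Measure.pi fun _ => ρ) :
    ∫ ω, ν.real {e | (e, ζ ω) ∈ P.badSet a b u} ∂μ ≤ 3 * ((s + 1 : ℝ) ^ p) ^ 2 * 2 ^ (-u) := by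
  have hm := P.measurableSet_badSet a b u
  rw [← integral_map (f := fun z => ν.real {e | (e, z) ∈ P.badSet a b u}) hζ.aemeasurable
    (P.measurable_badSet_section a b u).aestronglyMeasurable, hlaw]
  set π := Measure.pi fun _ : Fin s => ρ
  have h1 : ∫ z, ν.real {e | (e, z) ∈ P.badSet a b u} ∂π = (ν.prod π).real (P.badSet a b u) := by
    rw [measureReal_def, Measure.prod_apply_symm hm, ← integral_toReal]
    · rfl
    · exact (measurable_measure_prodMk_right hm).aemeasurable
    · exact Eventually.of_forall fun z => measure_lt_top _ _
  have h2 : (ν.prod π).real (P.badSet a b u) = ∫ e, π.real {z | (e, z) ∈ P.badSet a b u} ∂ν := by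
    rw [measureReal_def, Measure.prod_apply hm, ← integral_toReal]
    · rfl
    · exact (measurable_measure_prodMk_left hm).aemeasurable
    · exact Eventually.of_forall fun z => measure_lt_top _ _
  rw [h1, h2]
  have h3 : ∀ e, π.real {z | (e, z) ∈ P.badSet a b u} ≤ 3 * ((s + 1 : ℝ) ^ p) ^ 2 * 2 ^ (-u) :=
    fun e => measure_compl_gridGood_le hρ ha u s (P.second e)
  calc _ ≤ ∫ _, 3 * ((s + 1 : ℝ) ^ p) ^ 2 * 2 ^ (-u) ∂ν :=
        integral_mono_of_nonneg (Eventually.of_forall fun _ => measureReal_nonneg)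
          (integrable_const _) (Eventually.of_forall h3)
    _ = _ := by simp

end TreeProcedure
end Leaf

/-! ### Expected spread and defect; weights far from x -/

namespace TreeProcedure

set_option linter.unusedSectionVars false

variable {p d s : ℕ} {𝓔 : Type*} [MeasurableSpace 𝓔] {P : TreeProcedure p d s 𝓔}
  {x : Fin p → ℝ} {e : 𝓔} {z : Fin s → Obs p d} {α a b u K : ℝ} {κ : ℕ}

theorem sum_abs_weight_le (P : TreeProcedure p d s 𝓔) (x : Fin p → ℝ) (e : 𝓔)
    (z : Fin s → Obs p d) : ∑ i, |P.weight x e z i| ≤ 2 := by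
  have h : ∀ w i, |P.groupWeight x e z w i| = groupSign w * P.groupWeight x e z w i := fun w i => by
    rw [← abs_of_nonneg (P.groupSign_mul_groupWeight_nonneg x e z w i), abs_mul, abs_groupSign,
      one_mul]
  calc ∑ i, |P.weight x e z i|
      ≤ ∑ i, (groupSign true * P.groupWeight x e z true i +
          groupSign false * P.groupWeight x e z false i) := Finset.sum_le_sum fun i _ => by
        rw [← h, ← h]; exact abs_add_le _ _
    _ ≤ 1 + 1 := by
        rw [Finset.sum_add_distrib]
        exact add_le_add (P.sum_groupSign_mul_groupWeight_le x e z true)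
          (P.sum_groupSign_mul_groupWeight_le x e z false)
    _ = 2 := by norm_num

theorem exists_inLeaf_of_weight_ne_zero {i : Fin s} (h : P.weight x e z i ≠ 0) :
    ∃ w, P.InLeaf x w i (e, z) := by
  classical
  rw [weight_eq_groupWeight, groupWeight_eq] at h
  by_contra! hn
  exact h (if_neg (hn _))

theorem norm_sub_le_one {x y : Fin p → ℝ} (hx : x ∈ Set.Icc (0 : Fin p → ℝ) 1)
    (hy : y ∈ Set.Icc (0 : Fin p → ℝ) 1) : ‖y - x‖ ≤ 1 := by
  refine (pi_norm_le_iff_of_nonneg zero_le_one).2 fun j => ?_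
  have h1 := hx.1 j; have h2 := hx.2 j; have h3 := hy.1 j; have h4 := hy.2 j
  simp only [Pi.zero_apply, Pi.one_apply] at h1 h2 h3 h4
  rw [Pi.sub_apply, Real.norm_eq_abs, abs_le]
  constructor <;> linarith

theorem sum_abs_weight_mul_norm_le_two (P : TreeProcedure p d s 𝓔) (e : 𝓔)
    (hx : x ∈ Set.Icc (0 : Fin p → ℝ) 1)
    (hz : ∀ i, cov (z i) ∈ Set.Icc (0 : Fin p → ℝ) 1) :
    ∑ i, |P.weight x e z i| * ‖cov (z i) - x‖ ≤ 2 :=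
  (Finset.sum_le_sum fun i _ => mul_le_of_le_one_right (abs_nonneg _)
    (norm_sub_le_one hx (hz i))).trans (P.sum_abs_weight_le x e z)

/-- Only observations in the leaf carry weight, and their supremum distance from x is at most the
sum over features of the path weights. The total weight of the two groups is at most 2. -/
theorem GoodAt.sum_abs_weight_mul_norm_le (h : P.GoodAt α κ a b u e z) (hp : 0 < p) (hs : 0 < s)
    (ha : 0 < a) (hb : 0 < b) (hab : a ≤ b) (hu : 0 ≤ u) (hα0 : 0 < α) (hα : α ≤ 0.2)
    (hx : x ∈ Set.Icc (0 : Fin p → ℝ) 1)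
    (hK : Threshold α κ (a / (8 * b)) (p * (4 * b + a) + u) K) {k : ℕ}
    (hn : K ≤ α ^ k * (P.second e).card) :
    ∑ i, |P.weight x e z i| * ‖cov (z i) - x‖ ≤
      2 * ∑ j, (P.tree e z).pathWeight (1 - α * (a / (32 * b))) j x k := by
  have hr1 : 0 ≤ 1 - α * (a / (32 * b)) := by
    have h1 : a / (32 * b) ≤ 1 := div_le_one_of_le₀ (by linarith) (by positivity)
    have h2 : α ≤ 1 := by norm_num at hα; linarith
    have := mul_le_one₀ h2 (by positivity) h1
    linarith
  have hnn : 0 ≤ ∑ j, (P.tree e z).pathWeight (1 - α * (a / (32 * b))) j x k :=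
    Finset.sum_nonneg fun j _ => SplitTree.pathWeight_nonneg hr1 j x _ k
  calc ∑ i, |P.weight x e z i| * ‖cov (z i) - x‖
      ≤ ∑ i, |P.weight x e z i| *
          ∑ j, (P.tree e z).pathWeight (1 - α * (a / (32 * b))) j x k := by
        refine Finset.sum_le_sum fun i _ => ?_
        by_cases hw : P.weight x e z i = 0
        · simp [hw]
        obtain ⟨w, hw⟩ := exists_inLeaf_of_weight_ne_zero hw
        refine mul_le_mul_of_nonneg_left ?_ (abs_nonneg _)
        refine (pi_norm_le_iff_of_nonneg hnn).2 fun j => ?_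
        rw [Pi.sub_apply, Real.norm_eq_abs]
        refine (h.abs_sub_le hp hs ha hb hab hu hα0 hα hx hK hn hw j).trans ?_
        exact Finset.single_le_sum (f := fun j =>
          (P.tree e z).pathWeight (1 - α * (a / (32 * b))) j x k)
          (fun j _ => SplitTree.pathWeight_nonneg hr1 j x _ k) (Finset.mem_univ j)
    _ ≤ _ := by
        rw [← Finset.sum_mul]
        exact mul_le_mul_of_nonneg_right (P.sum_abs_weight_le x e z) hnn

variable (P) in
/-- The weighted mean distance from `x` of the observations that contribute at `x`. -/
noncomputable def spread (ν : Measure 𝓔) (x : Fin p → ℝ) (z : Fin s → Obs p d) : ℝ :=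
  ∑ i, |P.meanWeight ν x z i| * ‖cov (z i) - x‖

variable (P) in
/-- The mean number of treatment groups that are not represented in the leaf of `x`. -/
noncomputable def defect (ν : Measure 𝓔) (x : Fin p → ℝ) (z : Fin s → Obs p d) : ℝ :=
  ∑ w : Bool, (1 - ∑ i, if trt (z i) = w then |P.meanWeight ν x z i| else 0)

variable {Ω : Type*} [MeasurableSpace Ω] {μ : Measure Ω} [IsProbabilityMeasure μ]
  {ν : Measure 𝓔} [IsProbabilityMeasure ν] {ρ : Measure (Obs p d)} [IsProbabilityMeasure ρ]
  {ζ : Ω → Fin s → Obs p d}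

theorem spread_nonneg (P : TreeProcedure p d s 𝓔) (z : Fin s → Obs p d) : 0 ≤ P.spread ν x z :=
  Finset.sum_nonneg fun _ _ => by positivity

theorem defect_nonneg (P : TreeProcedure p d s 𝓔) (z : Fin s → Obs p d) : 0 ≤ P.defect ν x z :=
  Finset.sum_nonneg fun w _ => sub_nonneg.2 (P.sum_abs_meanWeight_group_le ν x z w)

theorem defect_le_two (P : TreeProcedure p d s 𝓔) (z : Fin s → Obs p d) : P.defect ν x z ≤ 2 := by
  have h : ∀ w, 0 ≤ ∑ i, (if trt (z i) = w then |P.meanWeight ν x z i| else 0) := fun w =>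
    Finset.sum_nonneg fun i _ => by positivity
  have h1 := h true
  have h2 := h false
  rw [defect, Fintype.sum_bool]
  linarith

theorem sum_abs_meanWeight_le_two (P : TreeProcedure p d s 𝓔) (z : Fin s → Obs p d) :
    ∑ i, |P.meanWeight ν x z i| ≤ 2 := by
  have h : ∀ i, |P.meanWeight ν x z i| =
      ∑ w : Bool, if trt (z i) = w then |P.meanWeight ν x z i| else 0 := fun i => by simp
  rw [Finset.sum_congr rfl fun i _ => h i, Finset.sum_comm]
  have h1 := P.sum_abs_meanWeight_group_le ν x z true
  have h2 := P.sum_abs_meanWeight_group_le ν x z false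
  rw [Fintype.sum_bool]
  linarith

theorem spread_le_two (P : TreeProcedure p d s 𝓔) (hx : x ∈ Set.Icc (0 : Fin p → ℝ) 1)
    (hz : ∀ i, cov (z i) ∈ Set.Icc (0 : Fin p → ℝ) 1) : P.spread ν x z ≤ 2 :=
  (Finset.sum_le_sum fun i _ => mul_le_of_le_one_right (abs_nonneg _)
    (norm_sub_le_one hx (hz i))).trans (P.sum_abs_meanWeight_le_two z)

theorem measurable_spread (P : TreeProcedure p d s 𝓔) : Measurable (P.spread ν x) := by
  refine Finset.measurable_sum _ fun i _ => ?_
  have h1 : Measurable fun z : Fin s → Obs p d => cov (z i) :=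
    measurable_cov.comp (measurable_pi_apply i)
  exact (P.measurable_meanWeight ν x i).abs.mul (h1.sub_const x).norm

theorem measurable_defect (P : TreeProcedure p d s 𝓔) : Measurable (P.defect ν x) := by
  refine Finset.measurable_sum _ fun w _ => ?_
  refine measurable_const.sub (Finset.measurable_sum _ fun i _ => ?_)
  exact Measurable.ite ((measurable_trt.comp (measurable_pi_apply i)) (measurableSet_singleton w))
    (P.measurable_meanWeight ν x i).abs measurable_const

/-- For fixed data, integrate over the auxiliary randomness: off the bad set the path weights bound
the spread and decay geometrically in mean, on the bad set the trivial bound 2 is used. -/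
theorem spread_le (P : TreeProcedure p d s 𝓔) (hp : 0 < p) (hs : 0 < s)
    (ha : 0 < a) (hb : 0 < b) (hab : a ≤ b) (hu : 0 ≤ u) (hα0 : 0 < α) (hα : α ≤ 0.2)
    (hx : x ∈ Set.Icc (0 : Fin p → ℝ) 1)
    (hK : Threshold α κ (a / (8 * b)) (p * (4 * b + a) + u) K) {k : ℕ}
    (hn : ∀ e, K ≤ α ^ k * (P.second e).card) {π₀ : ℝ} (hπ : 0 < π₀)
    (hreg : P.IsAlphaRegular ν α κ z) (hran : P.IsRandomSplit ν π₀ z)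
    (hz : ∀ i, cov (z i) ∈ Set.Icc (0 : Fin p → ℝ) 1) :
    P.spread ν x z ≤ 2 * p * (1 - α * (a / (32 * b)) * min (π₀ / p) 1) ^ k +
      2 * ν.real {e | (e, z) ∈ P.badSet a b u} := by
  have hr0 : 0 ≤ α * (a / (32 * b)) := by positivity
  have hr1 : 0 ≤ 1 - α * (a / (32 * b)) := by
    have h1 : a / (32 * b) ≤ 1 := div_le_one_of_le₀ (by linarith) (by positivity)
    have h2 : α ≤ 1 := by norm_num at hα; linarith
    have := mul_le_one₀ h2 (by positivity) h1
    linarith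
  set r := 1 - α * (a / (32 * b)) with hr
  have htree : Measurable fun e => P.tree e z :=
    P.measurable_tree.comp (measurable_id.prodMk measurable_const)
  have hbadm : MeasurableSet {e | (e, z) ∈ P.badSet a b u} :=
    (measurable_id.prodMk measurable_const) (P.measurableSet_badSet a b u)
  have : IsProbabilityMeasure (ν.map fun e => P.tree e z) :=
    Measure.isProbabilityMeasure_map htree.aemeasurable
  have hpw : ∀ j, Integrable (fun e => (P.tree e z).pathWeight r j x k) ν ∧
      ∫ e, (P.tree e z).pathWeight r j x k ∂ν ≤
        (1 - α * (a / (32 * b)) * min (π₀ / p) 1) ^ k := by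
    intro j
    have h1 := SplitTree.integrable_pathWeight (ν.map fun e => P.tree e z) hr1
      (by linarith : r ≤ 1) j x k
    refine ⟨h1.comp_measurable htree, ?_⟩
    have h2 := SplitTree.integral_pathWeight_le (ν.map fun e => P.tree e z) hr1
      (by linarith : r ≤ 1) (min_le_left (π₀ / p) 1) (min_le_right _ _)
      (le_min (by positivity) zero_le_one) j x (fun v => hran v j) k
    rw [integral_map htree.aemeasurable h1.aestronglyMeasurable] at h2
    refine h2.trans (le_of_eq ?_)
    rw [hr]; ring
  have hiw : ∀ i, Integrable (fun e => |P.weight x e z i| * ‖cov (z i) - x‖) ν := fun i =>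
    (P.integrable_weight ν x z i).abs.mul_const _
  have h1 : P.spread ν x z ≤ ∫ e, ∑ i, |P.weight x e z i| * ‖cov (z i) - x‖ ∂ν := by
    rw [integral_finsetSum _ fun i _ => hiw i]
    refine Finset.sum_le_sum fun i _ => ?_
    rw [integral_mul_const]
    exact mul_le_mul_of_nonneg_right abs_integral_le_integral_abs (norm_nonneg _)
  have hind : Integrable ({e | (e, z) ∈ P.badSet a b u}.indicator fun _ => (1 : ℝ)) ν :=
    (integrable_const _).indicator hbadm
  have hsum : Integrable (fun e => ∑ j, (P.tree e z).pathWeight r j x k) ν :=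
    integrable_finsetSum _ fun j _ => (hpw j).1
  have h2 : ∫ e, ∑ i, |P.weight x e z i| * ‖cov (z i) - x‖ ∂ν ≤
      ∫ e, (2 * ∑ j, (P.tree e z).pathWeight r j x k +
        2 * {e | (e, z) ∈ P.badSet a b u}.indicator (fun _ => (1 : ℝ)) e) ∂ν := by
    refine integral_mono_ae (integrable_finsetSum _ fun i _ => hiw i)
      ((hsum.const_mul 2).add (hind.const_mul 2)) ?_
    filter_upwards [hreg] with e he
    have hnn : 0 ≤ ∑ j, (P.tree e z).pathWeight r j x k :=
      Finset.sum_nonneg fun j _ => SplitTree.pathWeight_nonneg hr1 j x _ k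
    by_cases hbad : (e, z) ∈ P.badSet a b u
    · rw [Set.indicator_of_mem (by exact hbad)]
      have := P.sum_abs_weight_mul_norm_le_two e hx hz
      linarith
    · rw [Set.indicator_of_notMem (by exact hbad)]
      have hgood : P.GoodAt α κ a b u e z := ⟨he, hz, not_not.1 hbad⟩
      have := hgood.sum_abs_weight_mul_norm_le hp hs ha hb hab hu hα0 hα hx hK (hn e)
      linarith
  refine h1.trans (h2.trans ?_)
  rw [integral_add (hsum.const_mul 2) (hind.const_mul 2), integral_const_mul, integral_const_mul,
    integral_indicator_const _ hbadm, integral_finsetSum _ fun j _ => (hpw j).1]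
  have h3 := Finset.sum_le_sum fun j (_ : j ∈ Finset.univ) => (hpw j).2
  rw [Finset.sum_const, Finset.card_univ, Fintype.card_fin, nsmul_eq_mul] at h3
  simp only [smul_eq_mul, mul_one]
  linarith

theorem defect_le (P : TreeProcedure p d s 𝓔) (hp : 0 < p) (hs : 0 < s)
    (ha : 0 < a) (hb : 0 < b) (hu : 0 ≤ u) (hα : α ≤ 0.2) (hκ : 0 < κ)
    (hK : Threshold α κ (a / (8 * b)) (p * (4 * b + a) + u) K)
    (hn : ∀ e, K ≤ (P.second e).card)
    (hreg : P.IsAlphaRegular ν α κ z)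
    (hz : ∀ i, cov (z i) ∈ Set.Icc (0 : Fin p → ℝ) 1) (w : Bool) :
    1 - ν.real {e | (e, z) ∈ P.badSet a b u} ≤
      ∑ i, if trt (z i) = w then |P.meanWeight ν x z i| else 0 := by
  rw [sum_abs_meanWeight_group]
  have hbadm : MeasurableSet {e | (e, z) ∈ P.badSet a b u} :=
    (measurable_id.prodMk measurable_const) (P.measurableSet_badSet a b u)
  rw [← probReal_compl_eq_one_sub hbadm]
  refine ENNReal.toReal_mono (measure_ne_top _ _) (measure_mono_ae ?_)
  filter_upwards [hreg] with e he hbad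
  have hgood : P.GoodAt α κ a b u e z := ⟨he, hz, not_not.1 hbad⟩
  exact hgood.leafCount_ne_zero hp hs ha hb hu hα hκ hK (hn e) w

variable (ν) in
/-- The trees concentrate around `x`, and the weights of the groups nearly sum to one. -/
theorem integral_spread_add_defect_le (P : TreeProcedure p d s 𝓔) (hp : 0 < p) (hs : 0 < s)
    (ha : 0 < a) (hb : 0 < b) (hab : a ≤ b) (hu : 0 ≤ u) (hα0 : 0 < α) (hα : α ≤ 0.2)
    (hκ : 0 < κ) (hx : x ∈ Set.Icc (0 : Fin p → ℝ) 1)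
    (hK : Threshold α κ (a / (8 * b)) (p * (4 * b + a) + u) K) {k : ℕ}
    (hn : ∀ e, K ≤ α ^ k * (P.second e).card) {π₀ : ℝ} (hπ : 0 < π₀)
    (hρ : BoxMass ρ a b) (hζ : Measurable ζ) (hlaw : μ.map ζ = Measure.pi fun _ => ρ)
    (hreg : ∀ᵐ ω ∂μ, P.IsAlphaRegular ν α κ (ζ ω))
    (hran : ∀ᵐ ω ∂μ, P.IsRandomSplit ν π₀ (ζ ω))
    (hcube : ∀ᵐ ω ∂μ, ∀ i, cov (ζ ω i) ∈ Set.Icc (0 : Fin p → ℝ) 1) :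
    ∫ ω, (P.spread ν x (ζ ω) + P.defect ν x (ζ ω)) ∂μ ≤
      2 * p * (1 - α * (a / (32 * b)) * min (π₀ / p) 1) ^ k +
        12 * ((s + 1 : ℝ) ^ p) ^ 2 * 2 ^ (-u) := by
  have hα1 : α ≤ 1 := by norm_num at hα; linarith
  have hn' : ∀ e, K ≤ (P.second e).card := fun e => (hn e).trans
    (mul_le_of_le_one_left (Nat.cast_nonneg _) (pow_le_one₀ hα0.le hα1))
  have hint : Integrable (fun ω => ν.real {e | (e, ζ ω) ∈ P.badSet a b u}) μ :=
    Integrable.of_bound ((P.measurable_badSet_section a b u).comp hζ).aestronglyMeasurable 1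
      (Eventually.of_forall fun ω => by
        rw [Real.norm_eq_abs, abs_of_nonneg measureReal_nonneg]; exact measureReal_le_one)
  -- The factor 4 counts twice the bad probability from the spread and once from each of the two
  -- groups in the defect.
  have hle : ∫ ω, (P.spread ν x (ζ ω) + P.defect ν x (ζ ω)) ∂μ ≤
      ∫ ω, (2 * p * (1 - α * (a / (32 * b)) * min (π₀ / p) 1) ^ k +
        4 * ν.real {e | (e, ζ ω) ∈ P.badSet a b u}) ∂μ := by
    refine integral_mono_of_nonneg (Eventually.of_forall fun ω =>
      add_nonneg (P.spread_nonneg _) (P.defect_nonneg _))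
      ((integrable_const _).add (hint.const_mul 4)) ?_
    filter_upwards [hreg, hran, hcube] with ω h1 h2 h3
    have h4 := P.spread_le hp hs ha hb hab hu hα0 hα hx hK hn hπ h1 h2 h3
    have h5 := P.defect_le (x := x) hp hs ha hb hu hα hκ hK hn' h1 h3 true
    have h6 := P.defect_le (x := x) hp hs ha hb hu hα hκ hK hn' h1 h3 false
    rw [defect, Fintype.sum_bool]
    linarith
  refine hle.trans ?_
  rw [integral_add (integrable_const _) (hint.const_mul 4)]
  have := P.integral_badSet_le (ν := ν) hρ ha.le u hζ hlaw
  simp only [integral_const, probReal_univ, one_smul, integral_const_mul]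
  linarith

variable (ν) in
/-- Observations that are far from `x` get weights that are small in the mean. -/
theorem integral_abs_meanWeight_far_le (P : TreeProcedure p d s 𝓔) (hp : 0 < p) (hs : 0 < s)
    (ha : 0 < a) (hb : 0 < b) (hu : 0 ≤ u) (hα : α ≤ 0.2)
    (hx : x ∈ Set.Icc (0 : Fin p → ℝ) 1)
    (hK : Threshold α κ (a / (8 * b)) (p * (4 * b + a) + u) K) {R : ℝ}
    (hR : ∀ e, K + (p * (4 * b + a) + u) < a / 4 * (P.second e).card * R)
    (hρ : BoxMass ρ a b) (hζ : Measurable ζ) (hlaw : μ.map ζ = Measure.pi fun _ => ρ)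
    (hreg : ∀ᵐ ω ∂μ, P.IsAlphaRegular ν α κ (ζ ω))
    (hcube : ∀ᵐ ω ∂μ, ∀ i, cov (ζ ω i) ∈ Set.Icc (0 : Fin p → ℝ) 1) (i : Fin s) :
    ∫ ω, {ω | R ≤ ∏ j, |cov (ζ ω i) j - x j|}.indicator
        (fun ω => |P.meanWeight ν x (ζ ω) i|) ω ∂μ ≤
      3 * ((s + 1 : ℝ) ^ p) ^ 2 * 2 ^ (-u) := by
  have hint : Integrable (fun ω => ν.real {e | (e, ζ ω) ∈ P.badSet a b u}) μ :=
    Integrable.of_bound ((P.measurable_badSet_section a b u).comp hζ).aestronglyMeasurable 1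
      (Eventually.of_forall fun ω => by
        rw [Real.norm_eq_abs, abs_of_nonneg measureReal_nonneg]; exact measureReal_le_one)
  refine le_trans ?_ (P.integral_badSet_le (ν := ν) hρ ha.le u hζ hlaw)
  refine integral_mono_of_nonneg (Eventually.of_forall fun ω =>
    Set.indicator_nonneg (fun _ _ => abs_nonneg _) _) hint ?_
  filter_upwards [hreg, hcube] with ω h1 h2
  by_cases hfar : R ≤ ∏ j, |cov (ζ ω i) j - x j|
  · rw [Set.indicator_of_mem (by exact hfar)]
    have hbadm : MeasurableSet {e | (e, ζ ω) ∈ P.badSet a b u} :=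
      (measurable_id.prodMk measurable_const) (P.measurableSet_badSet a b u)
    calc |P.meanWeight ν x (ζ ω) i| ≤ ∫ e, |P.weight x e (ζ ω) i| ∂ν :=
          abs_integral_le_integral_abs
      _ ≤ ∫ e, {e | (e, ζ ω) ∈ P.badSet a b u}.indicator (fun _ => (1 : ℝ)) e ∂ν := by
          refine integral_mono_ae (P.integrable_weight ν x _ i).abs
            ((integrable_const _).indicator hbadm) ?_
          filter_upwards [h1] with e he
          by_cases hbad : (e, ζ ω) ∈ P.badSet a b u
          · rw [Set.indicator_of_mem (by exact hbad)]
            exact P.abs_weight_le x e _ i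
          · rw [Set.indicator_of_notMem (by exact hbad)]
            have hgood : P.GoodAt α κ a b u e (ζ ω) := ⟨he, h2, not_not.1 hbad⟩
            have : P.weight x e (ζ ω) i = 0 := by
              by_contra hne
              obtain ⟨w, hw⟩ := exists_inLeaf_of_weight_ne_zero hne
              have h3 := hgood.prod_abs_sub_le hp hs ha hb hu hα hx hK hw
              have h4 := mul_le_mul_of_nonneg_left hfar
                (by positivity : 0 ≤ a / 4 * ((P.second e).card : ℝ))
              have := hR e
              linarith
            simp [this]
      _ = _ := by rw [integral_indicator_const _ hbadm]; simp
  · rw [Set.indicator_of_notMem (by exact hfar)]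
    exact measureReal_nonneg

end TreeProcedure

/-! ### Projection on one coordinate and Bessel's inequality -/

section Projection

set_option linter.unusedSectionVars false

variable {Z : Type*} [MeasurableSpace Z] {s : ℕ} (ρ : Measure Z) [IsProbabilityMeasure ρ]

theorem measurable_update_prod (i : Fin s) :
    Measurable fun q : Z × (Fin s → Z) => Function.update q.2 i q.1 := by
  refine measurable_pi_lambda _ fun j => ?_
  by_cases h : j = i
  · subst h; simpa using measurable_fst
  · simp only [Function.update_of_ne h]
    exact (measurable_pi_apply j).comp measurable_snd

/-- Replacing one coordinate by an independent copy preserves the product law. This makes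
`coordMean` a concrete version of the conditional expectation given one observation. -/
theorem measurePreserving_update (i : Fin s) :
    MeasurePreserving (fun q : Z × (Fin s → Z) => Function.update q.2 i q.1)
      (ρ.prod (Measure.pi fun _ => ρ)) (Measure.pi fun _ => ρ) := by
  refine ⟨measurable_update_prod i, (Measure.pi_eq fun S hS => ?_).symm⟩
  rw [Measure.map_apply (measurable_update_prod i) (MeasurableSet.univ_pi hS)]
  have : (fun q : Z × (Fin s → Z) => Function.update q.2 i q.1) ⁻¹' (Set.univ.pi S) =
      S i ×ˢ Set.univ.pi (Function.update S i Set.univ) := by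
    ext q
    simp only [Set.mem_preimage, Set.mem_pi, Set.mem_univ, true_imp_iff, Set.mem_prod]
    constructor
    · intro h
      refine ⟨by simpa using h i, fun j => ?_⟩
      by_cases hj : j = i
      · subst hj; simp
      · simpa [hj] using h j
    · rintro ⟨h1, h2⟩ j
      by_cases hj : j = i
      · subst hj; simpa using h1
      · simpa [hj] using h2 j
  rw [this, Measure.prod_prod, Measure.pi_pi, ← Finset.mul_prod_erase Finset.univ _
    (Finset.mem_univ i), ← Finset.mul_prod_erase Finset.univ (fun j => ρ (S j)) (Finset.mem_univ i)]
  simp only [Function.update_self, measure_univ, one_mul]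
  congr 1
  exact Finset.prod_congr rfl fun j hj => by
    rw [Function.update_of_ne (Finset.ne_of_mem_erase hj)]

theorem measurePreserving_comp_perm (τ : Equiv.Perm (Fin s)) :
    MeasurePreserving (fun z : Fin s → Z => z ∘ τ) (Measure.pi fun _ => ρ)
      (Measure.pi fun _ => ρ) := by
  have hm : Measurable fun z : Fin s → Z => z ∘ τ :=
    measurable_pi_lambda _ fun j => measurable_pi_apply (τ j)
  refine ⟨hm, (Measure.pi_eq fun S hS => ?_).symm⟩
  rw [Measure.map_apply hm (MeasurableSet.univ_pi hS)]
  have : (fun z : Fin s → Z => z ∘ τ) ⁻¹' (Set.univ.pi S) = Set.univ.pi fun j => S (τ.symm j) := by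
    ext z
    simp only [Set.mem_preimage, Set.mem_pi, Set.mem_univ, true_imp_iff, Function.comp]
    exact ⟨fun h j => by simpa using h (τ.symm j), fun h j => by simpa using h (τ j)⟩
  rw [this, Measure.pi_pi]
  exact Equiv.prod_comp τ.symm fun j => ρ (S j)

variable {F : Type*} [NormedAddCommGroup F] [InnerProductSpace ℝ F] [CompleteSpace F]

/-- The mean of `G` over all coordinates other than `i`, where the coordinate `i` is `a`. -/
noncomputable def coordMean (i : Fin s) (G : (Fin s → Z) → F) (a : Z) : F :=
  ∫ z, G (Function.update z i a) ∂(Measure.pi fun _ => ρ)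

variable {ρ} {G : (Fin s → Z) → F} {C : ℝ}

theorem stronglyMeasurable_coordMean (hG : StronglyMeasurable G) (i : Fin s) :
    StronglyMeasurable (coordMean ρ i G) :=
  (hG.comp_measurable (measurable_update_prod i)).integral_prod_right'

theorem norm_coordMean_le (hC : ∀ z, ‖G z‖ ≤ C) (i : Fin s) (a : Z) :
    ‖coordMean ρ i G a‖ ≤ C := by
  refine (norm_integral_le_of_norm_le_const (Eventually.of_forall fun z => hC _)).trans ?_
  simp

theorem integral_eq_integral_update (hG : Integrable G (Measure.pi fun _ => ρ)) (i : Fin s) :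
    ∫ z, G z ∂(Measure.pi fun _ => ρ) = ∫ a, coordMean ρ i G a ∂ρ := by
  have h := measurePreserving_update ρ i
  rw [← h.map_eq, integral_map h.aemeasurable (by rw [h.map_eq]; exact hG.aestronglyMeasurable)]
  exact integral_prod _ (h.integrable_comp_of_integrable hG)

theorem integrable_of_bounded {α : Type*} [MeasurableSpace α] {π : Measure α} [IsFiniteMeasure π]
    {E : Type*} [NormedAddCommGroup E] {f : α → E}
    (hf : StronglyMeasurable f) (hC : ∀ z, ‖f z‖ ≤ C) : Integrable f π :=
  Integrable.of_bound hf.aestronglyMeasurable C (Eventually.of_forall hC)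

theorem integrable_update (hG : StronglyMeasurable G) (hC : ∀ z, ‖G z‖ ≤ C) (i : Fin s) (a : Z) :
    Integrable (fun z => G (Function.update z i a)) (Measure.pi fun _ => ρ) :=
  integrable_of_bounded (hG.comp_measurable
    ((measurable_update_prod i).comp (measurable_const.prodMk measurable_id))) fun z => hC _

theorem integral_inner_coord (hG : StronglyMeasurable G) (hC : ∀ z, ‖G z‖ ≤ C) {h : Z → F} {C' : ℝ}
    (hh : StronglyMeasurable h) (hC' : ∀ a, ‖h a‖ ≤ C') (i : Fin s) :
    ∫ z, inner ℝ (G z) (h (z i)) ∂(Measure.pi fun _ => ρ) =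
      ∫ a, inner ℝ (coordMean ρ i G a) (h a) ∂ρ := by
  have hi : Integrable (fun z => inner ℝ (G z) (h (z i))) (Measure.pi fun _ => ρ) := by
    refine integrable_of_bounded (C := C * C') (hG.inner (hh.comp_measurable
      (measurable_pi_apply i))) fun z => ?_
    exact (norm_inner_le_norm _ _).trans (mul_le_mul (hC z) (hC' _) (norm_nonneg _)
      ((norm_nonneg _).trans (hC z)))
  rw [integral_eq_integral_update hi i]
  refine integral_congr_ae (Eventually.of_forall fun a => ?_)
  simp only [coordMean, Function.update_self]
  simp only [real_inner_comm (h a)]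
  rw [integral_inner (integrable_update hG hC i a)]

/-- Conjugating with the transposition of i and j moves the frozen value from one place to the other
without changing G or the law. -/
theorem coordMean_eq_of_symm (hG : StronglyMeasurable G)
    (hsymm : ∀ (τ : Equiv.Perm (Fin s)) z, G (z ∘ τ) = G z) (i j : Fin s) :
    coordMean ρ i G = coordMean ρ j G := by
  ext a
  have h1 : ∀ z : Fin s → Z, G (Function.update z i a) =
      G (Function.update (z ∘ Equiv.swap j i) j a) := by
    intro z
    rw [← hsymm (Equiv.swap j i) (Function.update z i a)]
    congr 1
    ext k
    by_cases hk : k = j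
    · subst hk; simp
    · have : Equiv.swap j i k ≠ i := by
        exact fun h => hk ((Equiv.swap j i).injective (h.trans (Equiv.swap_apply_left j i).symm))
      simp [hk, this]
  have h2 := measurePreserving_comp_perm ρ (Equiv.swap j i)
  unfold coordMean
  simp only [h1]
  conv_rhs => rw [← h2.map_eq]
  rw [integral_map h2.aemeasurable]
  exact (hG.comp_measurable ((measurable_update_prod j).comp
    (measurable_const.prodMk measurable_id))).aestronglyMeasurable

/-- Bessel's inequality for the projections of a symmetric statistic on the observations. -/
theorem mul_integral_norm_coordMean_sub_sq_le (hG : StronglyMeasurable G) (hC : ∀ z, ‖G z‖ ≤ C)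
    (hsymm : ∀ (τ : Equiv.Perm (Fin s)) z, G (z ∘ τ) = G z) (i₀ : Fin s) (c : F) :
    s * ∫ a, ‖coordMean ρ i₀ G a - ∫ z, G z ∂(Measure.pi fun _ => ρ)‖ ^ 2 ∂ρ ≤
      ∫ z, ‖G z - c‖ ^ 2 ∂(Measure.pi fun _ => ρ) := by
  set π := Measure.pi fun _ : Fin s => ρ
  set m := ∫ z, G z ∂π
  set u : Z → F := fun a => coordMean ρ i₀ G a - m
  have hGi : Integrable G π := integrable_of_bounded hG hC
  have hu : StronglyMeasurable u :=
    (stronglyMeasurable_coordMean hG i₀).sub stronglyMeasurable_const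
  have hm : ‖m‖ ≤ C := by
    refine (norm_integral_le_of_norm_le_const (Eventually.of_forall hC)).trans ?_
    simp
  have huC : ∀ a, ‖u a‖ ≤ 2 * C := fun a => by
    refine (norm_sub_le _ _).trans ?_
    have := norm_coordMean_le (ρ := ρ) hC i₀ a
    linarith
  have hui : Integrable u ρ := integrable_of_bounded hu huC
  have hu0 : ∫ a, u a ∂ρ = 0 := by
    have h1 : Integrable (coordMean ρ i₀ G) ρ :=
      integrable_of_bounded (stronglyMeasurable_coordMean hG i₀) (norm_coordMean_le hC i₀)
    rw [integral_sub h1 (integrable_const _), ← integral_eq_integral_update hGi i₀]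
    simp [m, π]
  set v := ∫ a, ‖u a‖ ^ 2 ∂ρ
  have hinner : ∀ f g : Z → F, StronglyMeasurable f → StronglyMeasurable g → ∀ A B : ℝ,
      (∀ a, ‖f a‖ ≤ A) → (∀ a, ‖g a‖ ≤ B) → Integrable (fun a => inner ℝ (f a) (g a)) ρ := by
    intro f g hf hg A B hA hB
    refine integrable_of_bounded (C := A * B) (hf.inner hg) fun z => ?_
    exact (norm_inner_le_norm _ _).trans (mul_le_mul (hA z) (hB _) (norm_nonneg _)
      ((norm_nonneg _).trans (hA z)))
  have hcoord : ∀ i : Fin s, StronglyMeasurable fun z : Fin s → Z => u (z i) := fun i =>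
    hu.comp_measurable (measurable_pi_apply i)
  -- By symmetry all coordinates have the same projection. The constant c only shifts it by a vector
  -- against which the centred u integrates to zero.
  have h1 : ∀ i, ∫ z, inner ℝ (G z - c) (u (z i)) ∂π = v := by
    intro i
    have hGc : StronglyMeasurable fun z => G z - c := hG.sub stronglyMeasurable_const
    have hGcC : ∀ z, ‖G z - c‖ ≤ C + ‖c‖ := fun z => (norm_sub_le _ _).trans (by
      have := hC z; linarith)
    rw [integral_inner_coord hGc hGcC hu huC i]
    have h2 : ∀ a, coordMean ρ i (fun z => G z - c) a = u a + (m - c) := by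
      intro a
      have h3 : coordMean ρ i (fun z => G z - c) a = coordMean ρ i G a - c := by
        unfold coordMean
        rw [integral_sub (integrable_update hG hC i a) (integrable_const _)]
        simp
      rw [h3, coordMean_eq_of_symm hG hsymm i i₀]
      simp only [u]; abel
    simp only [h2, inner_add_left]
    rw [integral_add (hinner u u hu hu _ _ huC huC)
      (hinner (fun _ => m - c) u stronglyMeasurable_const hu _ _ (fun _ => le_rfl) huC),
      integral_inner hui, hu0, inner_zero_right, add_zero]
    simp only [real_inner_self_eq_norm_sq, v]
  -- Independence and centring make the copies of u orthogonal.
  have h2 : ∀ i j, ∫ z, inner ℝ (u (z j)) (u (z i)) ∂π = if j = i then v else 0 := by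
    intro i j
    rw [integral_inner_coord (hcoord j) (fun z => huC _) hu huC i]
    split_ifs with h
    · subst h
      refine integral_congr_ae (Eventually.of_forall fun a => ?_)
      simp [coordMean]
    · have : ∀ a, coordMean ρ i (fun z => u (z j)) a = 0 := by
        intro a
        simp only [coordMean, Function.update_of_ne h]
        have h3 := measurePreserving_eval (fun _ : Fin s => ρ) j
        rw [← hu0]
        have h4 := integral_map h3.aemeasurable (f := u)
          (by rw [h3.map_eq]; exact hu.aestronglyMeasurable)
        rw [h3.map_eq] at h4
        exact h4.symm
      simp [this]
  have hU : StronglyMeasurable fun z : Fin s → Z => ∑ i, u (z i) :=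
    Finset.stronglyMeasurable_fun_sum _ fun i _ => hcoord i
  have hUC : ∀ z : Fin s → Z, ‖∑ i, u (z i)‖ ≤ s * (2 * C) := fun z =>
    (norm_sum_le_of_le _ fun i _ => huC (z i)).trans (by simp)
  have hpair : ∀ f g : (Fin s → Z) → F, StronglyMeasurable f → StronglyMeasurable g → ∀ A B : ℝ,
      (∀ a, ‖f a‖ ≤ A) → (∀ a, ‖g a‖ ≤ B) → Integrable (fun a => inner ℝ (f a) (g a)) π := by
    intro f g hf hg A B hA hB
    refine integrable_of_bounded (C := A * B) (hf.inner hg) fun z => ?_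
    exact (norm_inner_le_norm _ _).trans (mul_le_mul (hA z) (hB _) (norm_nonneg _)
      ((norm_nonneg _).trans (hA z)))
  have hGc : StronglyMeasurable fun z => G z - c := hG.sub stronglyMeasurable_const
  have hGcC : ∀ z, ‖G z - c‖ ≤ C + ‖c‖ := fun z => (norm_sub_le _ _).trans (by
    have := hC z; linarith)
  have h3 : ∫ z, inner ℝ (G z - c) (∑ i, u (z i)) ∂π = s * v := by
    simp only [inner_sum]
    rw [integral_finsetSum _ fun i _ => hpair _ _ hGc (hcoord i) _ _ hGcC fun z => huC _]
    simp [h1]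
  have h4 : ∫ z, inner ℝ (∑ i, u (z i)) (∑ i, u (z i)) ∂π = s * v := by
    simp only [inner_sum, sum_inner]
    rw [integral_finsetSum _ fun i _ => integrable_finsetSum _ fun j _ =>
      hpair _ _ (hcoord j) (hcoord i) _ _ (fun z => huC _) fun z => huC _]
    have : ∀ i, ∫ z, ∑ j, inner ℝ (u (z j)) (u (z i)) ∂π = v := fun i => by
      rw [integral_finsetSum _ fun j _ =>
        hpair _ _ (hcoord j) (hcoord i) _ _ (fun z => huC _) fun z => huC _]
      simp [h2]
    simp [this]
  -- Expanding this nonnegative square gives the mean of ‖G - c‖² minus s v, which is the claim.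
  have h5 : 0 ≤ ∫ z, ‖(G z - c) - ∑ i, u (z i)‖ ^ 2 ∂π := integral_nonneg fun z => by positivity
  have h6 : ∫ z, ‖(G z - c) - ∑ i, u (z i)‖ ^ 2 ∂π =
      ∫ z, ‖G z - c‖ ^ 2 ∂π - 2 * (s * v) + s * v := by
    have e : ∀ z : Fin s → Z, ‖(G z - c) - ∑ i, u (z i)‖ ^ 2 = inner ℝ (G z - c) (G z - c) -
        2 * inner ℝ (G z - c) (∑ i, u (z i)) + inner ℝ (∑ i, u (z i)) (∑ i, u (z i)) := fun z => by
      rw [norm_sub_sq_real, real_inner_self_eq_norm_sq, real_inner_self_eq_norm_sq]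
    simp only [e]
    have i1 := hpair _ _ hGc hGc _ _ hGcC hGcC
    have i2 := (hpair _ _ hGc hU _ _ hGcC hUC).const_mul 2
    have i12 : Integrable (fun z => inner ℝ (G z - c) (G z - c) -
        2 * inner ℝ (G z - c) (∑ i, u (z i))) π := i1.sub i2
    rw [integral_add i12 (hpair _ _ hU hU _ _ hUC hUC), integral_sub i1 i2,
      integral_const_mul, h3, h4]
    simp only [real_inner_self_eq_norm_sq]
  linarith

end Projection

/-! ### Disintegration of outcomes given covariates and treatment -/

section Disintegration

variable {p d : ℕ}

/-- The law of the observed outcome given the covariates and the treatment status. -/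
noncomputable def outcomeKernel (Q : Bool → Kernel (Fin p → ℝ) (Fin d → ℝ)) :
    Kernel ((Fin p → ℝ) × Bool) (Fin d → ℝ) where
  toFun q := Q q.2 q.1
  measurable' := measurable_from_prod_countable_left fun w => (Q w).measurable

instance (Q : Bool → Kernel (Fin p → ℝ) (Fin d → ℝ)) [∀ w, IsMarkovKernel (Q w)] :
    IsMarkovKernel (outcomeKernel Q) :=
  ⟨fun q => inferInstanceAs (IsProbabilityMeasure (Q q.2 q.1))⟩

/-- `outcomeKernel Q` is the conditional law of the outcome. -/
def Disintegrates (ρ : Measure (Obs p d)) (Q : Bool → Kernel (Fin p → ℝ) (Fin d → ℝ)) : Prop :=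
  ρ.map (fun o => ((cov o, trt o), out o)) =
    (ρ.map fun o => (cov o, trt o)) ⊗ₘ outcomeKernel Q

variable {ρ : Measure (Obs p d)} [IsProbabilityMeasure ρ]
  {Q : Bool → Kernel (Fin p → ℝ) (Fin d → ℝ)} [∀ w, IsMarkovKernel (Q w)]
  {E : Type*} [NormedAddCommGroup E] [NormedSpace ℝ E]

theorem measurable_cov_trt : Measurable fun o : Obs p d => (cov o, trt o) :=
  measurable_cov.prodMk measurable_trt

theorem Disintegrates.integral_eq (h : Disintegrates ρ Q) {g : Obs p d → E}
    (hg : StronglyMeasurable g) {C : ℝ} (hC : ∀ o, ‖g o‖ ≤ C) :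
    ∫ o, g o ∂ρ = ∫ o, ∫ y, g (cov o, trt o, y) ∂(Q (trt o) (cov o)) ∂ρ := by
  have he : Measurable fun o : Obs p d => ((cov o, trt o), out o) :=
    measurable_cov_trt.prodMk measurable_out
  have hg' : StronglyMeasurable fun q : ((Fin p → ℝ) × Bool) × (Fin d → ℝ) =>
      g (q.1.1, q.1.2, q.2) := hg.comp_measurable
    ((measurable_fst.comp measurable_fst).prodMk ((measurable_snd.comp measurable_fst).prodMk
      measurable_snd))
  have : IsProbabilityMeasure (ρ.map fun o : Obs p d => (cov o, trt o)) :=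
    Measure.isProbabilityMeasure_map measurable_cov_trt.aemeasurable
  calc ∫ o, g o ∂ρ = ∫ q, g (q.1.1, q.1.2, q.2)
        ∂(ρ.map fun o : Obs p d => ((cov o, trt o), out o)) := by
        rw [integral_map he.aemeasurable hg'.aestronglyMeasurable]; rfl
    _ = ∫ q, ∫ y, g (q.1, q.2, y) ∂(outcomeKernel Q q) ∂(ρ.map fun o => (cov o, trt o)) := by
        rw [h, Measure.integral_compProd (integrable_of_bounded hg' fun _ => hC _)]
    _ = _ := by
        rw [integral_map measurable_cov_trt.aemeasurable]
        · rfl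
        · exact (hg'.integral_kernel_prod_right' (κ := outcomeKernel Q)).aestronglyMeasurable

/-- The conditional mean of `ξ` of the outcome of an observation, given covariates and treatment. -/
noncomputable def condMean (Q : Bool → Kernel (Fin p → ℝ) (Fin d → ℝ)) (ξ : (Fin d → ℝ) → E)
    (o : Obs p d) : E := ∫ y, ξ y ∂(Q (trt o) (cov o))

theorem stronglyMeasurable_condMean {ξ : (Fin d → ℝ) → E} (hξ : StronglyMeasurable ξ) :
    StronglyMeasurable (condMean Q ξ) := by
  have h := StronglyMeasurable.integral_kernel_prod_right' (κ := outcomeKernel Q)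
    (hξ.comp_measurable (measurable_snd (α := (Fin p → ℝ) × Bool)))
  exact h.comp_measurable measurable_cov_trt

theorem norm_condMean_le {ξ : (Fin d → ℝ) → E} {C : ℝ} (hC : ∀ y, ‖ξ y‖ ≤ C) (o : Obs p d) :
    ‖condMean Q ξ o‖ ≤ C := by
  refine (norm_integral_le_of_norm_le_const (Eventually.of_forall hC)).trans ?_
  simp

/-- A function of covariates and treatment times the residual of `ξ` has mean zero. -/
theorem Disintegrates.integral_smul_sub_condMean (h : Disintegrates ρ Q) [CompleteSpace E]
    {ξ : (Fin d → ℝ) → E} (hξ : StronglyMeasurable ξ) {C : ℝ} (hC : ∀ y, ‖ξ y‖ ≤ C)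
    {g : Obs p d → ℝ} (hg : StronglyMeasurable g) {C' : ℝ} (hC' : ∀ o, ‖g o‖ ≤ C')
    (hdep : ∀ o o', cov o = cov o' → trt o = trt o' → g o = g o') :
    ∫ o, g o • (ξ (out o) - condMean Q ξ o) ∂ρ = 0 := by
  have hr : StronglyMeasurable fun o : Obs p d => ξ (out o) - condMean Q ξ o :=
    (hξ.comp_measurable measurable_out).sub (stronglyMeasurable_condMean hξ)
  have hb : ∀ o : Obs p d, ‖ξ (out o) - condMean Q ξ o‖ ≤ 2 * C := fun o =>
    (norm_sub_le _ _).trans (by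
      have := hC (out o); have := norm_condMean_le (Q := Q) hC o; linarith)
  rw [h.integral_eq (g := fun o => g o • (ξ (out o) - condMean Q ξ o)) (hg.smul hr)
    (C := C' * (2 * C)) fun o => by
    rw [norm_smul]
    exact mul_le_mul (hC' o) (hb o) (norm_nonneg _) ((norm_nonneg _).trans (hC' o))]
  refine integral_eq_zero_of_ae (Eventually.of_forall fun o => ?_)
  have h1 : ∀ y, g (cov o, trt o, y) • (ξ (out (cov o, trt o, y)) -
      condMean Q ξ (cov o, trt o, y)) = g o • (ξ y - condMean Q ξ o) := fun y => by
    rw [hdep (cov o, trt o, y) o rfl rfl]; rfl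
  simp only [h1, Pi.zero_apply]
  rw [integral_smul, integral_sub (integrable_of_bounded hξ hC) (integrable_const _)]
  simp [condMean]

end Disintegration

/-! ### The weighted sum and the mean weight given one observation -/

namespace TreeProcedure

set_option linter.unusedSectionVars false

variable {p d s : ℕ} {𝓔 : Type*} [MeasurableSpace 𝓔] (P : TreeProcedure p d s 𝓔)
  (ν : Measure 𝓔) [IsProbabilityMeasure ν] (x : Fin p → ℝ)
  {F : Type*} [NormedAddCommGroup F] [InnerProductSpace ℝ F] [CompleteSpace F]
  {ρ : Measure (Obs p d)} [IsProbabilityMeasure ρ]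
  {Q : Bool → Kernel (Fin p → ℝ) (Fin d → ℝ)} [∀ w, IsMarkovKernel (Q w)]

/-- The weighted sum of `h` over the observations, with the averaged weights. -/
noncomputable def weightedSum (h : Obs p d → F) (z : Fin s → Obs p d) : F :=
  ∑ i, P.meanWeight ν x z i • h (z i)

variable {P ν x} {h : Obs p d → F} {C : ℝ}

theorem stronglyMeasurable_weightedSum (hh : StronglyMeasurable h) :
    StronglyMeasurable (P.weightedSum ν x h) :=
  Finset.stronglyMeasurable_fun_sum _ fun i _ =>
    (P.measurable_meanWeight ν x i).stronglyMeasurable.smul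
      (hh.comp_measurable (measurable_pi_apply i))

theorem norm_weightedSum_le (hC : ∀ o, ‖h o‖ ≤ C) (z : Fin s → Obs p d) (hC0 : 0 ≤ C) :
    ‖P.weightedSum ν x h z‖ ≤ 2 * C := by
  calc ‖P.weightedSum ν x h z‖ ≤ ∑ i, |P.meanWeight ν x z i| * C :=
        norm_sum_le_of_le _ fun i _ => by
          rw [norm_smul, Real.norm_eq_abs]
          exact mul_le_mul_of_nonneg_left (hC _) (abs_nonneg _)
    _ ≤ 2 * C := by
        rw [← Finset.sum_mul]
        exact mul_le_mul_of_nonneg_right (P.sum_abs_meanWeight_le_two z) hC0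

theorem weightedSum_symm (hP : P.IsSymmetric ν x) (τ : Equiv.Perm (Fin s))
    (z : Fin s → Obs p d) : P.weightedSum ν x h (z ∘ τ) = P.weightedSum ν x h z := by
  unfold weightedSum
  simp only [P.meanWeight_symm ν x hP τ z, Function.comp]
  exact Equiv.sum_comp τ fun i => P.meanWeight ν x z i • h (z i)

/-- The mean weight of an observation, given the observation. -/
noncomputable def condWeight (P : TreeProcedure p d s 𝓔) (ν : Measure 𝓔) (x : Fin p → ℝ)
    (ρ : Measure (Obs p d)) (i : Fin s) (o : Obs p d) : ℝ :=
  ∫ z, P.meanWeight ν x (Function.update z i o) i ∂(Measure.pi fun _ => ρ)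

theorem stronglyMeasurable_condWeight (i : Fin s) :
    StronglyMeasurable (P.condWeight ν x ρ i) :=
  ((P.measurable_meanWeight ν x i).stronglyMeasurable.comp_measurable
    (measurable_update_prod i)).integral_prod_right'

theorem condWeight_congr (hP : P.IsHonest) (i : Fin s) {o o' : Obs p d} (h1 : cov o = cov o')
    (h2 : trt o = trt o') : P.condWeight ν x ρ i o = P.condWeight ν x ρ i o' := by
  unfold condWeight
  simp only [P.meanWeight_update_out ν x hP _ i h1 h2]

theorem abs_condWeight_le (i : Fin s) (o : Obs p d) :
    |P.condWeight ν x ρ i o| ≤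
      ∫ z, |P.meanWeight ν x (Function.update z i o) i| ∂(Measure.pi fun _ => ρ) :=
  abs_integral_le_integral_abs

theorem abs_condWeight_le_one (i : Fin s) (o : Obs p d) : |P.condWeight ν x ρ i o| ≤ 1 := by
  rw [← Real.norm_eq_abs, condWeight]
  refine (norm_integral_le_of_norm_le_const (C := 1) (Eventually.of_forall fun z =>
    P.abs_meanWeight_le ν x _ i)).trans ?_
  simp

/-- The projection of the weighted sum of residuals. -/
theorem coordMean_weightedSum_residual (hP : P.IsHonest) (hρ : Disintegrates ρ Q)
    {ξ : (Fin d → ℝ) → F} (hξ : StronglyMeasurable ξ) (hC : ∀ y, ‖ξ y‖ ≤ C)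
    (i₀ : Fin s) (o : Obs p d) :
    coordMean ρ i₀ (P.weightedSum ν x fun o => ξ (out o) - condMean Q ξ o) o =
      P.condWeight ν x ρ i₀ o • (ξ (out o) - condMean Q ξ o) := by
  set h : Obs p d → F := fun o => ξ (out o) - condMean Q ξ o
  have hh : StronglyMeasurable h :=
    (hξ.comp_measurable measurable_out).sub (stronglyMeasurable_condMean hξ)
  have hb : ∀ o : Obs p d, ‖h o‖ ≤ 2 * C := fun o => (norm_sub_le _ _).trans (by
    have := hC (out o); have := norm_condMean_le (Q := Q) hC o; linarith)
  have hupd : ∀ i : Fin s, Measurable fun z : Fin s → Obs p d => Function.update z i₀ o := fun i =>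
    (measurable_update_prod i₀).comp (measurable_const.prodMk measurable_id)
  have hterm : ∀ i, StronglyMeasurable fun z : Fin s → Obs p d =>
      P.meanWeight ν x (Function.update z i₀ o) i • h (Function.update z i₀ o i) := fun i =>
    ((P.measurable_meanWeight ν x i).stronglyMeasurable.smul
      (hh.comp_measurable (measurable_pi_apply i))).comp_measurable (hupd i)
  have htermb : ∀ (i : Fin s) (z : Fin s → Obs p d), ‖P.meanWeight ν x z i • h (z i)‖ ≤
      1 * (2 * C) := fun i z => by
    rw [norm_smul]
    exact mul_le_mul (P.abs_meanWeight_le ν x z i) (hb _) (norm_nonneg _) zero_le_one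
  have hti : ∀ i, Integrable (fun z : Fin s → Obs p d =>
      P.meanWeight ν x (Function.update z i₀ o) i • h (Function.update z i₀ o i))
      (Measure.pi fun _ => ρ) := fun i => integrable_of_bounded (hterm i) fun z => htermb i _
  unfold coordMean weightedSum
  rw [integral_finsetSum _ fun i _ => hti i, Finset.sum_eq_single i₀]
  · simp only [Function.update_self, condWeight]
    rw [integral_smul_const]
  -- For i ≠ i₀, integrate coordinate i separately. With the other coordinates averaged out, its
  -- weight is a function of covariates and treatment alone by honesty, and the residual integrates
  -- to zero against such a function.
  · intro i _ hi
    rw [integral_eq_integral_update (hti i) i]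
    unfold coordMean
    have h1 : ∀ (b : Obs p d) (z : Fin s → Obs p d),
        P.meanWeight ν x (Function.update (Function.update z i b) i₀ o) i •
          h (Function.update (Function.update z i b) i₀ o i) =
        P.meanWeight ν x (Function.update (Function.update z i₀ o) i b) i • h b := fun b z => by
      rw [Function.update_comm hi, Function.update_self]
    simp only [h1, integral_smul_const]
    refine hρ.integral_smul_sub_condMean hξ hC (C' := 1) ?_ ?_ ?_
    · have h2 : Measurable fun q : Obs p d × (Fin s → Obs p d) =>
          Function.update (Function.update q.2 i₀ o) i q.1 :=
        (measurable_update_prod i).comp (measurable_fst.prodMk ((hupd i).comp measurable_snd))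
      exact ((P.measurable_meanWeight ν x i).stronglyMeasurable.comp_measurable
        h2).integral_prod_right'
    · intro b
      refine (norm_integral_le_of_norm_le_const (Eventually.of_forall fun z =>
        P.abs_meanWeight_le ν x _ i)).trans ?_
      simp
    · intro b b' hb1 hb2
      simp only [P.meanWeight_update_out ν x hP _ i hb1 hb2]
  · simp

/-- Averages over one observation are averages over the whole sample, by symmetry. -/
theorem mul_integral_abs_meanWeight (hP : P.IsSymmetric ν x) {g : Obs p d → ℝ} (hg : Measurable g)
    (hC : ∀ᵐ o ∂ρ, |g o| ≤ C) (i₀ : Fin s) :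
    s * ∫ z, |P.meanWeight ν x z i₀| * g (z i₀) ∂(Measure.pi fun _ => ρ) =
      ∫ z, ∑ i, |P.meanWeight ν x z i| * g (z i) ∂(Measure.pi fun _ => ρ) := by
  have hm : ∀ i, Measurable fun z : Fin s → Obs p d => |P.meanWeight ν x z i| * g (z i) := fun i =>
    (P.measurable_meanWeight ν x i).abs.mul (hg.comp (measurable_pi_apply i))
  have hi : ∀ i, Integrable (fun z => |P.meanWeight ν x z i| * g (z i))
      (Measure.pi fun _ => ρ) := fun i => by
    refine Integrable.of_bound (hm i).aestronglyMeasurable (1 * C) ?_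
    have h1 := (measurePreserving_eval (fun _ : Fin s => ρ) i).quasiMeasurePreserving.ae hC
    filter_upwards [h1] with z hz
    rw [norm_mul, Real.norm_eq_abs, Real.norm_eq_abs, abs_abs]
    exact mul_le_mul (P.abs_meanWeight_le ν x z i) hz (abs_nonneg _) zero_le_one
  rw [integral_finsetSum _ fun i _ => hi i]
  have : ∀ i, ∫ z, |P.meanWeight ν x z i| * g (z i) ∂(Measure.pi fun _ => ρ) =
      ∫ z, |P.meanWeight ν x z i₀| * g (z i₀) ∂(Measure.pi fun _ => ρ) := by
    intro i
    have h2 := measurePreserving_comp_perm ρ (Equiv.swap i₀ i)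
    conv_rhs => rw [← h2.map_eq]
    rw [integral_map h2.aemeasurable (hm i₀).aestronglyMeasurable]
    simp only [P.meanWeight_symm ν x hP, Function.comp, Equiv.swap_apply_left]
  simp [this]

/-- Jensen's inequality for the average over the remaining observations. -/
theorem integral_abs_condWeight_mul_le {g : Obs p d → ℝ} (hg : Measurable g) (hg0 : ∀ o, 0 ≤ g o)
    (hC : ∀ᵐ o ∂ρ, |g o| ≤ C) (i : Fin s) :
    ∫ o, |P.condWeight ν x ρ i o| * g o ∂ρ ≤
      ∫ z, |P.meanWeight ν x z i| * g (z i) ∂(Measure.pi fun _ => ρ) := by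
  have hm : Measurable fun z : Fin s → Obs p d => |P.meanWeight ν x z i| * g (z i) :=
    (P.measurable_meanWeight ν x i).abs.mul (hg.comp (measurable_pi_apply i))
  have hi : Integrable (fun z => |P.meanWeight ν x z i| * g (z i))
      (Measure.pi fun _ => ρ) := by
    refine Integrable.of_bound hm.aestronglyMeasurable (1 * C) ?_
    have h1 := (measurePreserving_eval (fun _ : Fin s => ρ) i).quasiMeasurePreserving.ae hC
    filter_upwards [h1] with z hz
    rw [norm_mul, Real.norm_eq_abs, Real.norm_eq_abs, abs_abs]
    exact mul_le_mul (P.abs_meanWeight_le ν x z i) hz (abs_nonneg _) zero_le_one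
  rw [integral_eq_integral_update hi i]
  have hcm : Integrable (coordMean ρ i fun z => |P.meanWeight ν x z i| * g (z i)) ρ :=
    ((measurePreserving_update ρ i).integrable_comp_of_integrable hi).integral_prod_left
  refine integral_mono_of_nonneg (Eventually.of_forall fun o => mul_nonneg (abs_nonneg _) (hg0 o))
    hcm (Eventually.of_forall fun o => ?_)
  simp only [coordMean, Function.update_self]
  rw [integral_mul_const]
  exact mul_le_mul_of_nonneg_right (abs_condWeight_le i o) (hg0 o)

end TreeProcedure

/-! ### Conditional variance of the outcome -/

section OutcomeVar

set_option linter.unusedSectionVars false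

variable {p d : ℕ} {F : Type*} [NormedAddCommGroup F] [InnerProductSpace ℝ F] [CompleteSpace F]

/-- The variance of `ξ` of the outcome in the group `w`, given the covariates. -/
noncomputable def outcomeVar (Q : Bool → Kernel (Fin p → ℝ) (Fin d → ℝ)) (ξ : (Fin d → ℝ) → F)
    (w : Bool) (t : Fin p → ℝ) : ℝ := ∫ y, ‖ξ y - ∫ y', ξ y' ∂(Q w t)‖ ^ 2 ∂(Q w t)

variable {Q : Bool → Kernel (Fin p → ℝ) (Fin d → ℝ)} [∀ w, IsMarkovKernel (Q w)]
  {ξ : (Fin d → ℝ) → F} {C : ℝ}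

theorem outcomeVar_nonneg (w : Bool) (t : Fin p → ℝ) : 0 ≤ outcomeVar Q ξ w t :=
  integral_nonneg fun _ => by positivity

theorem outcomeVar_eq (hξ : StronglyMeasurable ξ) (hC : ∀ y, ‖ξ y‖ ≤ C) (w : Bool)
    (t : Fin p → ℝ) :
    outcomeVar Q ξ w t = ∫ y, ‖ξ y‖ ^ 2 ∂(Q w t) - ‖∫ y, ξ y ∂(Q w t)‖ ^ 2 := by
  set M := ∫ y, ξ y ∂(Q w t)
  have hi : Integrable ξ (Q w t) := integrable_of_bounded hξ hC
  have h2 : Integrable (fun y => ‖ξ y‖ ^ 2) (Q w t) := by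
    refine integrable_of_bounded (C := C ^ 2) (hξ.norm.pow 2) fun y => ?_
    rw [norm_pow, norm_norm]
    exact pow_le_pow_left₀ (norm_nonneg _) (hC y) 2
  have h3 : Integrable (fun y => inner ℝ M (ξ y)) (Q w t) := hi.const_inner M
  have e : ∀ y, ‖ξ y - M‖ ^ 2 = ‖ξ y‖ ^ 2 - 2 * inner ℝ M (ξ y) + ‖M‖ ^ 2 := fun y => by
    rw [norm_sub_sq_real, real_inner_comm]
  have h4 : Integrable (fun y => ‖ξ y‖ ^ 2 - 2 * inner ℝ M (ξ y)) (Q w t) :=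
    h2.sub (h3.const_mul 2)
  unfold outcomeVar
  change ∫ y, ‖ξ y - M‖ ^ 2 ∂(Q w t) = _
  simp only [e]
  rw [integral_add h4 (integrable_const _), integral_sub h2 (h3.const_mul 2), integral_const_mul,
    integral_inner hi]
  simp only [integral_const, probReal_univ, one_smul]
  change _ - 2 * inner ℝ M M + _ = _
  rw [real_inner_self_eq_norm_sq]
  ring

theorem outcomeVar_le (hC : ∀ y, ‖ξ y‖ ≤ C) (w : Bool)
    (t : Fin p → ℝ) : outcomeVar Q ξ w t ≤ 4 * C ^ 2 := by
  have h : ∀ y, ‖ξ y - ∫ y', ξ y' ∂(Q w t)‖ ^ 2 ≤ 4 * C ^ 2 := fun y => by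
    have h1 := norm_condMean_le (Q := Q) (E := F) hC ((t, w, y) : Obs p d)
    have h2 : ‖ξ y - ∫ y', ξ y' ∂(Q w t)‖ ≤ 2 * C := (norm_sub_le _ _).trans (by
      have := hC y; change ‖∫ y', ξ y' ∂(Q w t)‖ ≤ C at h1; linarith)
    calc _ ≤ (2 * C) ^ 2 := pow_le_pow_left₀ (norm_nonneg _) h2 2
      _ = _ := by ring
  calc outcomeVar Q ξ w t ≤ ∫ _, 4 * C ^ 2 ∂(Q w t) :=
        integral_mono_of_nonneg (Eventually.of_forall fun _ => by positivity) (integrable_const _)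
          (Eventually.of_forall h)
    _ = _ := by simp

/-- The variance is the second moment minus the squared norm of the mean; the latter is Lipschitz
because the mean is Lipschitz and bounded by C. -/
theorem abs_outcomeVar_sub_le (hξ : StronglyMeasurable ξ) (hC : ∀ y, ‖ξ y‖ ≤ C) {L : ℝ} {w : Bool}
    {t x : Fin p → ℝ}
    (h1 : ‖∫ y, ξ y ∂(Q w t) - ∫ y, ξ y ∂(Q w x)‖ ≤ L * ‖t - x‖)
    (h2 : |∫ y, ‖ξ y‖ ^ 2 ∂(Q w t) - ∫ y, ‖ξ y‖ ^ 2 ∂(Q w x)| ≤ L * ‖t - x‖) :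
    |outcomeVar Q ξ w t - outcomeVar Q ξ w x| ≤ (L + 2 * C * L) * ‖t - x‖ := by
  rw [outcomeVar_eq hξ hC, outcomeVar_eq hξ hC]
  have hb : ∀ t, ‖∫ y, ξ y ∂(Q w t)‖ ≤ C := fun t => by
    refine (norm_integral_le_of_norm_le_const (Eventually.of_forall hC)).trans ?_
    simp
  set M := ∫ y, ξ y ∂(Q w t)
  set M' := ∫ y, ξ y ∂(Q w x)
  have h3 : |‖M‖ ^ 2 - ‖M'‖ ^ 2| ≤ 2 * C * (L * ‖t - x‖) := by
    have e : ‖M‖ ^ 2 - ‖M'‖ ^ 2 = (‖M‖ + ‖M'‖) * (‖M‖ - ‖M'‖) := by ring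
    rw [e, abs_mul, abs_of_nonneg (by positivity)]
    refine mul_le_mul ?_ ((abs_norm_sub_norm_le _ _).trans h1) (abs_nonneg _) ?_
    · have := hb t; have := hb x; linarith
    · have := (norm_nonneg _).trans (hb t); linarith
  rw [abs_le] at h2 h3 ⊢
  constructor <;> linarith [h2.1, h2.2, h3.1, h3.2]

end OutcomeVar

/-! ### Moments of the mean weight; the conditional mean part -/

namespace TreeProcedure

set_option linter.unusedSectionVars false

variable {p d s : ℕ} {𝓔 : Type*} [MeasurableSpace 𝓔] {P : TreeProcedure p d s 𝓔}
  {ν : Measure 𝓔} [IsProbabilityMeasure ν] {x : Fin p → ℝ}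
  {F : Type*} [NormedAddCommGroup F] [InnerProductSpace ℝ F] [CompleteSpace F]
  {ρ : Measure (Obs p d)} [IsProbabilityMeasure ρ]
  {Q : Bool → Kernel (Fin p → ℝ) (Fin d → ℝ)} [∀ w, IsMarkovKernel (Q w)]
  {ξ : (Fin d → ℝ) → F} {C L : ℝ}

/-- The part of the population in the treatment group `w`. -/
def groupSet (w : Bool) : Set (Obs p d) := {o | trt o = w}

theorem measurableSet_groupSet (w : Bool) : MeasurableSet (groupSet (p := p) (d := d) w) :=
  measurable_trt (measurableSet_singleton w)

/-- The mass of the treatment group `w` times the variance of the conditional mean weight within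
the group. -/
noncomputable def weightVar (P : TreeProcedure p d s 𝓔) (ν : Measure 𝓔) (x : Fin p → ℝ)
    (ρ : Measure (Obs p d)) (i : Fin s) (w : Bool) : ℝ :=
  ∫ o in groupSet w, P.condWeight ν x ρ i o ^ 2 ∂ρ -
    (∫ o in groupSet w, P.condWeight ν x ρ i o ∂ρ) ^ 2 / ρ.real (groupSet w)

theorem mul_setIntegral_abs_meanWeight_le (hP : P.IsSymmetric ν x) (i : Fin s) (w : Bool) :
    s * ∫ z, |P.meanWeight ν x z i| * (groupSet w).indicator 1 (z i) ∂(Measure.pi fun _ => ρ) =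
      ∫ z, ∑ i, (if trt (z i) = w then |P.meanWeight ν x z i| else 0)
        ∂(Measure.pi fun _ => ρ) := by
  rw [mul_integral_abs_meanWeight hP (C := 1)
    (measurable_one.indicator (measurableSet_groupSet w))]
  · refine integral_congr_ae (Eventually.of_forall fun z => Finset.sum_congr rfl fun i _ => ?_)
    by_cases h : trt (z i) = w
    · have h' : z i ∈ groupSet w := h
      simp [h, h']
    · have h' : z i ∉ groupSet w := h
      simp [h, h']
  · exact Eventually.of_forall fun o => by
      by_cases h : o ∈ groupSet w <;> simp [h]

theorem measurable_sum_group (w : Bool) : Measurable fun z : Fin s → Obs p d =>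
    ∑ i, (if trt (z i) = w then |P.meanWeight ν x z i| else 0) := by
  refine Finset.measurable_sum _ fun i _ => ?_
  exact Measurable.ite ((measurable_trt.comp (measurable_pi_apply i)) (measurableSet_singleton w))
    (P.measurable_meanWeight ν x i).abs measurable_const

/-- The group's total weight is at most 1, and exchangeability gives each of the s observations an
equal share of its expectation. -/
theorem integral_abs_meanWeight_group_le (hs : 0 < s) (hP : P.IsSymmetric ν x) (i : Fin s)
    (w : Bool) :
    ∫ z, |P.meanWeight ν x z i| * (groupSet w).indicator 1 (z i) ∂(Measure.pi fun _ => ρ) ≤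
      1 / s := by
  have hs' : (0 : ℝ) < s := Nat.cast_pos.2 hs
  rw [le_div_iff₀ hs', mul_comm, mul_setIntegral_abs_meanWeight_le hP]
  calc _ ≤ ∫ _, (1 : ℝ) ∂(Measure.pi fun _ : Fin s => ρ) :=
        integral_mono_of_nonneg (Eventually.of_forall fun z => Finset.sum_nonneg fun i _ => by
          positivity) (integrable_const _)
          (Eventually.of_forall fun z => P.sum_abs_meanWeight_group_le ν x z w)
    _ = 1 := by simp

theorem setIntegral_abs_condWeight_le (hs : 0 < s) (hP : P.IsSymmetric ν x) (i : Fin s)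
    (w : Bool) : ∫ o in groupSet w, |P.condWeight ν x ρ i o| ∂ρ ≤ 1 / s := by
  refine le_trans (le_trans (le_of_eq ?_) (integral_abs_condWeight_mul_le (C := 1) (ρ := ρ)
    (g := (groupSet w).indicator 1) (measurable_one.indicator (measurableSet_groupSet w)) ?_ ?_ i))
    (integral_abs_meanWeight_group_le hs hP i w)
  · rw [← integral_indicator (measurableSet_groupSet w)]
    refine integral_congr_ae (Eventually.of_forall fun o => ?_)
    by_cases h : o ∈ groupSet w <;> simp [h]
  · exact fun o => Set.indicator_nonneg (fun _ _ => zero_le_one) _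
  · exact Eventually.of_forall fun o => by
      by_cases h : o ∈ groupSet w <;> simp [h]

theorem integrable_condWeight (i : Fin s) : Integrable (P.condWeight ν x ρ i) ρ :=
  integrable_of_bounded (stronglyMeasurable_condWeight i) (abs_condWeight_le_one i)

theorem condWeight_sq_le (i : Fin s) (o : Obs p d) :
    P.condWeight ν x ρ i o ^ 2 ≤ |P.condWeight ν x ρ i o| := by
  rw [← sq_abs, sq]
  exact mul_le_of_le_one_right (abs_nonneg _) (abs_condWeight_le_one i o)

theorem integrable_condWeight_sq (i : Fin s) :
    Integrable (fun o => P.condWeight ν x ρ i o ^ 2) ρ :=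
  integrable_of_bounded (C := 1) ((stronglyMeasurable_condWeight i).pow 2) fun o => by
    rw [Real.norm_eq_abs, abs_of_nonneg (sq_nonneg _)]
    exact (condWeight_sq_le i o).trans (abs_condWeight_le_one i o)

theorem integral_eq_add_groups {f : Obs p d → ℝ} (hf : Integrable f ρ) :
    ∫ o, f o ∂ρ = ∫ o in groupSet true, f o ∂ρ + ∫ o in groupSet false, f o ∂ρ := by
  rw [← integral_add_compl (measurableSet_groupSet true) hf]
  have : (groupSet (p := p) (d := d) true)ᶜ = groupSet false := by ext o; simp [groupSet]
  rw [this]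

theorem integral_condWeight_sq_le (hs : 0 < s) (hP : P.IsSymmetric ν x) (i : Fin s) :
    ∫ o, P.condWeight ν x ρ i o ^ 2 ∂ρ ≤ 2 / s := by
  calc ∫ o, P.condWeight ν x ρ i o ^ 2 ∂ρ ≤ ∫ o, |P.condWeight ν x ρ i o| ∂ρ :=
        integral_mono (integrable_condWeight_sq i) (integrable_condWeight i).abs
          (condWeight_sq_le i)
    _ ≤ 1 / s + 1 / s := by
        rw [integral_eq_add_groups (integrable_condWeight i).abs]
        exact add_le_add (setIntegral_abs_condWeight_le hs hP i true)
          (setIntegral_abs_condWeight_le hs hP i false)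
    _ = 2 / s := by ring

/-- Since |ψ| ≤ 1, the square may be replaced by |ψ|; symmetry then distributes the expected spread
evenly over the observations. -/
theorem integral_condWeight_sq_mul_norm_le (hs : 0 < s) (hP : P.IsSymmetric ν x)
    (hx : x ∈ Set.Icc (0 : Fin p → ℝ) 1)
    (hcube : ∀ᵐ o ∂ρ, cov o ∈ Set.Icc (0 : Fin p → ℝ) 1) (i : Fin s) :
    ∫ o, P.condWeight ν x ρ i o ^ 2 * ‖cov o - x‖ ∂ρ ≤
      (∫ z, P.spread ν x z ∂(Measure.pi fun _ => ρ)) / s := by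
  have hs' : (0 : ℝ) < s := Nat.cast_pos.2 hs
  have hg : Measurable fun o : Obs p d => ‖cov o - x‖ := (measurable_cov.sub_const x).norm
  have hC : ∀ᵐ o ∂ρ, |‖cov o - x‖| ≤ 1 := by
    filter_upwards [hcube] with o ho
    rw [abs_norm]
    exact norm_sub_le_one hx ho
  rw [le_div_iff₀ hs', mul_comm]
  unfold spread
  rw [← mul_integral_abs_meanWeight hP hg hC i]
  refine mul_le_mul_of_nonneg_left ?_ hs'.le
  refine le_trans ?_ (integral_abs_condWeight_mul_le hg (fun _ => norm_nonneg _) hC i)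
  refine integral_mono_of_nonneg (Eventually.of_forall fun o => by positivity) ?_
    (Eventually.of_forall fun o =>
      mul_le_mul_of_nonneg_right (condWeight_sq_le i o) (norm_nonneg _))
  refine Integrable.of_bound ((stronglyMeasurable_condWeight i).measurable.abs.mul
    hg).aestronglyMeasurable (1 * 1) ?_
  filter_upwards [hC] with o ho
  rw [norm_mul, Real.norm_eq_abs, Real.norm_eq_abs, abs_abs]
  exact mul_le_mul (abs_condWeight_le_one i o) ho (abs_nonneg _) zero_le_one

theorem ae_pi_cube (hcube : ∀ᵐ o ∂ρ, cov o ∈ Set.Icc (0 : Fin p → ℝ) 1) :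
    ∀ᵐ z ∂(Measure.pi fun _ : Fin s => ρ), ∀ i, cov (z i) ∈ Set.Icc (0 : Fin p → ℝ) 1 :=
  ae_all_iff.2 fun i =>
    (measurePreserving_eval (fun _ : Fin s => ρ) i).quasiMeasurePreserving.ae hcube

/-- The weighted sum of conditional means is close to the difference of the conditional means at
`x`. -/
theorem norm_weightedSum_condMean_sub_le (hC : ∀ y, ‖ξ y‖ ≤ C)
    (hL : ∀ w, ∀ t ∈ Set.Icc (0 : Fin p → ℝ) 1,
      ‖∫ y, ξ y ∂(Q w t) - ∫ y, ξ y ∂(Q w x)‖ ≤ L * ‖t - x‖)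
    {z : Fin s → Obs p d} (hz : ∀ i, cov (z i) ∈ Set.Icc (0 : Fin p → ℝ) 1) :
    ‖P.weightedSum ν x (condMean Q ξ) z -
        (∫ y, ξ y ∂(Q true x) - ∫ y, ξ y ∂(Q false x))‖ ≤
      L * P.spread ν x z + C * P.defect ν x z := by
  set M : Bool → F := fun w => ∫ y, ξ y ∂(Q w x)
  have hM : ∀ w, ‖M w‖ ≤ C := fun w => by
    refine (norm_integral_le_of_norm_le_const (Eventually.of_forall hC)).trans ?_
    simp
  set t : Bool → ℝ := fun w => ∑ i, if trt (z i) = w then |P.meanWeight ν x z i| else 0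
  -- Treated weights are nonnegative and control weights nonpositive, so freezing the means at x
  -- leaves a difference weighted by the group masses t.
  have hsum : ∑ i, P.meanWeight ν x z i • M (trt (z i)) = t true • M true - t false • M false := by
    have h1 : ∀ i, P.meanWeight ν x z i • M (trt (z i)) =
        (if trt (z i) = true then |P.meanWeight ν x z i| else 0) • M true -
        (if trt (z i) = false then |P.meanWeight ν x z i| else 0) • M false := by
      intro i
      have h2 := P.abs_meanWeight_eq ν x z i
      cases h : trt (z i) <;> rw [h] at h2 <;> simp [h2, groupSign]
    rw [Finset.sum_congr rfl fun i _ => h1 i, Finset.sum_sub_distrib, ← Finset.sum_smul,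
      ← Finset.sum_smul]
  -- Two errors remain: the means are taken at X_i instead of x, bounded by the spread, and the
  -- group masses fall short of 1, bounded by the defect.
  have hsplit : P.weightedSum ν x (condMean Q ξ) z - (M true - M false) =
      ∑ i, P.meanWeight ν x z i • (condMean Q ξ (z i) - M (trt (z i))) -
        ((1 - t true) • M true - (1 - t false) • M false) := by
    simp only [smul_sub, Finset.sum_sub_distrib, hsum, weightedSum, sub_smul, one_smul]
    abel
  change ‖P.weightedSum ν x (condMean Q ξ) z - (M true - M false)‖ ≤ _
  rw [hsplit]
  have ht : ∀ w, 0 ≤ 1 - t w := fun w => sub_nonneg.2 (P.sum_abs_meanWeight_group_le ν x z w)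
  have h3 : ‖∑ i, P.meanWeight ν x z i • (condMean Q ξ (z i) - M (trt (z i)))‖ ≤
      L * P.spread ν x z := by
    unfold spread
    rw [Finset.mul_sum]
    refine norm_sum_le_of_le _ fun i _ => ?_
    rw [norm_smul, Real.norm_eq_abs, mul_left_comm]
    exact mul_le_mul_of_nonneg_left (hL _ _ (hz i)) (abs_nonneg _)
  have h4 : ‖(1 - t true) • M true - (1 - t false) • M false‖ ≤ C * P.defect ν x z := by
    refine (norm_sub_le _ _).trans ?_
    rw [norm_smul, norm_smul, Real.norm_of_nonneg (ht _), Real.norm_of_nonneg (ht _), defect,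
      Fintype.sum_bool, mul_add, mul_comm C, mul_comm C]
    exact add_le_add (mul_le_mul_of_nonneg_left (hM _) (ht _))
      (mul_le_mul_of_nonneg_left (hM _) (ht _))
  exact (norm_sub_le _ _).trans (add_le_add h3 h4)

theorem integrable_spread_add_defect (hx : x ∈ Set.Icc (0 : Fin p → ℝ) 1)
    (hcube : ∀ᵐ o ∂ρ, cov o ∈ Set.Icc (0 : Fin p → ℝ) 1) :
    Integrable (fun z => P.spread ν x z + P.defect ν x z) (Measure.pi fun _ : Fin s => ρ) := by
  refine Integrable.of_bound (P.measurable_spread.add P.measurable_defect).aestronglyMeasurable 4 ?_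
  filter_upwards [ae_pi_cube hcube] with z hz
  have h1 := P.spread_le_two (ν := ν) hx hz
  have h2 := P.defect_le_two (ν := ν) (x := x) z
  rw [Real.norm_eq_abs, abs_of_nonneg (add_nonneg (P.spread_nonneg z) (P.defect_nonneg z))]
  linarith

/-- Spread and defect are bounded by 2, so one factor of the square is estimated by a constant and
the bound stays linear in their mean. -/
theorem integral_norm_weightedSum_condMean_sub_sq_le (hC : ∀ y, ‖ξ y‖ ≤ C) (hL0 : 0 ≤ L)
    (hL : ∀ w, ∀ t ∈ Set.Icc (0 : Fin p → ℝ) 1,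
      ‖∫ y, ξ y ∂(Q w t) - ∫ y, ξ y ∂(Q w x)‖ ≤ L * ‖t - x‖)
    (hx : x ∈ Set.Icc (0 : Fin p → ℝ) 1)
    (hcube : ∀ᵐ o ∂ρ, cov o ∈ Set.Icc (0 : Fin p → ℝ) 1) :
    ∫ z, ‖P.weightedSum ν x (condMean Q ξ) z -
        (∫ y, ξ y ∂(Q true x) - ∫ y, ξ y ∂(Q false x))‖ ^ 2 ∂(Measure.pi fun _ : Fin s => ρ) ≤
      2 * (L + C) ^ 2 *
        ∫ z, (P.spread ν x z + P.defect ν x z) ∂(Measure.pi fun _ : Fin s => ρ) := by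
  have hC0 : 0 ≤ C := (norm_nonneg _).trans (hC 0)
  rw [← integral_const_mul]
  refine integral_mono_of_nonneg (Eventually.of_forall fun z => by positivity)
    ((integrable_spread_add_defect hx hcube).const_mul _) ?_
  filter_upwards [ae_pi_cube hcube] with z hz
  have h := norm_weightedSum_condMean_sub_le (P := P) (ν := ν) hC hL hz
  have h1 := P.spread_le_two (ν := ν) hx hz
  have h2 := P.defect_le_two (ν := ν) (x := x) z
  have h3 := P.spread_nonneg (ν := ν) (x := x) z
  have h4 := P.defect_nonneg (ν := ν) (x := x) z
  set D := P.spread ν x z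
  set E := P.defect ν x z
  have h5 : L * D + C * E ≤ (L + C) * (D + E) := by nlinarith [mul_nonneg hL0 h4, mul_nonneg hC0 h3]
  have h6 : L * D + C * E ≤ 2 * (L + C) := by nlinarith
  have h7 : 0 ≤ L * D + C * E := by positivity
  calc _ ≤ (L * D + C * E) ^ 2 := pow_le_pow_left₀ (norm_nonneg _) h 2
    _ = (L * D + C * E) * (L * D + C * E) := sq _
    _ ≤ (2 * (L + C)) * ((L + C) * (D + E)) := mul_le_mul h6 h5 h7 (by positivity)
    _ = _ := by ring

end TreeProcedure

/-! ### Expansion of the variance of the projection -/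

namespace TreeProcedure

set_option linter.unusedSectionVars false

variable {p d s : ℕ} {𝓔 : Type*} [MeasurableSpace 𝓔] {P : TreeProcedure p d s 𝓔}
  {ν : Measure 𝓔} [IsProbabilityMeasure ν] {x : Fin p → ℝ}
  {F : Type*} [NormedAddCommGroup F] [InnerProductSpace ℝ F] [CompleteSpace F]
  {ρ : Measure (Obs p d)} [IsProbabilityMeasure ρ]
  {Q : Bool → Kernel (Fin p → ℝ) (Fin d → ℝ)} [∀ w, IsMarkovKernel (Q w)]
  {ξ : (Fin d → ℝ) → F} {C L : ℝ}

/-- The variance of the leading term of the projection. -/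
theorem integral_norm_condWeight_smul_sq (hP : P.IsHonest) (hρ : Disintegrates ρ Q)
    (hξ : StronglyMeasurable ξ) (hC : ∀ y, ‖ξ y‖ ≤ C) (i : Fin s) :
    ∫ o, ‖P.condWeight ν x ρ i o • (ξ (out o) - condMean Q ξ o)‖ ^ 2 ∂ρ =
      ∫ o, P.condWeight ν x ρ i o ^ 2 * outcomeVar Q ξ (trt o) (cov o) ∂ρ := by
  have hm : StronglyMeasurable fun o : Obs p d =>
      ‖P.condWeight ν x ρ i o • (ξ (out o) - condMean Q ξ o)‖ ^ 2 :=
    ((stronglyMeasurable_condWeight i).smul ((hξ.comp_measurable measurable_out).sub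
      (stronglyMeasurable_condMean hξ))).norm.pow 2
  have hb : ∀ o : Obs p d, ‖‖P.condWeight ν x ρ i o • (ξ (out o) - condMean Q ξ o)‖ ^ 2‖ ≤
      (1 * (2 * C)) ^ 2 := fun o => by
    rw [norm_pow, norm_norm]
    refine pow_le_pow_left₀ (norm_nonneg _) ?_ 2
    rw [norm_smul]
    refine mul_le_mul (abs_condWeight_le_one i o) ?_ (norm_nonneg _) zero_le_one
    exact (norm_sub_le _ _).trans (by
      have := hC (out o); have := norm_condMean_le (Q := Q) hC o; linarith)
  rw [hρ.integral_eq hm hb]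
  refine integral_congr_ae (Eventually.of_forall fun o => ?_)
  have h1 : ∀ y, P.condWeight ν x ρ i (cov o, trt o, y) = P.condWeight ν x ρ i o := fun y =>
    condWeight_congr hP i rfl rfl
  simp only [h1, norm_smul, mul_pow, Real.norm_eq_abs, sq_abs]
  rw [integral_const_mul]
  rfl

theorem measurable_outcomeVar_comp (hξ : StronglyMeasurable ξ) (hC : ∀ y, ‖ξ y‖ ≤ C) :
    StronglyMeasurable fun o : Obs p d => outcomeVar Q ξ (trt o) (cov o) := by
  simp only [outcomeVar_eq hξ hC]
  exact (stronglyMeasurable_condMean (Q := Q) (hξ.norm.pow 2)).sub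
    ((stronglyMeasurable_condMean (Q := Q) hξ).norm.pow 2)

theorem integral_condWeight_sq_mul_group (c : Bool → ℝ) (i : Fin s) :
    ∫ o, P.condWeight ν x ρ i o ^ 2 * c (trt o) ∂ρ =
      ∑ w, (∫ o in groupSet w, P.condWeight ν x ρ i o ^ 2 ∂ρ) * c w := by
  have hi : Integrable (fun o => P.condWeight ν x ρ i o ^ 2 * c (trt o)) ρ := by
    refine (integrable_condWeight_sq i).mul_bdd (c := |c true| + |c false|)
      ((measurable_of_countable c).comp measurable_trt).aestronglyMeasurable
      (Eventually.of_forall fun o => ?_)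
    rw [Real.norm_eq_abs]
    cases trt o
    · have := abs_nonneg (c true); linarith
    · have := abs_nonneg (c false); linarith
  have h : ∀ w, ∫ o in groupSet w, P.condWeight ν x ρ i o ^ 2 * c (trt o) ∂ρ =
      (∫ o in groupSet w, P.condWeight ν x ρ i o ^ 2 ∂ρ) * c w := fun w => by
    rw [← integral_mul_const]
    refine setIntegral_congr_fun (measurableSet_groupSet w) fun o ho => ?_
    have : trt o = w := ho
    simp only [this]
  rw [integral_eq_add_groups hi, h, h, Fintype.sum_bool]

/-- The variance of the projection of the weighted sum of `ξ` of the outcomes is, up to a small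
error, determined by the variances of the conditional mean weights. -/
theorem abs_projectionVar_sub_le (hs : 0 < s) (hP : P.IsHonest) (hsymm : P.IsSymmetric ν x)
    (hρ : Disintegrates ρ Q) (hx : x ∈ Set.Icc (0 : Fin p → ℝ) 1)
    (hcube : ∀ᵐ o ∂ρ, cov o ∈ Set.Icc (0 : Fin p → ℝ) 1) (hq : ∀ w, 0 < ρ.real (groupSet w))
    (hξ : StronglyMeasurable ξ) (hC : ∀ y, ‖ξ y‖ ≤ C) (hL0 : 0 ≤ L)
    (hL : ∀ w, ∀ t ∈ Set.Icc (0 : Fin p → ℝ) 1,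
      ‖∫ y, ξ y ∂(Q w t) - ∫ y, ξ y ∂(Q w x)‖ ≤ L * ‖t - x‖)
    (hL2 : ∀ w, ∀ t ∈ Set.Icc (0 : Fin p → ℝ) 1,
      |∫ y, ‖ξ y‖ ^ 2 ∂(Q w t) - ∫ y, ‖ξ y‖ ^ 2 ∂(Q w x)| ≤ L * ‖t - x‖)
    {η δ : ℝ} (hδ : 0 < δ) (hδ1 : δ ≤ 1)
    (hη : ∫ z, (P.spread ν x z + P.defect ν x z) ∂(Measure.pi fun _ : Fin s => ρ) ≤ η)
    (i : Fin s) :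
    |∫ o, ‖coordMean ρ i (P.weightedSum ν x fun o => ξ (out o)) o -
        ∫ z, P.weightedSum ν x (fun o => ξ (out o)) z ∂(Measure.pi fun _ => ρ)‖ ^ 2 ∂ρ -
      ∑ w, P.weightVar ν x ρ i w * outcomeVar Q ξ w x| ≤
      (8 * C ^ 2 * δ + 4 * (L + C) ^ 2 * (η / δ) + (L + 2 * C * L) * η) / s +
        4 * C ^ 2 * ∑ w, 1 / ρ.real (groupSet w) / (s : ℝ) ^ 2 := by
  have hs' : (0 : ℝ) < s := Nat.cast_pos.2 hs
  have hC0 : 0 ≤ C := (norm_nonneg _).trans (hC 0)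
  set π := Measure.pi fun _ : Fin s => ρ
  set ψ := P.condWeight ν x ρ i
  have hη0 : 0 ≤ η := le_trans (integral_nonneg fun z => add_nonneg (P.spread_nonneg z)
    (P.defect_nonneg z)) hη
  set h₁ : Obs p d → F := fun o => ξ (out o) - condMean Q ξ o with hh₁
  have hξo : StronglyMeasurable fun o : Obs p d => ξ (out o) := hξ.comp_measurable measurable_out
  have hcm : StronglyMeasurable (condMean (p := p) Q ξ) := stronglyMeasurable_condMean hξ
  have hh₁m : StronglyMeasurable h₁ := hξo.sub hcm
  have hh₁b : ∀ o, ‖h₁ o‖ ≤ 2 * C := fun o => (norm_sub_le _ _).trans (by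
      have := hC (out o); have := norm_condMean_le (Q := Q) hC o; linarith)
  have hcmb : ∀ o : Obs p d, ‖condMean Q ξ o‖ ≤ C := norm_condMean_le hC
  have hsplit : ∀ z, P.weightedSum ν x (fun o => ξ (out o)) z =
      P.weightedSum ν x h₁ z + P.weightedSum ν x (condMean Q ξ) z := fun z => by
    simp only [weightedSum, hh₁, smul_sub, Finset.sum_sub_distrib, sub_add_cancel]
  have hG1m := stronglyMeasurable_weightedSum (P := P) (ν := ν) (x := x) hh₁m
  have hG2m := stronglyMeasurable_weightedSum (P := P) (ν := ν) (x := x) hcm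
  have hG1b := fun z => norm_weightedSum_le (P := P) (ν := ν) (x := x) hh₁b z (by positivity)
  have hG2b := fun z => norm_weightedSum_le (P := P) (ν := ν) (x := x) hcmb z hC0
  have hG1i : Integrable (P.weightedSum ν x h₁) π := integrable_of_bounded hG1m hG1b
  have hG2i : Integrable (P.weightedSum ν x (condMean Q ξ)) π := integrable_of_bounded hG2m hG2b
  have hres := coordMean_weightedSum_residual (P := P) (ν := ν) (x := x) hP hρ hξ hC i
  -- The residual part is centred, so all of the mean belongs to the conditional mean part B.
  have hE1 : ∫ z, P.weightedSum ν x h₁ z ∂π = 0 := by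
    rw [integral_eq_integral_update hG1i i]
    have e : ∀ o, coordMean ρ i (P.weightedSum ν x h₁) o =
        ψ o • (ξ (out o) - condMean Q ξ o) := hres
    simp only [e]
    exact hρ.integral_smul_sub_condMean hξ hC (stronglyMeasurable_condWeight i)
      (abs_condWeight_le_one i) fun o o' => condWeight_congr hP i
  set B : Obs p d → F := fun o => coordMean ρ i (P.weightedSum ν x (condMean Q ξ)) o -
    ∫ z, P.weightedSum ν x (condMean Q ξ) z ∂π with hB
  set A : Obs p d → F := fun o => ψ o • (ξ (out o) - condMean Q ξ o) with hA
  have hU : ∀ o, coordMean ρ i (P.weightedSum ν x fun o => ξ (out o)) o -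
        ∫ z, P.weightedSum ν x (fun o => ξ (out o)) z ∂π = A o + B o := by
    intro o
    have e1 : coordMean ρ i (P.weightedSum ν x fun o => ξ (out o)) o = A o +
        coordMean ρ i (P.weightedSum ν x (condMean Q ξ)) o := by
      rw [hA]
      simp only []
      rw [← hres o]
      unfold coordMean
      simp only [hsplit]
      exact integral_add (integrable_update hG1m hG1b i o) (integrable_update hG2m hG2b i o)
    have e2 : ∫ z, P.weightedSum ν x (fun o => ξ (out o)) z ∂π =
        ∫ z, P.weightedSum ν x (condMean Q ξ) z ∂π := by
      simp only [hsplit]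
      rw [integral_add hG1i hG2i, hE1, zero_add]
    rw [e1, e2, hB]
    simp only []
    abel
  simp only [hU]
  have hAm : StronglyMeasurable A := (stronglyMeasurable_condWeight i).smul hh₁m
  have hBm : StronglyMeasurable B := (stronglyMeasurable_coordMean hG2m i).sub
    stronglyMeasurable_const
  have hAb : ∀ o, ‖A o‖ ≤ 2 * C := fun o => by
    rw [hA]; simp only []
    rw [norm_smul]
    exact (mul_le_mul (abs_condWeight_le_one i o) (hh₁b o) (norm_nonneg _) zero_le_one).trans
      (one_mul _).le
  have hBb : ∀ o, ‖B o‖ ≤ 2 * C + 2 * C := fun o => by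
    refine (norm_sub_le _ _).trans (add_le_add (norm_coordMean_le hG2b i o) ?_)
    refine (norm_integral_le_of_norm_le_const (Eventually.of_forall hG2b)).trans ?_
    simp
  have hsqi : ∀ {f : Obs p d → F} {c : ℝ}, StronglyMeasurable f → (∀ o, ‖f o‖ ≤ c) →
      Integrable (fun o => ‖f o‖ ^ 2) ρ := fun {f c} hf hc =>
    integrable_of_bounded (C := c ^ 2) (hf.norm.pow 2) fun o => by
      rw [norm_pow, norm_norm]; exact pow_le_pow_left₀ (norm_nonneg _) (hc o) 2
  have hAi := hsqi hAm hAb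
  have hBi := hsqi hBm hBb
  have hABi : Integrable (fun o => ‖A o + B o‖ ^ 2) ρ :=
    hsqi (f := fun o => A o + B o) (hAm.add hBm)
      (fun o => (norm_add_le _ _).trans (add_le_add (hAb o) (hBb o)))
  have hAsq : ∫ o, ‖A o‖ ^ 2 ∂ρ ≤ 8 * C ^ 2 / s := by
    calc ∫ o, ‖A o‖ ^ 2 ∂ρ ≤ ∫ o, ψ o ^ 2 * (4 * C ^ 2) ∂ρ := by
          refine integral_mono hAi ((integrable_condWeight_sq i).mul_const _) fun o => ?_
          simp only [hA, norm_smul, mul_pow, Real.norm_eq_abs, sq_abs]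
          refine mul_le_mul_of_nonneg_left ?_ (sq_nonneg _)
          calc _ ≤ (2 * C) ^ 2 := pow_le_pow_left₀ (norm_nonneg _) (hh₁b o) 2
            _ = _ := by ring
      _ ≤ 2 / s * (4 * C ^ 2) := by
          rw [integral_mul_const]
          exact mul_le_mul_of_nonneg_right (integral_condWeight_sq_le hs hsymm i) (by positivity)
      _ = _ := by ring
  -- Bessel's inequality around the constant difference of the means at x gains the factor 1/s on
  -- top of η.
  have hBsq : ∫ o, ‖B o‖ ^ 2 ∂ρ ≤ 2 * (L + C) ^ 2 * η / s := by
    rw [le_div_iff₀ hs', mul_comm]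
    refine (mul_integral_norm_coordMean_sub_sq_le hG2m hG2b (weightedSum_symm hsymm) i
      (∫ y, ξ y ∂(Q true x) - ∫ y, ξ y ∂(Q false x))).trans ?_
    exact (integral_norm_weightedSum_condMean_sub_sq_le hC hL0 hL hx hcube).trans
      (mul_le_mul_of_nonneg_left hη (by positivity))
  -- Young's inequality with parameter δ handles the cross term of A and B; as δ ≤ 1, the square of
  -- B is absorbed into the same 1/δ term.
  have hstep1 : |∫ o, ‖A o + B o‖ ^ 2 ∂ρ - ∫ o, ‖A o‖ ^ 2 ∂ρ| ≤
      (8 * C ^ 2 * δ + 4 * (L + C) ^ 2 * (η / δ)) / s := by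
    have hpt : ∀ o, |‖A o + B o‖ ^ 2 - ‖A o‖ ^ 2| ≤ δ * ‖A o‖ ^ 2 + 2 / δ * ‖B o‖ ^ 2 := by
      intro o
      have e : ‖A o + B o‖ ^ 2 - ‖A o‖ ^ 2 = 2 * inner ℝ (A o) (B o) + ‖B o‖ ^ 2 := by
        rw [norm_add_sq_real]; ring
      have h1 : |2 * inner ℝ (A o) (B o)| ≤ δ * ‖A o‖ ^ 2 + 1 / δ * ‖B o‖ ^ 2 := by
        rw [abs_mul, abs_two]
        have h2 := abs_real_inner_le_norm (A o) (B o)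
        have h3 : 0 ≤ 1 / δ * (δ * ‖A o‖ - ‖B o‖) ^ 2 := by positivity
        have h4 : 1 / δ * (δ * ‖A o‖ - ‖B o‖) ^ 2 =
            δ * ‖A o‖ ^ 2 - 2 * (‖A o‖ * ‖B o‖) + 1 / δ * ‖B o‖ ^ 2 := by field_simp; ring
        linarith
      have h5 : ‖B o‖ ^ 2 ≤ 1 / δ * ‖B o‖ ^ 2 :=
        le_mul_of_one_le_left (by positivity) (by rw [le_div_iff₀ hδ]; linarith)
      rw [e]
      refine (abs_add_le _ _).trans ?_
      rw [abs_of_nonneg (by positivity : 0 ≤ ‖B o‖ ^ 2)]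
      have : 2 / δ * ‖B o‖ ^ 2 = 1 / δ * ‖B o‖ ^ 2 + 1 / δ * ‖B o‖ ^ 2 := by ring
      linarith
    rw [← integral_sub hABi hAi]
    calc _ ≤ ∫ o, |‖A o + B o‖ ^ 2 - ‖A o‖ ^ 2| ∂ρ := abs_integral_le_integral_abs
      _ ≤ ∫ o, (δ * ‖A o‖ ^ 2 + 2 / δ * ‖B o‖ ^ 2) ∂ρ :=
        integral_mono (hABi.sub hAi).abs ((hAi.const_mul _).add (hBi.const_mul _)) hpt
      _ = δ * ∫ o, ‖A o‖ ^ 2 ∂ρ + 2 / δ * ∫ o, ‖B o‖ ^ 2 ∂ρ := by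
        rw [integral_add (hAi.const_mul _) (hBi.const_mul _), integral_const_mul,
          integral_const_mul]
      _ ≤ δ * (8 * C ^ 2 / s) + 2 / δ * (2 * (L + C) ^ 2 * η / s) :=
        add_le_add (mul_le_mul_of_nonneg_left hAsq hδ.le)
          (mul_le_mul_of_nonneg_left hBsq (by positivity))
      _ = _ := by field_simp; ring
  -- The variance is frozen at x, at the Lipschitz cost of the mean of ψ² ‖X - x‖, which is the
  -- expected spread over s.
  have hstep2 : |∫ o, ‖A o‖ ^ 2 ∂ρ -
      ∑ w, (∫ o in groupSet w, ψ o ^ 2 ∂ρ) * outcomeVar Q ξ w x| ≤ (L + 2 * C * L) * η / s := by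
    rw [← integral_condWeight_sq_mul_group (fun w => outcomeVar Q ξ w x),
      integral_norm_condWeight_smul_sq hP hρ hξ hC]
    have hvb : ∀ w t, |outcomeVar Q ξ w t| ≤ 4 * C ^ 2 := fun w t => by
      rw [abs_of_nonneg (outcomeVar_nonneg w t)]; exact outcomeVar_le hC w t
    have i1 : Integrable (fun o => ψ o ^ 2 * outcomeVar Q ξ (trt o) (cov o)) ρ :=
      (integrable_condWeight_sq i).mul_bdd (c := 4 * C ^ 2)
        (measurable_outcomeVar_comp hξ hC).aestronglyMeasurable
        (Eventually.of_forall fun o => hvb _ _)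
    have i2 : Integrable (fun o => ψ o ^ 2 * outcomeVar Q ξ (trt o) x) ρ :=
      (integrable_condWeight_sq i).mul_bdd (c := 4 * C ^ 2)
        ((measurable_of_countable fun w => outcomeVar Q ξ w x).comp
          measurable_trt).aestronglyMeasurable
        (Eventually.of_forall fun o => hvb _ _)
    rw [← integral_sub i1 i2]
    have i3 : Integrable (fun o => (L + 2 * C * L) * (ψ o ^ 2 * ‖cov o - x‖)) ρ := by
      refine Integrable.const_mul ?_ _
      refine (integrable_condWeight_sq i).mul_bdd (c := 1)
        (measurable_cov.sub_const x).norm.aestronglyMeasurable ?_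
      filter_upwards [hcube] with o ho
      rw [norm_norm]; exact norm_sub_le_one hx ho
    calc _ ≤ ∫ o, |ψ o ^ 2 * outcomeVar Q ξ (trt o) (cov o) -
          ψ o ^ 2 * outcomeVar Q ξ (trt o) x| ∂ρ := abs_integral_le_integral_abs
      _ ≤ ∫ o, (L + 2 * C * L) * (ψ o ^ 2 * ‖cov o - x‖) ∂ρ := by
        refine integral_mono_ae (i1.sub i2).abs i3 ?_
        filter_upwards [hcube] with o ho
        have := abs_outcomeVar_sub_le hξ hC (hL (trt o) _ ho) (hL2 (trt o) _ ho)
        rw [← mul_sub, abs_mul, abs_of_nonneg (sq_nonneg (ψ o)), mul_left_comm]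
        exact mul_le_mul_of_nonneg_left this (sq_nonneg _)
      _ ≤ (L + 2 * C * L) * (η / s) := by
        rw [integral_const_mul]
        refine mul_le_mul_of_nonneg_left ?_ (by positivity)
        refine (integral_condWeight_sq_mul_norm_le hs hsymm hx hcube i).trans
          (div_le_div_of_nonneg_right (le_trans ?_ hη) hs'.le)
        refine integral_mono_of_nonneg (Eventually.of_forall fun z => P.spread_nonneg z)
          (integrable_spread_add_defect hx hcube) (Eventually.of_forall fun z => ?_)
        have := P.defect_nonneg (ν := ν) (x := x) z
        linarith
      _ = _ := by ring
  -- Second moments become variances: the mean of ψ over a group is at most 1/s, so its square is of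
  -- lower order.
  have hstep3 : |∑ w, (∫ o in groupSet w, ψ o ^ 2 ∂ρ) * outcomeVar Q ξ w x -
      ∑ w, P.weightVar ν x ρ i w * outcomeVar Q ξ w x| ≤
      4 * C ^ 2 * ∑ w, 1 / ρ.real (groupSet w) / (s : ℝ) ^ 2 := by
    rw [← Finset.sum_sub_distrib, Finset.mul_sum]
    refine (Finset.abs_sum_le_sum_abs _ _).trans (Finset.sum_le_sum fun w _ => ?_)
    rw [← sub_mul, abs_mul, mul_comm]
    have e : (∫ o in groupSet w, ψ o ^ 2 ∂ρ) - P.weightVar ν x ρ i w =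
        (∫ o in groupSet w, ψ o ∂ρ) ^ 2 / ρ.real (groupSet w) := by
      unfold weightVar; simp only [ψ]; ring
    rw [e, abs_of_nonneg (outcomeVar_nonneg w x),
      abs_of_nonneg (div_nonneg (sq_nonneg _) (hq w).le)]
    refine mul_le_mul (outcomeVar_le hC w x) ?_ (div_nonneg (sq_nonneg _) (hq w).le)
      (by positivity)
    have h1 : |∫ o in groupSet w, ψ o ∂ρ| ≤ 1 / s :=
      abs_integral_le_integral_abs.trans (setIntegral_abs_condWeight_le hs hsymm i w)
    have h2 : (∫ o in groupSet w, ψ o ∂ρ) ^ 2 ≤ (1 / s) ^ 2 := by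
      rw [← sq_abs]; exact pow_le_pow_left₀ (abs_nonneg _) h1 2
    calc _ ≤ (1 / (s : ℝ)) ^ 2 / ρ.real (groupSet w) := div_le_div_of_nonneg_right h2 (hq w).le
      _ = _ := by ring
  have e : (8 * C ^ 2 * δ + 4 * (L + C) ^ 2 * (η / δ) + (L + 2 * C * L) * η) / s =
      (8 * C ^ 2 * δ + 4 * (L + C) ^ 2 * (η / δ)) / s + (L + 2 * C * L) * η / s := by ring
  rw [e]
  refine (abs_sub_le _ (∫ o, ‖A o‖ ^ 2 ∂ρ) _).trans ?_
  rw [add_assoc]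
  refine add_le_add hstep1 ((abs_sub_le _
    (∑ w, (∫ o in groupSet w, ψ o ^ 2 ∂ρ) * outcomeVar Q ξ w x) _).trans ?_)
  exact add_le_add hstep2 hstep3

end TreeProcedure

/-! ### Lower bound for the variance of the mean weight -/

namespace TreeProcedure

set_option linter.unusedSectionVars false

variable {p d s : ℕ} {𝓔 : Type*} [MeasurableSpace 𝓔] {P : TreeProcedure p d s 𝓔}
  {ν : Measure 𝓔} [IsProbabilityMeasure ν] {x : Fin p → ℝ}
  {ρ : Measure (Obs p d)} [IsProbabilityMeasure ρ]

/-- The weight of a given observation has the sign of its group whatever the other data are, so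
nothing cancels and Jensen's inequality is an equality. The lower bound on the variance needs this
direction. -/
theorem abs_condWeight_eq (i : Fin s) (o : Obs p d) :
    |P.condWeight ν x ρ i o| =
      ∫ z, |P.meanWeight ν x (Function.update z i o) i| ∂(Measure.pi fun _ => ρ) := by
  refine le_antisymm (abs_condWeight_le i o) ?_
  simp only [P.abs_meanWeight_eq, Function.update_self]
  rw [integral_const_mul]
  refine (le_abs_self _).trans ?_
  rw [abs_mul, abs_groupSign, one_mul, condWeight]

theorem integral_abs_condWeight_mul_eq {g : Obs p d → ℝ} (hg : Measurable g) {C : ℝ}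
    (hC : ∀ o, |g o| ≤ C) (i : Fin s) :
    ∫ o, |P.condWeight ν x ρ i o| * g o ∂ρ =
      ∫ z, |P.meanWeight ν x z i| * g (z i) ∂(Measure.pi fun _ => ρ) := by
  have hi : Integrable (fun z : Fin s → Obs p d => |P.meanWeight ν x z i| * g (z i))
      (Measure.pi fun _ => ρ) := by
    refine integrable_of_bounded (C := 1 * C) ((P.measurable_meanWeight ν x i).abs.mul
      (hg.comp (measurable_pi_apply i))).stronglyMeasurable fun z => ?_
    rw [norm_mul, Real.norm_eq_abs, Real.norm_eq_abs, abs_abs]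
    exact mul_le_mul (P.abs_meanWeight_le ν x z i) (hC _) (abs_nonneg _) zero_le_one
  rw [integral_eq_integral_update hi i]
  refine integral_congr_ae (Eventually.of_forall fun o => ?_)
  simp only [coordMean, Function.update_self]
  rw [integral_mul_const, abs_condWeight_eq]

/-- The points whose coordinates differ from those of `x` by amounts with a small product. -/
def nearSet (x : Fin p → ℝ) (R : ℝ) : Set (Obs p d) := {o | ∏ j, |cov o j - x j| < R}

theorem measurableSet_nearSet (R : ℝ) : MeasurableSet (nearSet (d := d) x R) := by
  refine measurableSet_lt (Finset.measurable_prod _ fun j _ => ?_) measurable_const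
  exact (((measurable_pi_apply j).comp measurable_cov).sub_const _).abs

/-- If the weights of the observations are concentrated on a small set, then their conditional
means vary. -/
theorem weightVar_ge (hs : 0 < s) (hsymm : P.IsSymmetric ν x) {R η Φ r : ℝ} (i : Fin s)
    (hfar : ∫ z, {z : Fin s → Obs p d | R ≤ ∏ j, |cov (z i) j - x j|}.indicator
        (fun z => |P.meanWeight ν x z i|) z ∂(Measure.pi fun _ => ρ) ≤ Φ)
    (hη : ∫ z, P.defect ν x z ∂(Measure.pi fun _ : Fin s => ρ) ≤ η)
    (hΦ : Φ + η / s ≤ 1 / (2 * s)) (hr0 : 0 < r)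
    (hr : ρ.real (nearSet x R) ≤ r) (w : Bool) (hq : 0 < ρ.real (groupSet w)) :
    1 / (4 * (s : ℝ) ^ 2 * r) - 1 / (ρ.real (groupSet w) * (s : ℝ) ^ 2) ≤
      P.weightVar ν x ρ i w := by
  have hs' : (0 : ℝ) < s := Nat.cast_pos.2 hs
  set A : Set (Obs p d) := groupSet w ∩ nearSet x R
  have hA : MeasurableSet A := (measurableSet_groupSet w).inter (measurableSet_nearSet R)
  set ψ := P.condWeight ν x ρ i
  set T := ∫ o, |ψ o| * A.indicator 1 o ∂ρ with hTdef
  have hind : ∀ (B : Set (Obs p d)) o, |B.indicator (1 : Obs p d → ℝ) o| ≤ 1 := fun B o => by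
    by_cases h : o ∈ B <;> simp [h]
  have hmi : ∀ {B : Set (Obs p d)}, MeasurableSet B → Integrable (fun z : Fin s → Obs p d =>
      |P.meanWeight ν x z i| * B.indicator 1 (z i)) (Measure.pi fun _ => ρ) := fun {B} hB => by
    refine integrable_of_bounded (C := 1 * 1) ((P.measurable_meanWeight ν x i).abs.mul
      ((measurable_one.indicator hB).comp (measurable_pi_apply i))).stronglyMeasurable fun z => ?_
    rw [norm_mul, Real.norm_eq_abs, Real.norm_eq_abs, abs_abs]
    exact mul_le_mul (P.abs_meanWeight_le ν x z i) (hind _ _) (abs_nonneg _) zero_le_one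
  have hfarm : MeasurableSet {z : Fin s → Obs p d | R ≤ ∏ j, |cov (z i) j - x j|} := by
    refine measurableSet_le measurable_const (Finset.measurable_prod _ fun j _ => ?_)
    exact (((measurable_pi_apply j).comp (measurable_cov.comp (measurable_pi_apply i))).sub_const
      _).abs
  have hmfar : Integrable ({z : Fin s → Obs p d | R ≤ ∏ j, |cov (z i) j - x j|}.indicator
      (fun z => |P.meanWeight ν x z i|)) (Measure.pi fun _ => ρ) :=
    (integrable_of_bounded (C := 1) (P.measurable_meanWeight ν x i).abs.stronglyMeasurable
      fun z => by
        rw [Real.norm_eq_abs, abs_abs]; exact P.abs_meanWeight_le ν x z i).indicator hfarm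
  -- A member of the group lies in the near set and is counted in T, or is far from x and is counted
  -- in Φ.
  have hgroup : ∫ z, |P.meanWeight ν x z i| * (groupSet w).indicator 1 (z i)
      ∂(Measure.pi fun _ => ρ) ≤ T + Φ := by
    rw [hTdef, integral_abs_condWeight_mul_eq (measurable_one.indicator hA) (hind A) i]
    refine le_trans ?_ (add_le_add_right hfar _)
    rw [← integral_add (hmi hA) hmfar]
    refine integral_mono (hmi (measurableSet_groupSet w)) ((hmi hA).add hmfar) fun z => ?_
    have h0 := abs_nonneg (P.meanWeight ν x z i)
    by_cases h1 : z i ∈ groupSet w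
    · by_cases h2 : z i ∈ nearSet x R
      · have h3 : z ∉ {z : Fin s → Obs p d | R ≤ ∏ j, |cov (z i) j - x j|} := fun h =>
          absurd (show ∏ j, |cov (z i) j - x j| < R from h2) (not_lt.2 h)
        have h4 : z i ∈ A := ⟨h1, h2⟩
        simp [h1, h3, h4]
      · have h3 : z ∈ {z : Fin s → Obs p d | R ≤ ∏ j, |cov (z i) j - x j|} := by
          by_contra h
          exact h2 (show ∏ j, |cov (z i) j - x j| < R from lt_of_not_ge h)
        have h4 : z i ∉ A := fun h => h2 h.2
        simp only [Set.indicator_of_mem h1, Set.indicator_of_notMem h4, Set.indicator_of_mem h3]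
        simp
    · have h4 : z i ∉ A := fun h => h1 h.1
      simp only [Set.indicator_of_notMem h1, Set.indicator_of_notMem h4, mul_zero, zero_add]
      exact Set.indicator_nonneg (fun _ _ => abs_nonneg _) _
  -- Each group misses at most the total defect, so its weights have expected mass at least 1 - η,
  -- shared equally among s observations.
  have hdef : 1 - η ≤ s * ∫ z, |P.meanWeight ν x z i| * (groupSet w).indicator 1 (z i)
      ∂(Measure.pi fun _ => ρ) := by
    rw [mul_setIntegral_abs_meanWeight_le hsymm]
    have hsi : Integrable (fun z : Fin s → Obs p d =>
        ∑ i, (if trt (z i) = w then |P.meanWeight ν x z i| else 0)) (Measure.pi fun _ => ρ) :=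
      integrable_of_bounded (C := 1) (measurable_sum_group w).stronglyMeasurable fun z => by
        rw [Real.norm_of_nonneg (Finset.sum_nonneg fun i _ => by positivity)]
        exact P.sum_abs_meanWeight_group_le ν x z w
    have hdi : Integrable (fun z : Fin s → Obs p d => P.defect ν x z) (Measure.pi fun _ => ρ) :=
      integrable_of_bounded (C := 2) P.measurable_defect.stronglyMeasurable fun z => by
        rw [Real.norm_of_nonneg (P.defect_nonneg z)]; exact P.defect_le_two z
    have h1 : (1 : ℝ) ≤ ∫ z : Fin s → Obs p d, ((∑ i, (if trt (z i) = w then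
        |P.meanWeight ν x z i| else 0)) + P.defect ν x z) ∂(Measure.pi fun _ => ρ) := by
      calc (1 : ℝ) = ∫ _ : Fin s → Obs p d, (1 : ℝ) ∂(Measure.pi fun _ => ρ) := by simp
        _ ≤ _ := integral_mono (integrable_const _) (hsi.add hdi) fun z => by
          have h2 : ∀ v, 0 ≤ 1 - ∑ i, (if trt (z i) = v then |P.meanWeight ν x z i| else 0) :=
            fun v => sub_nonneg.2 (P.sum_abs_meanWeight_group_le ν x z v)
          have h3 := Finset.single_le_sum (fun v _ => h2 v) (Finset.mem_univ w)
          simp only [defect, Pi.add_apply]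
          linarith
    rw [integral_add hsi hdi] at h1
    linarith
  have hT : 1 / (2 * s) ≤ T := by
    have h1 : (1 - η) / s ≤ T + Φ := by
      rw [div_le_iff₀ hs']
      refine hdef.trans ?_
      rw [mul_comm]
      exact mul_le_mul_of_nonneg_right hgroup hs'.le
    have h2 : (1 - η) / s = 1 / (2 * s) + 1 / (2 * s) - η / s := by field_simp; ring
    linarith
  have hT0 : 0 ≤ T := le_trans (by positivity) hT
  -- Cauchy–Schwarz on a set of mass at most r, in the form (|ψ| - T/r)² ≥ 0 integrated over that
  -- set.
  have hCS : T ^ 2 / r ≤ ∫ o in groupSet w, ψ o ^ 2 ∂ρ := by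
    have hψi : Integrable (fun o => |ψ o| * A.indicator 1 o) ρ := by
      refine integrable_of_bounded (C := 1 * 1)
        ((stronglyMeasurable_condWeight i).measurable.abs.mul
        (measurable_one.indicator hA)).stronglyMeasurable fun o => ?_
      rw [norm_mul, Real.norm_eq_abs, Real.norm_eq_abs, abs_abs]
      exact mul_le_mul (abs_condWeight_le_one i o) (hind _ _) (abs_nonneg _) zero_le_one
    have hni : Integrable ((nearSet x R).indicator (1 : Obs p d → ℝ)) ρ :=
      (integrable_const (1 : ℝ)).indicator (measurableSet_nearSet R)
    have h1 : 2 * (T / r) * T - (T / r) ^ 2 * ρ.real (nearSet x R) ≤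
        ∫ o in groupSet w, ψ o ^ 2 ∂ρ := by
      rw [← integral_indicator (measurableSet_groupSet w), ← integral_indicator_one
        (measurableSet_nearSet R)]
      nth_rewrite 2 [hTdef]
      rw [← integral_const_mul, ← integral_const_mul,
        ← integral_sub (hψi.const_mul _) (hni.const_mul _)]
      refine integral_mono ((hψi.const_mul _).sub (hni.const_mul _))
        ((integrable_condWeight_sq i).indicator (measurableSet_groupSet w)) fun o => ?_
      by_cases h1 : o ∈ groupSet w
      · by_cases h2 : o ∈ nearSet x R
        · have h4 : o ∈ A := ⟨h1, h2⟩
          simp only [Set.indicator_of_mem h1, Set.indicator_of_mem h2, Set.indicator_of_mem h4,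
            Pi.one_apply, mul_one]
          have := sq_nonneg (|ψ o| - T / r)
          rw [sub_sq, sq_abs] at this
          change _ ≤ ψ o ^ 2
          linarith
        · have h4 : o ∉ A := fun h => h2 h.2
          simp only [Set.indicator_of_mem h1, Set.indicator_of_notMem h2,
            Set.indicator_of_notMem h4, mul_zero, sub_zero]
          exact sq_nonneg _
      · have h4 : o ∉ A := fun h => h1 h.1
        simp only [Set.indicator_of_notMem h1, Set.indicator_of_notMem h4, mul_zero, zero_sub]
        exact neg_nonpos.2 (mul_nonneg (sq_nonneg _)
          (Set.indicator_nonneg (fun _ _ => zero_le_one) _))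
    have h2 : (T / r) ^ 2 * ρ.real (nearSet x R) ≤ (T / r) ^ 2 * r :=
      mul_le_mul_of_nonneg_left hr (sq_nonneg _)
    have h3 : 2 * (T / r) * T - (T / r) ^ 2 * r = T ^ 2 / r := by field_simp; ring
    linarith
  have hmean : (∫ o in groupSet w, ψ o ∂ρ) ^ 2 ≤ 1 / (s : ℝ) ^ 2 := by
    have h1 : |∫ o in groupSet w, ψ o ∂ρ| ≤ 1 / s :=
      abs_integral_le_integral_abs.trans (setIntegral_abs_condWeight_le hs hsymm i w)
    rw [← sq_abs, ← one_div_pow]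
    exact pow_le_pow_left₀ (abs_nonneg _) h1 2
  have h5 : 1 / (4 * (s : ℝ) ^ 2 * r) ≤ T ^ 2 / r := by
    rw [← div_div]
    refine div_le_div_of_nonneg_right ?_ hr0.le
    calc 1 / (4 * (s : ℝ) ^ 2) = (1 / (2 * s)) ^ 2 := by rw [div_pow, mul_pow]; norm_num
      _ ≤ T ^ 2 := pow_le_pow_left₀ (by positivity) hT 2
  have h6 : (∫ o in groupSet w, ψ o ∂ρ) ^ 2 / ρ.real (groupSet w) ≤
      1 / (ρ.real (groupSet w) * (s : ℝ) ^ 2) := by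
    rw [mul_comm, ← div_div]
    exact div_le_div_of_nonneg_right hmean hq.le
  unfold weightVar
  change _ ≤ ∫ o in groupSet w, ψ o ^ 2 ∂ρ - (∫ o in groupSet w, ψ o ∂ρ) ^ 2 / _
  linarith

end TreeProcedure

/-! ### Volume of the points with small coordinate product -/

section NearVolume

theorem intervalIntegrable_abs_rpow {r : ℝ} (hr : -1 < r) :
    IntervalIntegrable (fun t : ℝ => |t| ^ r) volume (-2) 2 := by
  have h1 : IntervalIntegrable (fun t : ℝ => |t| ^ r) volume 0 2 := by
    refine (intervalIntegral.intervalIntegrable_rpow' hr).congr ?_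
    intro t ht
    rw [Set.uIoc_of_le (by norm_num)] at ht
    simp only [abs_of_pos ht.1]
  have h2 : IntervalIntegrable (fun t : ℝ => |t| ^ r) volume (-2) 0 := by
    have h3 := (IntervalIntegrable.iff_comp_neg (by simp)).1 h1
    simp only [abs_neg, neg_zero] at h3
    exact h3.symm
  exact h2.trans h1

theorem integrableOn_abs_sub_rpow {r : ℝ} (hr : -1 < r) {c : ℝ} (hc : c ∈ Set.Icc (0 : ℝ) 1) :
    IntegrableOn (fun t : ℝ => |t - c| ^ r) (Set.Icc 0 1) := by
  have h := (intervalIntegrable_abs_rpow hr).comp_sub_right c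
  rw [intervalIntegrable_iff_integrableOn_Icc_of_le (by linarith)] at h
  exact h.mono_set (Set.Icc_subset_Icc (by linarith [hc.2]) (by linarith [hc.1]))

variable {p : ℕ}

/-- The set of points whose coordinates differ from those of `x` by amounts with a small product
has small volume. -/
theorem exists_volume_near_le {x : Fin p → ℝ} (hx : x ∈ Set.Icc (0 : Fin p → ℝ) 1) {γ : ℝ}
    (hγ : 0 < γ) (hγ1 : γ < 1) :
    ∃ C : ℝ, 0 < C ∧ ∀ R : ℝ, 0 < R →
      volume.real ({t : Fin p → ℝ | ∏ j, |t j - x j| < R} ∩ Set.Icc 0 1) ≤ C * R ^ γ := by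
  -- A product of one-dimensional functions, integrable on the cube as γ < 1. Markov's inequality
  -- for f then bounds the volume by R^γ times its integral.
  set f : (Fin p → ℝ) → ℝ := fun t => ∏ j, |t j - x j| ^ (-γ)
  set m : Measure (Fin p → ℝ) := Measure.pi fun _ => (volume : Measure ℝ).restrict (Set.Icc 0 1)
  have hm : m = volume.restrict (Set.Icc (0 : Fin p → ℝ) 1) := by
    rw [← Set.pi_univ_Icc, volume_pi, Measure.restrict_pi_pi]; rfl
  have hf : Integrable f m :=
    Integrable.fintype_prod (f := fun j (t : ℝ) => |t - x j| ^ (-γ)) fun j =>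
      integrableOn_abs_sub_rpow (by linarith) ⟨hx.1 j, hx.2 j⟩
  have hf0 : ∀ t, 0 ≤ f t := fun t => Finset.prod_nonneg fun j _ => by positivity
  refine ⟨∫ t, f t ∂m + 1, add_pos_of_nonneg_of_pos (integral_nonneg hf0) one_pos,
    fun R hR => ?_⟩
  set B := {t : Fin p → ℝ | ∏ j, |t j - x j| < R}
  have hB : MeasurableSet B := measurableSet_lt
    (Finset.measurable_prod _ fun j _ => ((measurable_pi_apply j).sub_const _).abs)
    measurable_const
  have h1 : volume.real (B ∩ Set.Icc 0 1) = m.real B := by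
    rw [hm, measureReal_restrict_apply hB]
  -- On the null set where some t_j = x_j the convention 0^(-γ) = 0 makes f vanish, so the pointwise
  -- estimate would fail there.
  have hne : ∀ᵐ t ∂m, ∀ j, t j ≠ x j := ae_all_iff.2 fun j => by
    rw [hm]
    refine ae_restrict_of_ae ?_
    rw [volume_pi]
    exact Measure.ae_eval_ne (fun _ : Fin p => (volume : Measure ℝ)) j (x j)
  rw [h1, ← integral_indicator_one hB]
  calc ∫ t, B.indicator 1 t ∂m ≤ ∫ t, R ^ γ * f t ∂m := by
        refine integral_mono_of_nonneg (Eventually.of_forall fun t =>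
          Set.indicator_nonneg (fun _ _ => zero_le_one) _) (hf.const_mul _) ?_
        filter_upwards [hne] with t ht
        by_cases h : t ∈ B
        · rw [Set.indicator_of_mem h]
          have h2 : 0 < ∏ j, |t j - x j| :=
            Finset.prod_pos fun j _ => abs_pos.2 (sub_ne_zero.2 (ht j))
          have h3 : f t = (∏ j, |t j - x j|) ^ (-γ) :=
            Real.finsetProd_rpow _ _ (fun j _ => abs_nonneg _) _
          have h4 : ∏ j, |t j - x j| ≤ R := le_of_lt h
          rw [h3, Real.rpow_neg h2.le, ← div_eq_mul_inv, Pi.one_apply,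
            one_le_div (Real.rpow_pos_of_pos h2 _)]
          exact Real.rpow_le_rpow h2.le h4 hγ.le
        · rw [Set.indicator_of_notMem h]
          exact mul_nonneg (by positivity) (hf0 t)
    _ ≤ _ := by
        rw [integral_const_mul, mul_comm]
        exact mul_le_mul_of_nonneg_right (by linarith) (by positivity)

end NearVolume

/-! ### Comparison of rates -/

section Rates

theorem tendsto_rpow_natCast_atTop {θ : ℝ} (hθ : 0 < θ) :
    Tendsto (fun s : ℕ => (s : ℝ) ^ θ) atTop atTop :=
  (tendsto_rpow_atTop hθ).comp tendsto_natCast_atTop_atTop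

theorem eventually_rpow_le_mul_rpow {a b : ℝ} (h : a < b) (D : ℝ) {c : ℝ} (hc : 0 < c) :
    ∀ᶠ s : ℕ in atTop, D * (s : ℝ) ^ a ≤ c * (s : ℝ) ^ b := by
  have h1 := (tendsto_rpow_natCast_atTop (sub_pos.2 h)).eventually_ge_atTop (D / c)
  filter_upwards [h1, eventually_gt_atTop 0] with s hs hs0
  have hs' : (0 : ℝ) < s := Nat.cast_pos.2 hs0
  rw [div_le_iff₀ hc, mul_comm] at hs
  calc D * (s : ℝ) ^ a ≤ c * (s : ℝ) ^ (b - a) * (s : ℝ) ^ a :=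
        mul_le_mul_of_nonneg_right hs (by positivity)
    _ = c * (s : ℝ) ^ b := by rw [mul_assoc, ← Real.rpow_add hs']; congr 2; ring

/-- Stretched exponentials decay faster than every power. -/
theorem eventually_pow_mul_two_rpow_le (p : ℕ) {θ : ℝ} (hθ : 0 < θ) (N : ℝ) {c : ℝ} (hc : 0 < c) :
    ∀ᶠ s : ℕ in atTop,
      ((s + 1 : ℝ) ^ p) ^ 2 * (2 : ℝ) ^ (-((s : ℝ) ^ θ)) ≤ c * (s : ℝ) ^ (-N) := by
  have h1 := ((tendsto_rpow_mul_exp_neg_mul_atTop_nhds_zero ((2 * p + N) / θ) (Real.log 2)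
    (Real.log_pos one_lt_two)).comp (tendsto_rpow_natCast_atTop hθ)).const_mul ((2 : ℝ) ^ (2 * p))
  rw [mul_zero] at h1
  filter_upwards [h1.eventually_le_const hc, eventually_gt_atTop 0] with s hs hs0
  have hs' : (0 : ℝ) < s := Nat.cast_pos.2 hs0
  have hs1 : (1 : ℝ) ≤ s := by exact_mod_cast hs0
  simp only [Function.comp] at hs
  rw [← Real.rpow_mul hs'.le, mul_div_cancel₀ _ hθ.ne', Real.rpow_add hs'] at hs
  have h2 : ((s + 1 : ℝ) ^ p) ^ 2 ≤ 2 ^ (2 * p) * (s : ℝ) ^ (2 * p : ℝ) := by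
    have : (s : ℝ) ^ (2 * p : ℝ) = (s : ℝ) ^ (2 * p) := by
      rw [← Real.rpow_natCast]; push_cast; rfl
    rw [this, ← mul_pow, ← pow_mul, mul_comm p 2]
    exact pow_le_pow_left₀ (by positivity) (by linarith) _
  have h3 : (2 : ℝ) ^ (-((s : ℝ) ^ θ)) = Real.exp (-Real.log 2 * (s : ℝ) ^ θ) := by
    rw [Real.rpow_def_of_pos two_pos]; congr 1; ring
  rw [h3]
  have h4 : (s : ℝ) ^ N * (s : ℝ) ^ (-N) = 1 := by rw [← Real.rpow_add hs']; simp
  calc _ ≤ 2 ^ (2 * p) * (s : ℝ) ^ (2 * p : ℝ) * Real.exp (-Real.log 2 * (s : ℝ) ^ θ) :=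
        mul_le_mul_of_nonneg_right h2 (Real.exp_nonneg _)
    _ = (2 ^ (2 * p) * ((s : ℝ) ^ (2 * p : ℝ) * (s : ℝ) ^ N *
          Real.exp (-Real.log 2 * (s : ℝ) ^ θ))) * (s : ℝ) ^ (-N) := by
        linear_combination (-(2 ^ (2 * p) * (s : ℝ) ^ (2 * p : ℝ) *
          Real.exp (-Real.log 2 * (s : ℝ) ^ θ))) * h4
    _ ≤ _ := mul_le_mul_of_nonneg_right hs (by positivity)

/-- A depth that is logarithmic in the sample size. -/
theorem exists_depth {α r : ℝ} (hα : 0 < α) (hα1 : α < 1) (hr : 0 < r) (hr1 : r < 1) {s : ℕ}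
    (hs : 0 < s) : ∃ k : ℕ, (s : ℝ) ^ (-(1 / 2 : ℝ)) ≤ α ^ k ∧
      r ^ k ≤ r⁻¹ * (s : ℝ) ^ (-(Real.log r / (2 * Real.log α))) := by
  have hs' : (0 : ℝ) < s := Nat.cast_pos.2 hs
  have hlα : Real.log α < 0 := Real.log_neg hα hα1
  have hne := hlα.ne
  have hlr : Real.log r < 0 := Real.log_neg hr hr1
  have hls : 0 ≤ Real.log s := Real.log_natCast_nonneg s
  -- This real depth satisfies α^y = s^(-1/2). Rounding down keeps α^k large enough and costs only
  -- the factor r⁻¹.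
  set y := Real.log s / (2 * -Real.log α) with hy
  have hy0 : 0 ≤ y := div_nonneg hls (by linarith)
  refine ⟨⌊y⌋₊, ?_, ?_⟩
  · have h1 := Nat.floor_le hy0
    rw [← Real.rpow_natCast α, Real.rpow_def_of_pos hs', Real.rpow_def_of_pos hα,
      Real.exp_le_exp]
    have h2 : Real.log α * y ≤ Real.log α * ⌊y⌋₊ := mul_le_mul_of_nonpos_left h1 hlα.le
    have h3 : Real.log α * y = Real.log s * -(1 / 2) := by
      rw [hy]; field_simp
    linarith
  · have h1 := (Nat.lt_floor_add_one y).le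
    rw [← Real.rpow_natCast r, Real.rpow_def_of_pos hs', Real.rpow_def_of_pos hr]
    rw [show r⁻¹ = Real.exp (-Real.log r) by rw [Real.exp_neg, Real.exp_log hr], ← Real.exp_add,
      Real.exp_le_exp]
    have h2 : Real.log r * (⌊y⌋₊ + 1) ≤ Real.log r * y := mul_le_mul_of_nonpos_left h1 hlr.le
    have h3 : Real.log r * y = Real.log s * -(Real.log r / (2 * Real.log α)) := by
      rw [hy]; field_simp
    linarith

end Rates

/-! ### Polynomial rates for valid procedures -/

namespace TreeProcedure

set_option linter.unusedSectionVars false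

variable {p d : ℕ} {Ω 𝓔 : Type*} [MeasurableSpace Ω] [MeasurableSpace 𝓔]

/-- The assumptions on a tree procedure that is run on an i.i.d. sample `ζ` with law `ρ`. -/
structure Valid (μ : Measure Ω) (ν : Measure 𝓔) (ρ : Measure (Obs p d)) (x : Fin p → ℝ) (α : ℝ)
    (κ : ℕ) (π₀ : ℝ) {s : ℕ} (P : TreeProcedure p d s 𝓔) (ζ : Ω → Fin s → Obs p d) : Prop where
  honest : P.IsHonest
  symm : P.IsSymmetric ν x
  measurable : Measurable ζ
  law : μ.map ζ = Measure.pi fun _ => ρ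
  regular : ∀ᵐ ω ∂μ, P.IsAlphaRegular ν α κ (ζ ω)
  random : ∀ᵐ ω ∂μ, P.IsRandomSplit ν π₀ (ζ ω)

variable {μ : Measure Ω} [IsProbabilityMeasure μ] {ν : Measure 𝓔} [IsProbabilityMeasure ν]
  {ρ : Measure (Obs p d)} [IsProbabilityMeasure ρ] {x : Fin p → ℝ} {α π₀ a b : ℝ} {κ : ℕ}

theorem Valid.cube {s : ℕ} {P : TreeProcedure p d s 𝓔} {ζ : Ω → Fin s → Obs p d}
    (h : P.Valid μ ν ρ x α κ π₀ ζ) (hρ : BoxMass ρ a b) :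
    ∀ᵐ ω ∂μ, ∀ i, cov (ζ ω i) ∈ Set.Icc (0 : Fin p → ℝ) 1 := by
  have h1 := ae_pi_cube (s := s) hρ.cube
  rw [← h.law] at h1
  exact ae_of_ae_map h.measurable.aemeasurable h1

theorem IsHonest.third_le_card {s : ℕ} {P : TreeProcedure p d s 𝓔} (h : P.IsHonest) (hs : 2 ≤ s)
    (e : 𝓔) : (s : ℝ) / 3 ≤ (P.second e).card := by
  have h1 : s ≤ 3 * (P.second e).card := by
    rcases h.1 e with h | h <;> omega
  have h2 : (s : ℝ) ≤ 3 * (P.second e).card := by exact_mod_cast h1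
  linarith

/-- The trees concentrate around `x` at a polynomial rate. -/
theorem exists_rate_integral_spread_add_defect (hp : 0 < p) (ha : 0 < a) (hb : 0 < b) (hab : a ≤ b)
    (hα0 : 0 < α) (hα : α ≤ 0.2) (hκ : 0 < κ) (hπ : 0 < π₀) (hx : x ∈ Set.Icc (0 : Fin p → ℝ) 1)
    (hρ : BoxMass ρ a b) :
    ∃ ε C : ℝ, 0 < ε ∧ 0 < C ∧ ∀ᶠ s : ℕ in atTop, ∀ (P : TreeProcedure p d s 𝓔)
      (ζ : Ω → Fin s → Obs p d), P.Valid μ ν ρ x α κ π₀ ζ →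
        ∫ z, (P.spread ν x z + P.defect ν x z) ∂(Measure.pi fun _ => ρ) ≤ C * (s : ℝ) ^ (-ε) := by
  have hα1 : α < 1 := by norm_num at hα; linarith
  have hab1 : a / (32 * b) ≤ 1 / 32 := by
    rw [div_le_div_iff₀ (by positivity) (by norm_num)]; linarith
  -- The product of the relative shrinkage of a side by one split and the guaranteed probability of
  -- the feature, capped at 1; the expected side loses the factor 1 - q per level.
  set q := α * (a / (32 * b)) * min (π₀ / p) 1 with hq
  have hp' : (0 : ℝ) < p := Nat.cast_pos.2 hp
  have hq0 : 0 < q := mul_pos (by positivity) (lt_min (by positivity) one_pos)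
  have hq1 : q < 1 := by
    have h1 : α * (a / (32 * b)) ≤ 1 * (1 / 32) :=
      mul_le_mul hα1.le hab1 (by positivity) (by norm_num)
    have h2 : q ≤ 1 * (1 / 32) * 1 :=
      mul_le_mul h1 (min_le_right _ _) (le_min (by positivity) zero_le_one) (by norm_num)
    linarith
  set ε := Real.log (1 - q) / (2 * Real.log α)
  have hε : 0 < ε := div_pos_of_neg_of_neg (Real.log_neg (by linarith) (by linarith))
    (by have := Real.log_neg hα0 hα1; linarith)
  set D := 2 / α + 10 + 5 * ((κ : ℝ) + 1) / (a / (8 * b))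
  have hD : 0 < D := by positivity
  set G := (p : ℝ) * (4 * b + a)
  have hG : 0 ≤ G := by positivity
  refine ⟨ε, 2 * p * (1 - q)⁻¹ + 12, hε, ?_, ?_⟩
  · have : 0 < (1 - q)⁻¹ := inv_pos.2 (by linarith)
    positivity
  -- The slack u is s^(1/4). It makes the grid failure probability smaller than every power of s,
  -- while the threshold, of order s^(1/4), stays below the s^(1/2)/3 observations that remain after
  -- k splits.
  filter_upwards [eventually_ge_atTop 2,
    eventually_pow_mul_two_rpow_le p (by norm_num : (0 : ℝ) < 1 / 4) ε one_pos,
    eventually_rpow_le_mul_rpow (by norm_num : (1 / 4 : ℝ) < 1 / 2) (D * (G + 1))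
      (by norm_num : (0 : ℝ) < 1 / 3)] with s hs h1 h2 P ζ h
  have hs0 : 0 < s := by omega
  have hs' : (0 : ℝ) < s := Nat.cast_pos.2 hs0
  have hs1 : (1 : ℝ) ≤ s := by exact_mod_cast hs0
  have hu : (1 : ℝ) ≤ (s : ℝ) ^ (1 / 4 : ℝ) := Real.one_le_rpow hs1 (by norm_num)
  obtain ⟨k, hk1, hk2⟩ := exists_depth hα0 hα1 (sub_pos.2 hq1) (by linarith : 1 - q < 1) hs0
  have hK := exists_threshold (κ := κ) hα0 (by positivity : 0 < a / (8 * b))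
    (by linarith : 0 ≤ G + (s : ℝ) ^ (1 / 4 : ℝ)) (by linarith)
  have hn : ∀ e, D * (G + (s : ℝ) ^ (1 / 4 : ℝ)) ≤ α ^ k * (P.second e).card := fun e => by
    calc D * (G + (s : ℝ) ^ (1 / 4 : ℝ)) ≤ D * ((G + 1) * (s : ℝ) ^ (1 / 4 : ℝ)) := by
          refine mul_le_mul_of_nonneg_left ?_ hD.le
          nlinarith
      _ ≤ 1 / 3 * (s : ℝ) ^ (1 / 2 : ℝ) := by linarith
      _ = (s : ℝ) ^ (-(1 / 2 : ℝ)) * (s / 3) := by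
          have : (s : ℝ) ^ (1 / 2 : ℝ) = (s : ℝ) ^ (-(1 / 2 : ℝ)) * s := by
            nth_rewrite 3 [← Real.rpow_one (s : ℝ)]
            rw [← Real.rpow_add hs']; norm_num
          rw [this]; ring
      _ ≤ _ := mul_le_mul hk1 (h.honest.third_le_card hs e) (by positivity) (by positivity)
  have h3 := P.integral_spread_add_defect_le ν hp hs0 ha hb hab (by linarith) hα0 hα hκ hx hK hn hπ
    hρ h.measurable h.law h.regular h.random (h.cube hρ)
  have hm : Measurable fun z : Fin s → Obs p d => P.spread ν x z + P.defect ν x z :=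
    P.measurable_spread.add P.measurable_defect
  rw [← h.law, integral_map h.measurable.aemeasurable hm.aestronglyMeasurable]
  refine h3.trans ?_
  have h4 : 2 * p * (1 - q) ^ k ≤ 2 * p * ((1 - q)⁻¹ * (s : ℝ) ^ (-ε)) :=
    mul_le_mul_of_nonneg_left hk2 (by positivity)
  rw [mul_assoc 12, add_mul]
  linarith

/-- The conditional mean weights vary at least polynomially. -/
theorem exists_weightVar_ge (hp : 0 < p) (ha : 0 < a) (hb : 0 < b) (hab : a ≤ b)
    (hα0 : 0 < α) (hα : α ≤ 0.2) (hκ : 0 < κ) (hπ : 0 < π₀) (hx : x ∈ Set.Icc (0 : Fin p → ℝ) 1)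
    (hρ : BoxMass ρ a b) (hvol : ∀ B : Set (Fin p → ℝ), MeasurableSet B →
      ρ.real {o | cov o ∈ B} ≤ b * volume.real (B ∩ Set.Icc 0 1))
    (hq : ∀ w, 0 < ρ.real (groupSet w)) {γ : ℝ} (hγ : 0 < γ) (hγ1 : γ < 1) :
    ∃ c : ℝ, 0 < c ∧ ∀ᶠ s : ℕ in atTop, ∀ (P : TreeProcedure p d s 𝓔)
      (ζ : Ω → Fin s → Obs p d), P.Valid μ ν ρ x α κ π₀ ζ → ∀ i w,
        c * (s : ℝ) ^ (γ ^ 2 - 2) ≤ P.weightVar ν x ρ i w := by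
  obtain ⟨ε, C, hε, hC, hrate⟩ := exists_rate_integral_spread_add_defect (μ := μ) (ν := ν) hp ha hb
    hab hα0 hα hκ hπ hx hρ
  obtain ⟨M, hM, hnear⟩ := exists_volume_near_le hx hγ hγ1
  set D := 2 / α + 10 + 5 * ((κ : ℝ) + 1) / (a / (8 * b))
  have hD : 0 < D := by positivity
  set G := (p : ℝ) * (4 * b + a)
  have hG : 0 ≤ G := by positivity
  -- Chosen so that a/4 · (s/3) · R exceeds the threshold plus the additive error; 12/a would give
  -- equality, and 13 makes it strict.
  set T := 13 / a * ((D + 1) * (G + 1)) with hT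
  have hT0 : 0 < T := by positivity
  set c := 1 / (8 * (b * (M * T ^ γ))) with hc
  have hc0 : 0 < c := by positivity
  refine ⟨c, hc0, ?_⟩
  have hγ2 : 0 < 1 - γ := by linarith
  have hqe : ∀ w, ∀ᶠ s : ℕ in atTop,
      1 / ρ.real (groupSet w) * (s : ℝ) ^ (-2 : ℝ) ≤ c * (s : ℝ) ^ (γ ^ 2 - 2) := fun w =>
    eventually_rpow_le_mul_rpow (by nlinarith [sq_pos_of_pos hγ]) _ hc0
  filter_upwards [hrate, eventually_ge_atTop 2, hqe true, hqe false,
    eventually_pow_mul_two_rpow_le p hγ2 1 (by norm_num : (0 : ℝ) < 1 / 12),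
    eventually_rpow_le_mul_rpow (by linarith : -ε < 0) C (by norm_num : (0 : ℝ) < 1 / 4)]
    with s h1 hs hq1 hq0 h2 h3 P ζ h i w
  have hs0 : 0 < s := by omega
  have hs' : (0 : ℝ) < s := Nat.cast_pos.2 hs0
  have hs1 : (1 : ℝ) ≤ s := by exact_mod_cast hs0
  -- The slack is a small power of s, so the leaf has at most of order s^(1-γ) observations, hence
  -- volume of order s^(-γ), while the failure probability still decays faster than every power.
  set U := (s : ℝ) ^ (1 - γ) with hU
  have hu : 1 ≤ U := Real.one_le_rpow hs1 hγ2.le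
  have hK := exists_threshold (κ := κ) hα0 (by positivity : 0 < a / (8 * b))
    (by linarith : 0 ≤ G + U) (by linarith)
  set R := T * (s : ℝ) ^ (-γ) with hR
  have hR0 : 0 < R := by positivity
  have hUs : (s : ℝ) * (s : ℝ) ^ (-γ) = U := by
    nth_rewrite 1 [← Real.rpow_one (s : ℝ)]
    rw [← Real.rpow_add hs']; rfl
  have hn : ∀ e, D * (G + U) + (G + U) < a / 4 * (P.second e).card * R := fun e => by
    calc D * (G + U) + (G + U) = (D + 1) * (G + U) := by ring
      _ ≤ (D + 1) * ((G + 1) * U) := by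
          refine mul_le_mul_of_nonneg_left ?_ (by linarith)
          nlinarith
      _ < 13 / 12 * ((D + 1) * ((G + 1) * U)) := by
          have : 0 < (D + 1) * ((G + 1) * U) := by positivity
          linarith
      _ = a / 4 * (s / 3) * R := by
          rw [hR, hT, ← hUs]; field_simp; ring
      _ ≤ _ := by
          refine mul_le_mul_of_nonneg_right ?_ hR0.le
          exact mul_le_mul_of_nonneg_left (h.honest.third_le_card hs e) (by positivity)
  have hfar := P.integral_abs_meanWeight_far_le ν hp hs0 ha hb (by linarith) hα hx hK hn hρ
    h.measurable h.law h.regular (h.cube hρ) i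
  have hfarm : MeasurableSet {z : Fin s → Obs p d | R ≤ ∏ j, |cov (z i) j - x j|} := by
    refine measurableSet_le measurable_const (Finset.measurable_prod _ fun j _ => ?_)
    exact (((measurable_pi_apply j).comp (measurable_cov.comp (measurable_pi_apply i))).sub_const
      _).abs
  have hfar' : ∫ z, {z : Fin s → Obs p d | R ≤ ∏ j, |cov (z i) j - x j|}.indicator
        (fun z => |P.meanWeight ν x z i|) z ∂(Measure.pi fun _ => ρ) ≤
      3 * ((s + 1 : ℝ) ^ p) ^ 2 * 2 ^ (-U) := by
    rw [← h.law, integral_map h.measurable.aemeasurable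
      ((P.measurable_meanWeight ν x i).abs.indicator hfarm).aestronglyMeasurable]
    exact hfar
  have hdef : ∫ z, P.defect ν x z ∂(Measure.pi fun _ : Fin s => ρ) ≤ 1 / 4 := by
    refine le_trans (integral_mono_of_nonneg (Eventually.of_forall fun z => P.defect_nonneg z)
      (integrable_spread_add_defect hx hρ.cube) (Eventually.of_forall fun z => ?_))
      ((h1 P ζ h).trans (by simpa using h3))
    have := P.spread_nonneg (ν := ν) (x := x) z
    linarith
  have hr : ρ.real (nearSet x R) ≤ b * (M * R ^ γ) := by
    refine (hvol {t | ∏ j, |t j - x j| < R} (measurableSet_lt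
      (Finset.measurable_prod _ fun j _ => ((measurable_pi_apply j).sub_const _).abs)
      measurable_const)).trans (mul_le_mul_of_nonneg_left (hnear R hR0) hb.le)
  have hV := weightVar_ge hs0 h.symm i hfar' hdef (by
      rw [Real.rpow_neg_one] at h2
      have : 1 / (2 * s) = 3 * (1 / 12 * (s : ℝ)⁻¹) + 1 / 4 / s := by field_simp; norm_num
      rw [this, mul_assoc 3]
      linarith) (by positivity) hr w (hq w)
  refine le_trans ?_ hV
  -- With R of order s^(-γ), the near set has mass of order s^(-γ²), which produces the exponent γ²
  -- - 2. The factor 2 leaves room for subtracting the squared mean.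
  have e1 : 1 / (4 * (s : ℝ) ^ 2 * (b * (M * R ^ γ))) = 2 * c * (s : ℝ) ^ (γ ^ 2 - 2) := by
    have e2 : (s : ℝ) ^ (γ ^ 2 - 2) = (((s : ℝ) ^ (-γ)) ^ γ)⁻¹ * ((s : ℝ) ^ 2)⁻¹ := by
      have e4 : ((s : ℝ) ^ 2)⁻¹ = (s : ℝ) ^ (-2 : ℝ) := by
        rw [Real.rpow_neg hs'.le]; norm_num
      rw [← Real.rpow_mul hs'.le, ← Real.rpow_neg hs'.le, e4, ← Real.rpow_add hs']
      congr 1; ring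
    have h5 : 0 < ((s : ℝ) ^ (-γ)) ^ γ := by positivity
    have h6 : 0 < T ^ γ := by positivity
    rw [e2, hc, hR, Real.mul_rpow hT0.le (by positivity)]
    generalize ((s : ℝ) ^ (-γ)) ^ γ = Y at h5 ⊢
    field_simp
    norm_num
  have e3 : 1 / (ρ.real (groupSet w) * (s : ℝ) ^ 2) ≤ c * (s : ℝ) ^ (γ ^ 2 - 2) := by
    have e4 : 1 / (ρ.real (groupSet w) * (s : ℝ) ^ 2) =
        1 / ρ.real (groupSet w) * (s : ℝ) ^ (-2 : ℝ) := by
      rw [Real.rpow_neg hs'.le, ← div_div, div_eq_mul_inv (1 / ρ.real (groupSet w))]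
      norm_num
    rw [e4]
    cases w
    · exact hq0
    · exact hq1
  rw [e1]
  linarith

end TreeProcedure

/-! ### Law of the observed data -/

section Law

set_option linter.unusedSectionVars false

variable {p d : ℕ} {Ω : Type*} [MeasurableSpace Ω] {μ : Measure Ω} [IsProbabilityMeasure μ]

theorem measurable_observed {X : ℕ → Ω → Fin p → ℝ} {W : ℕ → Ω → Bool}
    {Y : Bool → ℕ → Ω → Fin d → ℝ} (hX : ∀ i, Measurable (X i)) (hW : ∀ i, Measurable (W i))
    (hY : ∀ w i, Measurable (Y w i)) (i : ℕ) : Measurable (observed X W Y i) := by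
  have h : Measurable fun q : Ω × Bool => Y q.2 i q.1 :=
    measurable_from_prod_countable_left fun w => hY w i
  exact (hX i).prodMk ((hW i).prodMk (h.comp (measurable_id.prodMk (hW i))))

theorem measurable_sample {X : ℕ → Ω → Fin p → ℝ} {W : ℕ → Ω → Bool}
    {Y : Bool → ℕ → Ω → Fin d → ℝ} (hX : ∀ i, Measurable (X i)) (hW : ∀ i, Measurable (W i))
    (hY : ∀ w i, Measurable (Y w i)) (s : ℕ) : Measurable (sample X W Y s) :=
  measurable_pi_iff.2 fun i => measurable_observed hX hW hY i

/-- An observation is one fixed measurable function of covariates, treatment and both potential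
outcomes, so independence and equality in law carry over. -/
theorem map_sample {X : ℕ → Ω → Fin p → ℝ} {W : ℕ → Ω → Bool}
    {Y : Bool → ℕ → Ω → Fin d → ℝ} (hX : ∀ i, Measurable (X i)) (hW : ∀ i, Measurable (W i))
    (hY : ∀ w i, Measurable (Y w i))
    (h_indep : iIndepFun (fun i ω => (X i ω, W i ω, Y false i ω, Y true i ω)) μ)
    (h_ident : ∀ i, IdentDistrib (fun ω => (X i ω, W i ω, Y false i ω, Y true i ω))
      (fun ω => (X 0 ω, W 0 ω, Y false 0 ω, Y true 0 ω)) μ μ) (s : ℕ) :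
    μ.map (sample X W Y s) = Measure.pi fun _ => μ.map (observed X W Y 0) := by
  set φ : (Fin p → ℝ) × Bool × (Fin d → ℝ) × (Fin d → ℝ) → Obs p d :=
    fun q => (q.1, q.2.1, if q.2.1 = true then q.2.2.2 else q.2.2.1) with hφ
  have hφm : Measurable φ := by
    refine measurable_fst.prodMk ((measurable_fst.comp measurable_snd).prodMk ?_)
    exact Measurable.ite ((measurable_fst.comp measurable_snd) (measurableSet_singleton true))
      (measurable_snd.comp (measurable_snd.comp measurable_snd))
      (measurable_fst.comp (measurable_snd.comp measurable_snd))
  have hobs : ∀ i, observed X W Y i = φ ∘ fun ω => (X i ω, W i ω, Y false i ω, Y true i ω) := by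
    intro i
    funext ω
    cases h : W i ω <;> simp [observed, hφ, h]
  have h1 : iIndepFun (fun i => observed X W Y i) μ := by
    have := h_indep.comp (fun _ => φ) fun _ => hφm
    simpa only [hobs] using this
  have h2 : iIndepFun (fun i : Fin s => observed X W Y i) μ :=
    h1.precomp (g := fun i : Fin s => (i : ℕ)) Fin.val_injective
  have h3 := (iIndepFun_iff_map_fun_eq_pi_map
    fun i : Fin s => (measurable_observed hX hW hY i).aemeasurable).1 h2
  have h4 : ∀ i, μ.map (observed X W Y i) = μ.map (observed X W Y 0) := fun i => by
    simp only [hobs]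
    exact ((h_ident i).comp hφm).map_eq
  simp only [h4] at h3
  exact h3

variable {X : Ω → Fin p → ℝ} {W : Ω → Bool} {Y : Bool → Ω → Fin d → ℝ}

theorem setIntegral_condProb (hX : Measurable X) {A : Set Ω} (hA : MeasurableSet A)
    {B : Set (Fin p → ℝ)} (hB : MeasurableSet B) :
    ∫ ω in X ⁻¹' B, (μ⟦A | MeasurableSpace.comap X inferInstance⟧) ω ∂μ = μ.real (X ⁻¹' B ∩ A) := by
  rw [setIntegral_condExp hX.comap_le ((integrable_const _).indicator hA) ⟨B, hB, rfl⟩,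
    setIntegral_indicator hA]
  simp

theorem HasBoundedDensityOnCube.measureReal_bounds {m : Measure (Fin p → ℝ)}
    (h : HasBoundedDensityOnCube m) :
    ∃ a b : ℝ, 0 < a ∧ a ≤ b ∧ (∀ᵐ t ∂m, t ∈ Set.Icc (0 : Fin p → ℝ) 1) ∧
      ∀ B : Set (Fin p → ℝ), MeasurableSet B →
        a * volume.real (B ∩ Set.Icc 0 1) ≤ m.real B ∧
          m.real B ≤ b * volume.real (B ∩ Set.Icc 0 1) := by
  obtain ⟨g, a, b, hg, ha, hb, rfl⟩ := h
  have hab : a ≤ b := by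
    have := hb 0 ⟨le_rfl, zero_le_one⟩
    exact_mod_cast this.1.trans this.2
  refine ⟨a, b, ha, hab, ?_, fun B hB => ?_⟩
  · exact (withDensity_absolutelyContinuous _ _).ae_le (ae_restrict_mem measurableSet_Icc)
  · have hfin : volume (B ∩ Set.Icc (0 : Fin p → ℝ) 1) ≠ ∞ :=
      ((measure_mono Set.inter_subset_right).trans_lt isCompact_Icc.measure_lt_top).ne
    have hm : MeasurableSet (B ∩ Set.Icc (0 : Fin p → ℝ) 1) := hB.inter measurableSet_Icc
    have e : ((volume.restrict (Set.Icc (0 : Fin p → ℝ) 1)).withDensity g) B =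
        ∫⁻ t in B ∩ Set.Icc 0 1, g t := by
      rw [withDensity_apply _ hB, Measure.restrict_restrict hB]
    have hu : ∫⁻ t in B ∩ Set.Icc 0 1, g t ≤ b * volume (B ∩ Set.Icc 0 1) := by
      rw [← setLIntegral_const]
      exact setLIntegral_mono measurable_const fun t ht => (hb t ht.2).2
    have hl : a * volume (B ∩ Set.Icc 0 1) ≤ ∫⁻ t in B ∩ Set.Icc 0 1, g t := by
      rw [← setLIntegral_const]
      exact setLIntegral_mono hg fun t ht => (hb t ht.2).1
    have hbt : b * volume (B ∩ Set.Icc 0 1) ≠ ∞ := ENNReal.mul_ne_top ENNReal.coe_ne_top hfin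
    constructor
    · have := ENNReal.toReal_mono (hu.trans_lt hbt.lt_top).ne hl
      rw [ENNReal.toReal_mul, ← e] at this
      exact this
    · have := ENNReal.toReal_mono hbt hu
      rw [ENNReal.toReal_mul, ← e] at this
      exact this

/-- Integrate the overlap bounds over the event that X lies in B; for the control group use the
upper bound and take complements. -/
theorem mul_le_measureReal_inter_trt (hX : Measurable X) (hW : Measurable W) {ε : ℝ}
    (h_overlap : ∀ᵐ ω ∂μ,
      ε < (μ⟦W ⁻¹' {true} | MeasurableSpace.comap X inferInstance⟧) ω ∧
      (μ⟦W ⁻¹' {true} | MeasurableSpace.comap X inferInstance⟧) ω < 1 - ε)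
    {B : Set (Fin p → ℝ)} (hB : MeasurableSet B) (w : Bool) :
    ε * μ.real (X ⁻¹' B) ≤ μ.real (X ⁻¹' B ∩ W ⁻¹' {w}) := by
  have hA : MeasurableSet (W ⁻¹' {true}) := hW (measurableSet_singleton true)
  have h1 := setIntegral_condProb (μ := μ) hX hA hB
  have hi : IntegrableOn (μ⟦W ⁻¹' {true} | MeasurableSpace.comap X inferInstance⟧) (X ⁻¹' B) μ :=
    integrable_condExp.integrableOn
  have ht : ε * μ.real (X ⁻¹' B) ≤ μ.real (X ⁻¹' B ∩ W ⁻¹' {true}) := by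
    rw [← h1, mul_comm, ← smul_eq_mul, ← setIntegral_const]
    refine setIntegral_mono_ae integrableOn_const hi ?_
    filter_upwards [h_overlap] with ω h using h.1.le
  cases w
  · have h2 : μ.real (X ⁻¹' B ∩ W ⁻¹' {true}) ≤ (1 - ε) * μ.real (X ⁻¹' B) := by
      rw [← h1, mul_comm, ← smul_eq_mul, ← setIntegral_const]
      refine setIntegral_mono_ae hi integrableOn_const ?_
      filter_upwards [h_overlap] with ω h using h.2.le
    have h3 := measureReal_inter_add_sdiff (μ := μ) (s := X ⁻¹' B) hA
    have h4 : X ⁻¹' B \ W ⁻¹' {true} = X ⁻¹' B ∩ W ⁻¹' {false} := by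
      ext ω; simp
    rw [h4] at h3
    linarith
  · exact ht

/-- The observed data have boxes of comparable mass. -/
theorem exists_boxMass (hX : Measurable X) (hW : Measurable W)
    (hO : Measurable fun ω => ((X ω, W ω, Y (W ω) ω) : Obs p d))
    (h_density : HasBoundedDensityOnCube (μ.map X))
    (h_overlap : ∃ ε : ℝ, 0 < ε ∧ ∀ᵐ ω ∂μ,
      ε < (μ⟦W ⁻¹' {true} | MeasurableSpace.comap X inferInstance⟧) ω ∧
      (μ⟦W ⁻¹' {true} | MeasurableSpace.comap X inferInstance⟧) ω < 1 - ε) :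
    ∃ a b : ℝ, 0 < a ∧ 0 < b ∧ a ≤ b ∧
      BoxMass (μ.map fun ω => ((X ω, W ω, Y (W ω) ω) : Obs p d)) a b ∧
      (∀ B : Set (Fin p → ℝ), MeasurableSet B →
        (μ.map fun ω => ((X ω, W ω, Y (W ω) ω) : Obs p d)).real {o | cov o ∈ B} ≤
          b * volume.real (B ∩ Set.Icc 0 1)) ∧
      ∀ w, 0 < (μ.map fun ω => ((X ω, W ω, Y (W ω) ω) : Obs p d)).real
        (TreeProcedure.groupSet w) := by
  obtain ⟨a, b, ha, hab, hcube, hm⟩ := h_density.measureReal_bounds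
  obtain ⟨ε, hε, hov⟩ := h_overlap
  set O := fun ω => ((X ω, W ω, Y (W ω) ω) : Obs p d)
  have hε1 : ε ≤ 1 := by
    obtain ⟨ω, h⟩ := hov.exists
    linarith
  have hcov : ∀ B : Set (Fin p → ℝ), MeasurableSet B →
      (μ.map O).real {o | cov o ∈ B} = (μ.map X).real B := fun B hB => by
    have hm' : MeasurableSet {o : Obs p d | cov o ∈ B} := measurable_cov hB
    rw [map_measureReal_apply hO hm', map_measureReal_apply hX hB]
    rfl
  have hgr : ∀ (B : Set (Fin p → ℝ)) w, MeasurableSet B →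
      ε * (μ.map X).real B ≤ (μ.map O).real ({o | cov o ∈ B} ∩ {o | trt o = w}) := fun B w hB => by
    have hm : MeasurableSet ({o : Obs p d | cov o ∈ B} ∩ {o | trt o = w}) :=
      (measurable_cov hB).inter (measurable_trt (measurableSet_singleton w))
    rw [map_measureReal_apply hO hm, map_measureReal_apply hX hB]
    exact mul_le_measureReal_inter_trt hX hW hov hB w
  have hvol : ∀ B : Set (Fin p → ℝ), MeasurableSet B →
      (μ.map O).real {o | cov o ∈ B} ≤ b * volume.real (B ∩ Set.Icc 0 1) := fun B hB => by
    rw [hcov B hB]; exact (hm B hB).2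
  have : IsProbabilityMeasure (μ.map X) := Measure.isProbabilityMeasure_map hX.aemeasurable
  refine ⟨ε * a, b, by positivity, by linarith, by nlinarith, ⟨?_, ?_, ?_⟩, hvol, fun w => ?_⟩
  · rw [ae_map_iff hO.aemeasurable (measurable_cov measurableSet_Icc)]
    exact (ae_map_iff hX.aemeasurable measurableSet_Icc).1 hcube
  · intro lo hi h0 h1 h2
    refine (hvol (Set.Icc lo hi) measurableSet_Icc).trans (le_of_eq ?_)
    rw [Set.inter_eq_left.2 (Set.Icc_subset_Icc h0 h2), measureReal_def,
      Real.volume_Icc_pi_toReal h1]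
    rfl
  · intro lo hi h0 h1 h2 w
    set B := Set.univ.pi fun j => Set.Ioo (lo j) (hi j) with hB
    have hBm : MeasurableSet B := MeasurableSet.univ_pi fun j => measurableSet_Ioo
    have hsub : B ⊆ Set.Icc 0 1 := fun t ht =>
      ⟨fun j => (h0 j).trans (ht j trivial).1.le, fun j => (ht j trivial).2.le.trans (h2 j)⟩
    have h3 := (hm B hBm).1
    rw [Set.inter_eq_left.2 hsub, measureReal_def, Real.volume_pi_Ioo_toReal h1] at h3
    have h4 : openBox d lo hi w = {o | cov o ∈ B} ∩ {o | trt o = w} := by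
      ext o; simp [openBox, hB]
    rw [h4, mul_assoc]
    exact (mul_le_mul_of_nonneg_left h3 hε.le).trans (hgr B w hBm)
  · have h3 := hgr Set.univ w MeasurableSet.univ
    have h4 : {o : Obs p d | cov o ∈ (Set.univ : Set (Fin p → ℝ))} ∩ {o | trt o = w} =
        TreeProcedure.groupSet w := by ext o; simp [TreeProcedure.groupSet]
    rw [h4, probReal_univ, mul_one] at h3
    linarith

/-- Under unconfoundedness the potential outcome laws disintegrate the law of the observed data. -/
theorem disintegrates_observed (hX : Measurable X) (hW : Measurable W) (hY : ∀ w, Measurable (Y w))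
    (hO : Measurable fun ω => ((X ω, W ω, Y (W ω) ω) : Obs p d))
    (h_unconf : CondIndepGiven μ (fun ω => (Y false ω, Y true ω)) W X)
    (Q : Bool → Kernel (Fin p → ℝ) (Fin d → ℝ)) [∀ w, IsMarkovKernel (Q w)]
    (hQ : ∀ w, μ.map (fun ω => (X ω, Y w ω)) = (μ.map X).compProd (Q w)) :
    Disintegrates (μ.map fun ω => ((X ω, W ω, Y (W ω) ω) : Obs p d)) Q := by
  set O := fun ω => ((X ω, W ω, Y (W ω) ω) : Obs p d)
  have : IsProbabilityMeasure (μ.map O) := Measure.isProbabilityMeasure_map hO.aemeasurable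
  have hout : Measurable fun o : Obs p d => ((cov o, trt o), out o) :=
    measurable_cov_trt.prodMk measurable_out
  have : IsProbabilityMeasure ((μ.map O).map fun o => ((cov o, trt o), out o)) :=
    Measure.isProbabilityMeasure_map hout.aemeasurable
  have : IsProbabilityMeasure ((μ.map O).map fun o => (cov o, trt o)) :=
    Measure.isProbabilityMeasure_map measurable_cov_trt.aemeasurable
  have hsingle : ∀ {A : Set (Fin p → ℝ)} {B : Set (Fin d → ℝ)} (w : Bool), MeasurableSet A →
      MeasurableSet B →
      ((μ.map O).map fun o => ((cov o, trt o), out o)) ((A ×ˢ {w}) ×ˢ B) =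
      (((μ.map O).map fun o => (cov o, trt o)) ⊗ₘ outcomeKernel Q) ((A ×ˢ {w}) ×ˢ B) := by
    intro A B w hA hB
    have hAw : MeasurableSet (A ×ˢ ({w} : Set Bool)) := hA.prod (measurableSet_singleton w)
    have hYB : MeasurableSet (Y w ⁻¹' B) := hY w hB
    have hWw : MeasurableSet (W ⁻¹' {w}) := hW (measurableSet_singleton w)
    have hXA : MeasurableSet (X ⁻¹' A) := hX hA
    have hker : Measurable fun t => (Q w t) B := (Q w).measurable_coe hB
    have hlhs : ((μ.map O).map fun o => ((cov o, trt o), out o)) ((A ×ˢ {w}) ×ˢ B) =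
        μ (X ⁻¹' A ∩ (Y w ⁻¹' B ∩ W ⁻¹' {w})) := by
      rw [Measure.map_map hout hO, Measure.map_apply (hout.comp hO) (hAw.prod hB)]
      congr 1
      ext ω
      simp only [Set.mem_preimage, Set.mem_prod, Function.comp, Set.mem_singleton_iff, cov, trt,
        out, Set.mem_inter_iff, O]
      constructor
      · rintro ⟨⟨h1, h2⟩, h3⟩
        rw [h2] at h3
        exact ⟨h1, h3, h2⟩
      · rintro ⟨h1, h3, h2⟩
        rw [h2]
        exact ⟨⟨h1, rfl⟩, h3⟩
    have hrhs : (((μ.map O).map fun o => (cov o, trt o)) ⊗ₘ outcomeKernel Q) ((A ×ˢ {w}) ×ˢ B) =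
        ∫⁻ ω in X ⁻¹' A ∩ W ⁻¹' {w}, (Q w (X ω)) B ∂μ := by
      rw [Measure.compProd_apply_prod hAw hB, Measure.map_map measurable_cov_trt hO,
        setLIntegral_map hAw ((outcomeKernel Q).measurable_coe hB) (measurable_cov_trt.comp hO)]
      refine setLIntegral_congr_fun (hXA.inter hWw) fun ω hω => ?_
      have : W ω = w := hω.2
      change (Q (W ω) (X ω)) B = _
      rw [this]
    rw [hlhs, hrhs]
    have hreal : ∀ ω, (Q w (X ω)) B = ENNReal.ofReal ((Q w (X ω)).real B) := fun ω => by
      rw [ofReal_measureReal]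
    have hkr : Measurable fun ω => (Q w (X ω)).real B := (hker.comp hX).ennreal_toReal
    have hki : Integrable (fun ω => (Q w (X ω)).real B) μ :=
      Integrable.of_bound hkr.aestronglyMeasurable 1 (Eventually.of_forall fun ω => by
        rw [Real.norm_of_nonneg measureReal_nonneg]; exact measureReal_le_one)
    simp only [hreal]
    rw [← ofReal_integral_eq_lintegral_ofReal hki.integrableOn
      (Eventually.of_forall fun ω => measureReal_nonneg), ← ofReal_measureReal]
    congr 1
    have hcY : (fun ω => (Q w (X ω)).real B) =ᵐ[μ]
        μ⟦Y w ⁻¹' B | MeasurableSpace.comap X inferInstance⟧ := by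
      have h1 := condDistrib_ae_eq_condExp (μ := μ) hX (hY w) hB
      have h2 := ae_of_ae_map hX.aemeasurable
        (condDistrib_ae_eq_of_measure_eq_compProd X (hY w).aemeasurable (hQ w))
      refine EventuallyEq.trans ?_ h1
      filter_upwards [h2] with ω h
      rw [h]
    -- The event about the pair of potential outcomes is chosen to involve only the outcome of group
    -- w.
    have hind := h_unconf {q | (if w = true then q.2 else q.1) ∈ B} {w} (by
        cases w
        · exact measurable_fst hB
        · exact measurable_snd hB) (measurableSet_singleton w)
    have hpre : (fun ω => (Y false ω, Y true ω)) ⁻¹' {q | (if w = true then q.2 else q.1) ∈ B} =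
        Y w ⁻¹' B := by
      cases w <;> rfl
    rw [hpre] at hind
    have hWi : Integrable ((W ⁻¹' {w}).indicator fun _ => (1 : ℝ)) μ :=
      (integrable_const _).indicator hWw
    -- Unconfoundedness factorises the joint conditional probability as Q_w(X)(B) times that of W =
    -- w; pulling the first factor back inside leaves the integral of Q_w(X)(B) over X ∈ A and W =
    -- w.
    have hpull : μ[(fun ω => (Q w (X ω)).real B) * (W ⁻¹' {w}).indicator (fun _ => (1 : ℝ)) |
          MeasurableSpace.comap X inferInstance]
        =ᵐ[μ] (fun ω => (Q w (X ω)).real B) *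
          μ⟦W ⁻¹' {w} | MeasurableSpace.comap X inferInstance⟧ := by
      refine condExp_mul_of_stronglyMeasurable_left ?_ ?_ hWi
      · exact hker.ennreal_toReal.stronglyMeasurable.comp_measurable (comap_measurable X)
      · refine hki.mul_bdd (c := 1) hWi.aestronglyMeasurable (Eventually.of_forall fun ω => ?_)
        by_cases h : ω ∈ W ⁻¹' {w} <;> simp [h]
    have hmul : (fun ω => (Q w (X ω)).real B) * (W ⁻¹' {w}).indicator (fun _ => (1 : ℝ)) =
        (W ⁻¹' {w}).indicator fun ω => (Q w (X ω)).real B := by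
      ext ω; by_cases h : ω ∈ W ⁻¹' {w} <;> simp [h]
    rw [hmul] at hpull
    calc μ.real (X ⁻¹' A ∩ (Y w ⁻¹' B ∩ W ⁻¹' {w}))
        = ∫ ω in X ⁻¹' A, (μ⟦Y w ⁻¹' B ∩ W ⁻¹' {w} | MeasurableSpace.comap X inferInstance⟧) ω ∂μ :=
          (setIntegral_condProb hX (hYB.inter hWw) hA).symm
      _ = ∫ ω in X ⁻¹' A, (μ[(W ⁻¹' {w}).indicator (fun ω => (Q w (X ω)).real B) |
            MeasurableSpace.comap X inferInstance]) ω ∂μ := by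
          refine setIntegral_congr_ae hXA ?_
          filter_upwards [hind, hcY, hpull] with ω h1 h2 h3 _
          rw [h1, h3, Pi.mul_apply, ← h2]
      _ = ∫ ω in X ⁻¹' A ∩ W ⁻¹' {w}, (Q w (X ω)).real B ∂μ := by
          rw [setIntegral_condExp hX.comap_le (hki.indicator hWw) ⟨A, hA, rfl⟩,
            setIntegral_indicator hWw]
  unfold Disintegrates
  -- Measurable boxes determine the measure, and a set of treatment values is a finite union of
  -- singletons, so the case of a single group suffices.
  refine Measure.ext_prod₃_iff'.2 fun {A V B} hA _ hB => ?_
  have hsplit : ∀ m : Measure (((Fin p → ℝ) × Bool) × (Fin d → ℝ)), m ((A ×ˢ V) ×ˢ B) =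
      ∑ w ∈ (Set.toFinite V).toFinset, m ((A ×ˢ {w}) ×ˢ B) := by
    intro m
    rw [← measure_biUnion_finset]
    · congr 1
      ext q
      simp only [Set.mem_prod, Set.mem_iUnion, Set.mem_singleton_iff, Set.Finite.mem_toFinset]
      constructor
      · rintro ⟨⟨h1, h2⟩, h3⟩; exact ⟨_, h2, ⟨h1, rfl⟩, h3⟩
      · rintro ⟨w, h2, ⟨h1, rfl⟩, h3⟩; exact ⟨⟨h1, h2⟩, h3⟩
    · intro w _ w' _ hne
      refine Set.disjoint_left.2 fun q h1 h2 => hne ?_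
      exact (h1.1.2 : q.1.2 = w).symm.trans h2.1.2
    · exact fun w _ => (hA.prod (measurableSet_singleton w)).prod hB
  rw [hsplit, hsplit]
  exact Finset.sum_congr rfl fun w _ => hsingle w hA hB

end Law

/-! ### The Hájek projection as a coordinate mean -/

section Projection

set_option linter.unusedSectionVars false

variable {s : ℕ} {Z Ω : Type*} [MeasurableSpace Z] [MeasurableSpace Ω] {μ : Measure Ω}
  [IsProbabilityMeasure μ] {ρ : Measure Z} [IsProbabilityMeasure ρ] {ζ : Ω → Fin s → Z}
  {F : Type*} [NormedAddCommGroup F] [InnerProductSpace ℝ F] [CompleteSpace F]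
  {G : (Fin s → Z) → F} {C : ℝ}

theorem map_coord (hζ : Measurable ζ) (hlaw : μ.map ζ = Measure.pi fun _ => ρ) (i : Fin s) :
    μ.map (fun ω => ζ ω i) = ρ := by
  have h := (measurePreserving_eval (fun _ : Fin s => ρ) i).map_eq
  rw [← hlaw, Measure.map_map (measurable_pi_apply i) hζ] at h
  exact h

theorem setIntegral_coord (hζ : Measurable ζ) (hlaw : μ.map ζ = Measure.pi fun _ => ρ) (i : Fin s)
    {g : Z → F} (hg : StronglyMeasurable g) {B : Set Z} (hB : MeasurableSet B) :
    ∫ ω in (fun ω => ζ ω i) ⁻¹' B, g (ζ ω i) ∂μ = ∫ a in B, g a ∂ρ := by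
  have h := setIntegral_map (μ := μ) (g := fun ω => ζ ω i) hB hg.aestronglyMeasurable
    ((measurable_pi_apply i).comp hζ).aemeasurable
  rw [map_coord hζ hlaw i] at h
  exact h.symm

theorem integral_coord (hζ : Measurable ζ) (hlaw : μ.map ζ = Measure.pi fun _ => ρ) (i : Fin s)
    {g : Z → F} (hg : StronglyMeasurable g) : ∫ ω, g (ζ ω i) ∂μ = ∫ a, g a ∂ρ := by
  have h := setIntegral_coord hζ hlaw i hg MeasurableSet.univ
  simpa using h

/-- The conditional expectation given one observation of an independent sample. -/
theorem condExp_coord (hζ : Measurable ζ) (hlaw : μ.map ζ = Measure.pi fun _ => ρ)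
    (hG : StronglyMeasurable G) (hC : ∀ z, ‖G z‖ ≤ C) (i : Fin s) :
    μ[fun ω => G (ζ ω) | MeasurableSpace.comap (fun ω => ζ ω i) inferInstance] =ᵐ[μ]
      fun ω => coordMean ρ i G (ζ ω i) := by
  have hζi : Measurable fun ω => ζ ω i := (measurable_pi_apply i).comp hζ
  have hcm : StronglyMeasurable (coordMean ρ i G) := stronglyMeasurable_coordMean hG i
  have hcb : ∀ a, ‖coordMean ρ i G a‖ ≤ C := norm_coordMean_le hC i
  symm
  refine ae_eq_condExp_of_forall_setIntegral_eq hζi.comap_le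
    (integrable_of_bounded (hG.comp_measurable hζ) fun _ => hC _)
    (fun S _ _ => (integrable_of_bounded (hcm.comp_measurable hζi) fun _ => hcb _).integrableOn)
    ?_ (hcm.comp_measurable (comap_measurable fun ω => ζ ω i)).aestronglyMeasurable
  rintro S ⟨B, hB, rfl⟩ -
  have hB' : MeasurableSet {z : Fin s → Z | z i ∈ B} := measurable_pi_apply i hB
  have h2 : ∫ ω in (fun ω => ζ ω i) ⁻¹' B, G (ζ ω) ∂μ =
      ∫ z in {z : Fin s → Z | z i ∈ B}, G z ∂(Measure.pi fun _ => ρ) := by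
    rw [← hlaw, setIntegral_map hB' hG.aestronglyMeasurable hζ.aemeasurable]
    rfl
  rw [setIntegral_coord hζ hlaw i hcm hB, h2, ← integral_indicator hB', ← integral_indicator hB,
    integral_eq_integral_update ((integrable_of_bounded hG hC).indicator hB') i]
  refine integral_congr_ae (Eventually.of_forall fun a => ?_)
  unfold coordMean
  by_cases h : a ∈ B
  · have h3 : ∀ z : Fin s → Z, Function.update z i a ∈ {z : Fin s → Z | z i ∈ B} := fun z => by
      simpa using h
    simp only [Set.indicator_of_mem h, Set.indicator_of_mem (h3 _)]
  · have h3 : ∀ z : Fin s → Z, Function.update z i a ∉ {z : Fin s → Z | z i ∈ B} := fun z => by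
      simpa using h
    simp only [Set.indicator_of_notMem h, Set.indicator_of_notMem (h3 _), integral_zero]

theorem hajek_ae_eq (hζ : Measurable ζ) (hlaw : μ.map ζ = Measure.pi fun _ => ρ)
    (hG : StronglyMeasurable G) (hC : ∀ z, ‖G z‖ ≤ C) (i : Fin s) :
    hajek μ (fun ω => G (ζ ω)) (fun ω => ζ ω i) =ᵐ[μ]
      fun ω => coordMean ρ i G (ζ ω i) - ∫ z, G z ∂(Measure.pi fun _ => ρ) := by
  filter_upwards [condExp_coord hζ hlaw hG hC i] with ω h
  have h2 : ∫ z, G z ∂(Measure.pi fun _ => ρ) = ∫ ω, G (ζ ω) ∂μ := by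
    rw [← hlaw, integral_map hζ.aemeasurable hG.aestronglyMeasurable]
  rw [hajek, h2]
  exact congrArg (· - _) h

theorem integral_hajek (hζ : Measurable ζ) (i : Fin s) :
    ∫ ω, hajek μ (fun ω => G (ζ ω)) (fun ω => ζ ω i) ω ∂μ = 0 := by
  have hζi : Measurable fun ω => ζ ω i := (measurable_pi_apply i).comp hζ
  unfold hajek
  rw [integral_sub integrable_condExp (integrable_const _), integral_condExp hζi.comap_le]
  simp

theorem hilbertVar_hajek (hζ : Measurable ζ) (hlaw : μ.map ζ = Measure.pi fun _ => ρ)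
    (hG : StronglyMeasurable G) (hC : ∀ z, ‖G z‖ ≤ C) (i : Fin s) :
    hilbertVar μ (hajek μ (fun ω => G (ζ ω)) (fun ω => ζ ω i)) =
      ∫ a, ‖coordMean ρ i G a - ∫ z, G z ∂(Measure.pi fun _ => ρ)‖ ^ 2 ∂ρ := by
  have hζi : Measurable fun ω => ζ ω i := (measurable_pi_apply i).comp hζ
  have hcm : StronglyMeasurable (coordMean ρ i G) := stronglyMeasurable_coordMean hG i
  unfold hilbertVar
  rw [integral_hajek hζ i]
  have hm : StronglyMeasurable fun a => ‖coordMean ρ i G a -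
      ∫ z, G z ∂(Measure.pi fun _ => ρ)‖ ^ 2 := (hcm.sub stronglyMeasurable_const).norm.pow 2
  rw [← integral_coord hζ hlaw i hm]
  refine integral_congr_ae ?_
  filter_upwards [hajek_ae_eq hζ hlaw hG hC i] with ω h
  rw [h, sub_zero]

/-- The inner product with f commutes with the projection, so this is the scalar case of the
variance formula applied to ⟨f, G⟩. -/
theorem variance_inner_hajek (hζ : Measurable ζ) (hlaw : μ.map ζ = Measure.pi fun _ => ρ)
    (hG : StronglyMeasurable G) (hC : ∀ z, ‖G z‖ ≤ C) (i : Fin s) (f : F) :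
    Var[fun ω => inner ℝ (hajek μ (fun ω => G (ζ ω)) (fun ω => ζ ω i) ω) f; μ] =
      ∫ a, ‖coordMean ρ i (fun z => inner ℝ f (G z)) a -
        ∫ z, inner ℝ f (G z) ∂(Measure.pi fun _ => ρ)‖ ^ 2 ∂ρ := by
  have hGf : StronglyMeasurable fun z => inner ℝ f (G z) := stronglyMeasurable_const.inner hG
  have hCf : ∀ z, ‖inner ℝ f (G z)‖ ≤ ‖f‖ * C := fun z =>
    (norm_inner_le_norm _ _).trans (mul_le_mul_of_nonneg_left (hC z) (norm_nonneg _))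
  rw [← hilbertVar_hajek hζ hlaw hGf hCf i]
  have hae : (fun ω => inner ℝ (hajek μ (fun ω => G (ζ ω)) (fun ω => ζ ω i) ω) f) =ᵐ[μ]
      hajek μ (fun ω => inner ℝ f (G (ζ ω))) (fun ω => ζ ω i) := by
    filter_upwards [hajek_ae_eq hζ hlaw hG hC i, hajek_ae_eq hζ hlaw hGf hCf i] with ω h1 h2
    rw [h1, h2, real_inner_comm, inner_sub_right, coordMean, coordMean,
      integral_inner (integrable_of_bounded hG hC), integral_inner]
    exact integrable_of_bounded (hG.comp_measurable ((measurable_update_prod i).comp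
      (measurable_const.prodMk measurable_id))) fun _ => hC _
  rw [variance_congr hae, variance_eq_integral]
  · unfold hilbertVar
    simp only [Real.norm_eq_abs, sq_abs]
  · exact (integrable_condExp.aestronglyMeasurable.sub
      aestronglyMeasurable_const).aemeasurable

end Projection

/-! ### The group variance in terms of the mean weight -/

section GroupVar

set_option linter.unusedSectionVars false

open TreeProcedure

variable {p d s : ℕ} {Ω 𝓔 : Type*} [MeasurableSpace Ω] [MeasurableSpace 𝓔] {μ : Measure Ω}
  [IsProbabilityMeasure μ] {ν : Measure 𝓔} [IsProbabilityMeasure ν]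
  {ρ : Measure (Obs p d)} [IsProbabilityMeasure ρ] {ζ : Ω → Fin s → Obs p d}
  {P : TreeProcedure p d s 𝓔} {x : Fin p → ℝ}

theorem coordMean_meanGroupWeight (w : Bool) (i : Fin s) (o : Obs p d) :
    coordMean ρ i (fun z => P.meanGroupWeight ν x z w i) o =
      if trt o = w then P.condWeight ν x ρ i o else 0 := by
  unfold coordMean condWeight
  simp only [meanGroupWeight_eq_ite, Function.update_self]
  split_ifs <;> simp

/-- Condition on the whole observation first. By honesty the result depends on covariates and
treatment only, so conditioning further down on those changes nothing. -/
theorem condExp_meanGroupWeight (hζ : Measurable ζ) (hlaw : μ.map ζ = Measure.pi fun _ => ρ)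
    (hP : P.IsHonest) (w : Bool) (i : Fin s) :
    μ[fun ω => P.meanGroupWeight ν x (ζ ω) w i |
        MeasurableSpace.comap (fun ω => (cov (ζ ω i), trt (ζ ω i))) inferInstance] =ᵐ[μ]
      fun ω => if trt (ζ ω i) = w then P.condWeight ν x ρ i (ζ ω i) else 0 := by
  have hζi : Measurable fun ω => ζ ω i := (measurable_pi_apply i).comp hζ
  have hct : Measurable fun ω => (cov (ζ ω i), trt (ζ ω i)) := measurable_cov_trt.comp hζi
  have hle : MeasurableSpace.comap (fun ω => (cov (ζ ω i), trt (ζ ω i))) inferInstance ≤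
      MeasurableSpace.comap (fun ω => ζ ω i) inferInstance := by
    rintro S ⟨B, hB, rfl⟩
    exact ⟨_, measurable_cov_trt hB, rfl⟩
  set h : Obs p d → ℝ := fun o => if trt o = w then P.condWeight ν x ρ i o else 0 with hh
  have hhm : StronglyMeasurable h := StronglyMeasurable.ite
    (measurable_trt (measurableSet_singleton w)) (stronglyMeasurable_condWeight i)
    stronglyMeasurable_const
  have hhb : ∀ o, ‖h o‖ ≤ 1 := fun o => by
    simp only [hh]
    split_ifs
    · exact abs_condWeight_le_one i o
    · simp
  have h1 := condExp_coord hζ hlaw (P.measurable_meanGroupWeight ν x w i).stronglyMeasurable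
    (C := 1) (fun z => by
      rw [meanGroupWeight_eq_ite]
      split_ifs
      · exact P.abs_meanWeight_le ν x z i
      · simp) i
  simp only [coordMean_meanGroupWeight] at h1
  refine (condExp_condExp_of_le hle hζi.comap_le).symm.trans ((condExp_congr_ae h1).trans ?_)
  have h2 : (fun ω => h (ζ ω i)) = (fun q : (Fin p → ℝ) × Bool => h (q.1, q.2, 0)) ∘
      fun ω => (cov (ζ ω i), trt (ζ ω i)) := by
    -- The outcome 0 is a dummy value: the mean weight ignores the outcome.
    funext ω
    simp only [hh, Function.comp]
    rw [condWeight_congr hP i (o := ζ ω i) (o' := (cov (ζ ω i), trt (ζ ω i), 0)) rfl rfl]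
    rfl
  have h3 : StronglyMeasurable fun q : (Fin p → ℝ) × Bool => h (q.1, q.2, 0) :=
    hhm.comp_measurable (measurable_fst.prodMk (measurable_snd.prodMk measurable_const))
  have h4 : StronglyMeasurable[MeasurableSpace.comap
      (fun ω => (cov (ζ ω i), trt (ζ ω i))) inferInstance] fun ω => h (ζ ω i) := by
    rw [h2]
    exact h3.comp_measurable (comap_measurable fun ω => (cov (ζ ω i), trt (ζ ω i)))
  exact EventuallyEq.of_eq (condExp_of_stronglyMeasurable hct.comap_le h4
    (integrable_of_bounded (hhm.comp_measurable hζi) fun _ => hhb _))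

/-- Under the conditional law given the group, integrals are set integrals divided by the group's
mass; `weightVar` carries that mass as a factor, which the outer expectation over W supplies again.
-/
theorem groupVar_meanGroupWeight (hζ : Measurable ζ) (hlaw : μ.map ζ = Measure.pi fun _ => ρ)
    (hP : P.IsHonest) (i : Fin s) (w : Bool) (hq : 0 < ρ.real (groupSet w)) :
    groupVar μ (fun ω => P.meanGroupWeight ν x (ζ ω) w i) (fun ω => cov (ζ ω i))
      (fun ω => trt (ζ ω i)) w = P.weightVar ν x ρ i w / ρ.real (groupSet w) := by
  have hζi : Measurable fun ω => ζ ω i := (measurable_pi_apply i).comp hζ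
  set A : Set Ω := (fun ω => trt (ζ ω i)) ⁻¹' {w}
  have hA : MeasurableSet A := (measurable_trt.comp hζi) (measurableSet_singleton w)
  have hAq : μ.real A = ρ.real (groupSet w) := by
    have e := map_measureReal_apply (μ := μ) hζi (measurableSet_groupSet w)
    rw [map_coord hζ hlaw i] at e
    exact e.symm
  have hA0 : μ A ≠ 0 := fun h => by
    rw [← hAq, measureReal_def, h] at hq; simp at hq
  have : IsProbabilityMeasure (μ[|A]) := cond_isProbabilityMeasure hA0
  set h : Obs p d → ℝ := fun o => if trt o = w then P.condWeight ν x ρ i o else 0 with hh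
  have hhm : StronglyMeasurable h := StronglyMeasurable.ite
    (measurable_trt (measurableSet_singleton w)) (stronglyMeasurable_condWeight i)
    stronglyMeasurable_const
  have hhb : ∀ o, ‖h o‖ ≤ 1 := fun o => by
    simp only [hh]
    split_ifs
    · exact abs_condWeight_le_one i o
    · simp
  have hcond : ∀ {g : Obs p d → ℝ}, StronglyMeasurable g → ∫ ω, g (ζ ω i) ∂(μ[|A]) =
      (∫ o in groupSet w, g o ∂ρ) / ρ.real (groupSet w) := fun {g} hg => by
    rw [ProbabilityTheory.cond, integral_smul_measure, ENNReal.toReal_inv, ← measureReal_def, hAq,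
      smul_eq_mul, inv_mul_eq_div, ← setIntegral_coord hζ hlaw i hg (measurableSet_groupSet w)]
    rfl
  have hset : ∀ k : ℕ, ∫ o in groupSet w, h o ^ k ∂ρ =
      ∫ o in groupSet w, P.condWeight ν x ρ i o ^ k ∂ρ := fun k =>
    setIntegral_congr_fun (measurableSet_groupSet w) fun o ho => by
      have : trt o = w := ho
      simp [hh, this]
  unfold groupVar
  have hvar : Var[fun ω => h (ζ ω i); μ[|A]] =
      ∫ ω, h (ζ ω i) ^ 2 ∂(μ[|A]) - (∫ ω, h (ζ ω i) ∂(μ[|A])) ^ 2 :=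
    variance_eq_sub (MemLp.of_bound (hhm.comp_measurable hζi).aestronglyMeasurable 1
      (Eventually.of_forall fun ω => hhb _))
  rw [variance_congr (cond_absolutelyContinuous.ae_eq (condExp_meanGroupWeight hζ hlaw hP w i))]
  refine hvar.trans ?_
  have e1 := hcond (hhm.pow 2)
  have e2 := hcond hhm
  have s1 := hset 2
  have s2 := hset 1
  simp only [pow_one] at s2
  simp only [Pi.pow_apply] at e1
  rw [e1, e2, s1, s2, weightVar, sub_div, div_pow, div_div, sq (ρ.real _)]

theorem integral_mul_trt (hζ : Measurable ζ) (hlaw : μ.map ζ = Measure.pi fun _ => ρ) (i : Fin s)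
    (v : Bool → ℝ) :
    ∫ ω, v (trt (ζ ω i)) ∂μ = ∑ w, v w * ρ.real (groupSet w) := by
  have hζi : Measurable fun ω => ζ ω i := (measurable_pi_apply i).comp hζ
  have hv : Measurable fun o : Obs p d => v (trt o) :=
    (measurable_of_countable v).comp measurable_trt
  have hi : Integrable (fun o : Obs p d => v (trt o)) ρ :=
    integrable_of_bounded (C := |v true| + |v false|) hv.stronglyMeasurable fun o => by
      rw [Real.norm_eq_abs]
      cases trt o
      · have := abs_nonneg (v true); linarith
      · have := abs_nonneg (v false); linarith
  have h1 : ∫ ω, v (trt (ζ ω i)) ∂μ = ∫ o, v (trt o) ∂ρ :=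
    integral_coord hζ hlaw i hv.stronglyMeasurable
  have h2 : ∀ w, ∫ o in groupSet w, v (trt o) ∂ρ = v w * ρ.real (groupSet w) := fun w => by
    rw [setIntegral_congr_fun (g := fun _ => v w) (measurableSet_groupSet w) fun o ho => by
      have : trt o = w := ho
      simp only [this], setIntegral_const, smul_eq_mul, mul_comm]
  rw [h1, integral_eq_add_groups hi, h2, h2, Fintype.sum_bool]

end GroupVar

/-! ### Limit of the ratio -/

section Ratio

/-- The limit of a ratio of sums of two terms, up to negligible errors. -/
theorem tendsto_div_limitRatio {A B : ℕ → ℝ} {v : ℕ → Bool → ℝ} {a b q : Bool → ℝ}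
    (hq : ∀ w, 0 < q w) (hb : ∀ w, 0 < b w) (hv : ∀ w, ∀ᶠ n in atTop, 0 < v n w)
    (hA : ∀ w, Tendsto (fun n => (A n - ∑ w, v n w * q w * a w) / v n w) atTop (𝓝 0))
    (hB : ∀ w, Tendsto (fun n => (B n - ∑ w, v n w * q w * b w) / v n w) atTop (𝓝 0))
    {c : ℝ≥0∞} (hc : Tendsto (fun n => ENNReal.ofReal (v n true) / ENNReal.ofReal (v n false))
      atTop (𝓝 c)) :
    Tendsto (fun n => A n / B n) atTop (𝓝 (limitRatio c a b q)) := by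
  unfold limitRatio
  split_ifs with h
  -- For c = ∞ numerator and denominator are divided by the dominant v n true, so the control terms
  -- vanish in the limit.
  · have hr : Tendsto (fun n => v n false / v n true) atTop (𝓝 0) := by
      have h1 := tendsto_inv_iff.2 hc
      rw [h, ENNReal.inv_top] at h1
      have h2 := (ENNReal.tendsto_toReal ENNReal.zero_ne_top).comp h1
      refine Tendsto.congr' ?_ h2
      filter_upwards [hv true, hv false] with n h3 h4
      simp only [Function.comp]
      rw [← ENNReal.ofReal_div_of_pos h4, ← ENNReal.ofReal_inv_of_pos (div_pos h3 h4), inv_div,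
        ENNReal.toReal_ofReal (div_pos h4 h3).le]
    have h5 : Tendsto (fun n => (q true * a true + v n false / v n true * (q false * a false) +
        (A n - ∑ w, v n w * q w * a w) / v n true) /
        (q true * b true + v n false / v n true * (q false * b false) +
        (B n - ∑ w, v n w * q w * b w) / v n true)) atTop
        (𝓝 ((q true * a true + 0 * (q false * a false) + 0) /
          (q true * b true + 0 * (q false * b false) + 0))) := by
      refine Tendsto.div ?_ ?_ ?_
      · exact (tendsto_const_nhds.add (hr.mul_const _)).add (hA true)
      · exact (tendsto_const_nhds.add (hr.mul_const _)).add (hB true)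
      · have := mul_pos (hq true) (hb true)
        simp only [zero_mul, add_zero]; exact this.ne'
    simp only [zero_mul, add_zero] at h5
    rw [mul_div_mul_left _ _ (hq true).ne'] at h5
    refine Tendsto.congr' ?_ h5
    filter_upwards [hv true] with n h3
    rw [← mul_div_mul_left (A n) (B n) (inv_ne_zero h3.ne')]
    simp only [Fintype.sum_bool]
    congr 1 <;> field_simp <;> ring
  -- For finite c they are divided by v n false, and the limit of the denominator is positive thanks
  -- to its control term even if c = 0.
  · have hr : Tendsto (fun n => v n true / v n false) atTop (𝓝 c.toReal) := by
      have h2 := (ENNReal.tendsto_toReal h).comp hc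
      refine Tendsto.congr' ?_ h2
      filter_upwards [hv true, hv false] with n h3 h4
      simp only [Function.comp]
      rw [← ENNReal.ofReal_div_of_pos h4, ENNReal.toReal_ofReal (div_pos h3 h4).le]
    have h5 : Tendsto (fun n => (v n true / v n false * a true * q true + a false * q false +
        (A n - ∑ w, v n w * q w * a w) / v n false) /
        (v n true / v n false * b true * q true + b false * q false +
        (B n - ∑ w, v n w * q w * b w) / v n false)) atTop
        (𝓝 ((c.toReal * a true * q true + a false * q false + 0) /
          (c.toReal * b true * q true + b false * q false + 0))) := by
      refine Tendsto.div ?_ ?_ ?_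
      · exact (((hr.mul_const _).mul_const _).add_const _).add (hA false)
      · exact (((hr.mul_const _).mul_const _).add_const _).add (hB false)
      · have h1 := mul_pos (hb false) (hq false)
        have h2 := mul_nonneg (mul_nonneg (ENNReal.toReal_nonneg (a := c)) (hb true).le)
          (hq true).le
        rw [add_zero]
        exact (add_pos_of_nonneg_of_pos h2 h1).ne'
    simp only [add_zero] at h5
    refine Tendsto.congr' ?_ h5
    filter_upwards [hv false] with n h3
    rw [← mul_div_mul_left (A n) (B n) (inv_ne_zero h3.ne')]
    simp only [Fintype.sum_bool]
    congr 1 <;> field_simp <;> ring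

end Ratio

/-! ### Features in the reproducing kernel Hilbert space -/

section Feature

set_option linter.unusedSectionVars false

variable {d : ℕ} {H : Type*} [NormedAddCommGroup H] [InnerProductSpace ℝ H] [CompleteSpace H]
  [RKHS ℝ H (Fin d → ℝ) ℝ]

theorem inner_feature (f : H) (y : Fin d → ℝ) : inner ℝ f (feature H y) = f y := by
  rw [feature, RKHS.inner_kerFun]
  simp

theorem inner_feature_feature (y y' : Fin d → ℝ) :
    inner ℝ (feature H y) (feature H y') = scalarKernel H y' y := by
  rw [scalarKernel, feature, feature, ← RKHS.kernel_inner]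
  simp

theorem exists_norm_feature_le (hk : ∃ C : ℝ, ∀ y y' : Fin d → ℝ, scalarKernel H y y' ≤ C) :
    ∃ C : ℝ, ∀ y : Fin d → ℝ, ‖feature H y‖ ≤ C := by
  obtain ⟨C, hC⟩ := hk
  refine ⟨√C, fun y => Real.le_sqrt_of_sq_le ?_⟩
  rw [← real_inner_self_eq_norm_sq, inner_feature_feature]
  exact hC y y

theorem tendsto_sqrt_kernel_sub {E : Type*} [TopologicalSpace E] {K : E → E → ℝ}
    (hK : Continuous fun yy : E × E => K yy.1 yy.2) (y₀ : E) :
    Tendsto (fun y => √(K y y - 2 * K y₀ y + K y₀ y₀)) (𝓝 y₀) (𝓝 0) := by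
  have e1 : Continuous fun y => K y y := hK.comp (continuous_id.prodMk continuous_id)
  have e2 : Continuous fun y => K y₀ y := hK.comp (continuous_const.prodMk continuous_id)
  have h := ((e1.sub (e2.const_mul 2)).add_const (K y₀ y₀)).sqrt.tendsto y₀
  simp only [Pi.sub_apply] at h
  rwa [show K y₀ y₀ - 2 * K y₀ y₀ + K y₀ y₀ = 0 by ring, Real.sqrt_zero] at h

/-- The squared distance of two features is K(y, y) - 2 K(y₀, y) + K(y₀, y₀), which tends to 0 as y
→ y₀. Continuity on ℝ^d gives strong measurability without any separability assumption on the
Hilbert space. -/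
theorem continuous_feature
    (hk : Continuous fun yy : (Fin d → ℝ) × (Fin d → ℝ) => scalarKernel H yy.1 yy.2) :
    Continuous (feature H : (Fin d → ℝ) → H) := by
  rw [continuous_iff_continuousAt]
  intro y₀
  rw [ContinuousAt, tendsto_iff_norm_sub_tendsto_zero]
  refine (tendsto_sqrt_kernel_sub hk y₀).congr fun y => ?_
  rw [← inner_feature_feature, ← inner_feature_feature, ← inner_feature_feature,
    real_inner_self_eq_norm_sq, real_inner_self_eq_norm_sq, ← norm_sub_sq_real,
    Real.sqrt_sq (norm_nonneg _)]

variable {p s : ℕ} {𝓔 : Type*} [MeasurableSpace 𝓔] (P : TreeProcedure p d s 𝓔) (ν : Measure 𝓔)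
  [IsProbabilityMeasure ν] (x : Fin p → ℝ)

theorem causalTree_eq_weightedSum (z : Fin s → Obs p d) :
    causalTree H P ν x z = P.weightedSum ν x (fun o => feature H (out o)) z := by
  unfold causalTree TreeProcedure.weightedSum TreeProcedure.meanWeight
  rw [integral_finsetSum _ fun i _ => (P.integrable_weight ν x z i).smul_const _]
  simp only [integral_smul_const]

theorem inner_weightedSum_feature (f : H) (z : Fin s → Obs p d) :
    inner ℝ f (P.weightedSum ν x (fun o => feature H (out o)) z) =
      P.weightedSum ν x (fun o => f (out o)) z := by
  unfold TreeProcedure.weightedSum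
  simp only [inner_sum, inner_smul_right, inner_feature, smul_eq_mul]

end Feature

/-! ### The variance expansion with a polynomial error -/

namespace TreeProcedure

set_option linter.unusedSectionVars false

variable {p d s : ℕ} {𝓔 : Type*} [MeasurableSpace 𝓔] {P : TreeProcedure p d s 𝓔}
  {ν : Measure 𝓔} [IsProbabilityMeasure ν] {x : Fin p → ℝ}
  {F : Type*} [NormedAddCommGroup F] [InnerProductSpace ℝ F] [CompleteSpace F]
  {ρ : Measure (Obs p d)} [IsProbabilityMeasure ρ]
  {Q : Bool → Kernel (Fin p → ℝ) (Fin d → ℝ)} [∀ w, IsMarkovKernel (Q w)]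
  {ξ : (Fin d → ℝ) → F} {C L : ℝ}

/-- The variance of the projection, with an error of polynomial order. -/
theorem abs_projectionVar_sub_le_rpow (hs : 0 < s) (hP : P.IsHonest) (hsymm : P.IsSymmetric ν x)
    (hρ : Disintegrates ρ Q) (hx : x ∈ Set.Icc (0 : Fin p → ℝ) 1)
    (hcube : ∀ᵐ o ∂ρ, cov o ∈ Set.Icc (0 : Fin p → ℝ) 1) (hq : ∀ w, 0 < ρ.real (groupSet w))
    (hξ : StronglyMeasurable ξ) (hC : ∀ y, ‖ξ y‖ ≤ C) (hL0 : 0 ≤ L)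
    (hL : ∀ w, ∀ t ∈ Set.Icc (0 : Fin p → ℝ) 1,
      ‖∫ y, ξ y ∂(Q w t) - ∫ y, ξ y ∂(Q w x)‖ ≤ L * ‖t - x‖)
    (hL2 : ∀ w, ∀ t ∈ Set.Icc (0 : Fin p → ℝ) 1,
      |∫ y, ‖ξ y‖ ^ 2 ∂(Q w t) - ∫ y, ‖ξ y‖ ^ 2 ∂(Q w x)| ≤ L * ‖t - x‖)
    {ε M : ℝ} (hε : 0 < ε) (hε1 : ε ≤ 1) (hM : 0 < M)
    (hη : ∫ z, (P.spread ν x z + P.defect ν x z) ∂(Measure.pi fun _ : Fin s => ρ) ≤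
      M * (s : ℝ) ^ (-(2 * ε)))
    (i : Fin s) :
    |∫ o, ‖coordMean ρ i (P.weightedSum ν x fun o => ξ (out o)) o -
        ∫ z, P.weightedSum ν x (fun o => ξ (out o)) z ∂(Measure.pi fun _ => ρ)‖ ^ 2 ∂ρ -
      ∑ w, P.weightVar ν x ρ i w * outcomeVar Q ξ w x| ≤
      (8 * C ^ 2 + 4 * (L + C) ^ 2 * M + (L + 2 * C * L) * M +
        4 * C ^ 2 * ∑ w, 1 / ρ.real (groupSet w)) * (s : ℝ) ^ (-(1 + ε)) := by
  have hs' : (0 : ℝ) < s := Nat.cast_pos.2 hs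
  have hs1 : (1 : ℝ) ≤ s := by exact_mod_cast hs
  have hC0 : 0 ≤ C := (norm_nonneg _).trans (hC 0)
  -- With η of order s^(-2ε), this δ balances the two terms δ and η/δ of the cross-term estimate.
  set δ := (s : ℝ) ^ (-ε) with hδ
  have hδ0 : 0 < δ := by positivity
  have hδ1 : δ ≤ 1 := Real.rpow_le_one_of_one_le_of_nonpos hs1 (by linarith)
  have hδ2 : (s : ℝ) ^ (-(2 * ε)) = δ * δ := by
    rw [hδ, ← Real.rpow_add hs']; congr 1; ring
  have hδ3 : (s : ℝ) ^ (-(1 + ε)) = δ / s := by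
    rw [hδ, neg_add, Real.rpow_add hs', Real.rpow_neg_one]; ring
  have hδs : 1 / (s : ℝ) ≤ δ := by
    rw [hδ, one_div, ← Real.rpow_neg_one]
    exact Real.rpow_le_rpow_of_exponent_le hs1 (by linarith)
  have hδδ : δ * δ ≤ δ := mul_le_of_le_one_right hδ0.le hδ1
  rw [hδ2] at hη
  refine (abs_projectionVar_sub_le hs hP hsymm hρ hx hcube hq hξ hC hL0 hL hL2 hδ0 hδ1 hη
    i).trans ?_
  rw [hδ3, ← Finset.sum_div]
  have e1 : M * (δ * δ) / δ = M * δ := by field_simp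
  rw [e1]
  set S := ∑ w, 1 / ρ.real (groupSet (p := p) (d := d) w)
  have hS : 0 ≤ S := Finset.sum_nonneg fun w _ => (div_pos one_pos (hq w)).le
  have e2 : 4 * C ^ 2 * (S / (s : ℝ) ^ 2) = 4 * C ^ 2 * S * (1 / s) / s := by
    field_simp
  rw [e2, ← add_div, ← mul_div_assoc _ δ (s : ℝ)]
  refine div_le_div_of_nonneg_right ?_ hs'.le
  have e3 : (L + 2 * C * L) * (M * (δ * δ)) ≤ (L + 2 * C * L) * (M * δ) :=
    mul_le_mul_of_nonneg_left (mul_le_mul_of_nonneg_left hδδ hM.le) (by positivity)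
  have e4 : 4 * C ^ 2 * S * (1 / s) ≤ 4 * C ^ 2 * S * δ :=
    mul_le_mul_of_nonneg_left hδs (by positivity)
  linarith

end TreeProcedure

/-! ### Asymptotics along the subsample sizes -/

section Limits

theorem tendsto_subsample_atTop {β : ℝ} (hβ : 0 < β) {s : ℕ → ℕ}
    (hs : ∀ n : ℕ, |(s n : ℝ) - (n : ℝ) ^ β| ≤ 1) : Tendsto s atTop atTop := by
  rw [← tendsto_natCast_atTop_iff (R := ℝ)]
  refine tendsto_atTop_mono (fun n => ?_)
    (tendsto_atTop_add_const_right _ (-1) (tendsto_rpow_natCast_atTop hβ))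
  have := (abs_le.1 (hs n)).1
  linarith

theorem isLittleO_of_abs_le_rpow {s : ℕ → ℕ} (hs : Tendsto s atTop atTop) {g : ℕ → ℝ} {D a b : ℝ}
    (hab : a < b) (h : ∀ᶠ n in atTop, |g n| ≤ D * (s n : ℝ) ^ a) :
    g =o[atTop] fun n => (s n : ℝ) ^ b := by
  refine isLittleO_iff.2 fun c hc => ?_
  filter_upwards [h, hs.eventually (eventually_rpow_le_mul_rpow hab D hc)] with n h1 h2
  rw [Real.norm_eq_abs, Real.norm_of_nonneg (by positivity)]
  exact h1.trans h2

theorem tendsto_div_of_abs_le_rpow {s : ℕ → ℕ} (hs : Tendsto s atTop atTop) 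
    {g v : ℕ → ℝ} {D a b c : ℝ} (hc : 0 < c)
    (hab : a < b) (h : ∀ᶠ n in atTop, |g n| ≤ D * (s n : ℝ) ^ a)
    (hv : ∀ᶠ n in atTop, c * (s n : ℝ) ^ b ≤ v n) :
    Tendsto (fun n => g n / v n) atTop (𝓝 0) := by
  have h1 : (fun n => (s n : ℝ) ^ b) =O[atTop] v := by
    refine IsBigO.of_bound c⁻¹ ?_
    filter_upwards [hv] with n hn
    rw [Real.norm_of_nonneg (by positivity), Real.norm_eq_abs, inv_mul_eq_div, le_div_iff₀ hc,
      mul_comm]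
    exact hn.trans (le_abs_self _)
  exact ((isLittleO_of_abs_le_rpow hs hab h).trans_isBigO h1).tendsto_div_nhds_zero

end Limits

section Limits

theorem exists_lipschitz_bound {p : ℕ} {E : Type*} [SeminormedAddCommGroup E]
    {m : Bool → (Fin p → ℝ) → E} (h : ∀ w, LipschitzOnCube (m w)) {x : Fin p → ℝ}
    (hx : x ∈ Set.Icc (0 : Fin p → ℝ) 1) :
    ∃ L : ℝ, 0 ≤ L ∧ ∀ w, ∀ t ∈ Set.Icc (0 : Fin p → ℝ) 1, ‖m w t - m w x‖ ≤ L * ‖t - x‖ := by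
  choose L hL using h
  refine ⟨L true + L false, by positivity, fun w t ht => ?_⟩
  have h1 := (hL w).dist_le_mul t ht x hx
  rw [dist_eq_norm, dist_eq_norm] at h1
  refine h1.trans (mul_le_mul_of_nonneg_right ?_ (norm_nonneg _))
  cases w
  · exact le_add_of_nonneg_left (NNReal.coe_nonneg _)
  · exact le_add_of_nonneg_right (NNReal.coe_nonneg _)

end Limits

/-! ### Conditional variances of evaluations, and the theorem -/

section SigmaSq

variable {p d : ℕ} {H : Type*} [NormedAddCommGroup H] [InnerProductSpace ℝ H] [CompleteSpace H]
  [RKHS ℝ H (Fin d → ℝ) ℝ] (Q : Bool → Kernel (Fin p → ℝ) (Fin d → ℝ))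

variable [∀ w, IsMarkovKernel (Q w)]

theorem inner_meanEmbedding (hm : StronglyMeasurable (feature H : (Fin d → ℝ) → H)) {C : ℝ}
    (hC : ∀ y : Fin d → ℝ, ‖feature H y‖ ≤ C) (f : H) (w : Bool) (t : Fin p → ℝ) :
    inner ℝ f (meanEmbedding H (Q w) t) = ∫ y, f y ∂(Q w t) := by
  rw [meanEmbedding, ← integral_inner (integrable_of_bounded hm hC)]
  simp only [inner_feature]

theorem sigmaSqOf_eq_outcomeVar (hm : StronglyMeasurable (feature H : (Fin d → ℝ) → H)) {C : ℝ}
    (hC : ∀ y : Fin d → ℝ, ‖feature H y‖ ≤ C) (f : H) (x : Fin p → ℝ) :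
    sigmaSqOf Q f x = fun w => outcomeVar Q (fun y => f y) w x := by
  funext w
  simp only [sigmaSqOf, inner_feature, inner_meanEmbedding Q hm hC, outcomeVar, Real.norm_eq_abs]

end SigmaSq

theorem mainTheorem5
    {p d : ℕ} (hp : 0 < p)
    -- the reproducing kernel Hilbert space of a bounded continuous kernel on `ℝ^d`
    {H : Type*} [NormedAddCommGroup H] [InnerProductSpace ℝ H] [CompleteSpace H]
    [RKHS ℝ H (Fin d → ℝ) ℝ]
    (hk_bdd : ∃ C : ℝ, ∀ y y' : Fin d → ℝ, scalarKernel H y y' ≤ C)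
    (hk_cont : Continuous fun yy : (Fin d → ℝ) × (Fin d → ℝ) => scalarKernel H yy.1 yy.2)
    -- i.i.d. covariates, treatments and potential outcomes
    {Ω : Type*} [MeasurableSpace Ω] (μ : Measure Ω) [IsProbabilityMeasure μ]
    (X : ℕ → Ω → Fin p → ℝ) (W : ℕ → Ω → Bool) (Y : Bool → ℕ → Ω → Fin d → ℝ)
    (hX : ∀ i, Measurable (X i)) (hW : ∀ i, Measurable (W i)) (hY : ∀ w i, Measurable (Y w i))
    (h_indep : iIndepFun (fun i ω => (X i ω, W i ω, Y false i ω, Y true i ω)) μ)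
    (h_ident : ∀ i, IdentDistrib (fun ω => (X i ω, W i ω, Y false i ω, Y true i ω))
      (fun ω => (X 0 ω, W 0 ω, Y false 0 ω, Y true 0 ω)) μ μ)
    -- density of the covariates, overlap, unconfoundedness
    (h_density : HasBoundedDensityOnCube (μ.map (X 0)))
    (h_overlap : ∃ ε : ℝ, 0 < ε ∧ ∀ᵐ ω ∂μ,
      ε < (μ⟦W 0 ⁻¹' {true} | MeasurableSpace.comap (X 0) inferInstance⟧) ω ∧
      (μ⟦W 0 ⁻¹' {true} | MeasurableSpace.comap (X 0) inferInstance⟧) ω < 1 - ε)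
    (h_unconf : CondIndepGiven μ (fun ω => (Y false 0 ω, Y true 0 ω)) (W 0) (X 0))
    -- `Q w t` is the law of `Y^w` given `X = t`
    (Q : Bool → Kernel (Fin p → ℝ) (Fin d → ℝ)) [∀ w, IsMarkovKernel (Q w)]
    (hQ : ∀ w, μ.map (fun ω => (X 0 ω, Y w 0 ω)) = (μ.map (X 0)).compProd (Q w))
    -- Lipschitz conditional moments
    (h_lip_mean : ∀ w, LipschitzOnCube (meanEmbedding H (Q w)))
    (h_lip_norm : ∀ w, LipschitzOnCube fun t => ∫ y, ‖feature H y‖ ^ 2 ∂(Q w t))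
    (h_lip_eval : ∀ w, ∀ f : H, f ≠ 0 → LipschitzOnCube fun t => ∫ y, |f y| ^ 2 ∂(Q w t))
    -- the test point, and non-degeneracy there
    (x : Fin p → ℝ) (hx : x ∈ Set.Icc (0 : Fin p → ℝ) 1)
    (h_var : ∀ w, 0 < (∫ y, ‖feature H y‖ ^ 2 ∂(Q w x)) - ‖meanEmbedding H (Q w) x‖ ^ 2)
    (h_var_eval : ∀ w, ∀ f : H, f ≠ 0 → 0 < Var[fun y => f y; Q w x])
    -- parameters of the trees and the subsample size `s n = n ^ β`, rounded to an integer
    (α : ℝ) (hα : 0 < α) (hα' : α ≤ 0.2) (κ : ℕ) (hκ : 0 < κ) (π : ℝ) (hπ : 0 < π)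
    (β : ℝ) (hβ : β < 1)
    (hβ' : (1 + Real.log ((1 - α)⁻¹) / Real.log (α⁻¹) * (π / p))⁻¹ < β)
    (s : ℕ → ℕ) (hs_pos : ∀ n, 0 < s n) (hs : ∀ n : ℕ, |(s n : ℝ) - (n : ℝ) ^ β| ≤ 1)
    -- the tree-growing procedures, with auxiliary randomness of law `ν` independent of the data
    {𝓔 : Type*} [MeasurableSpace 𝓔] (ν : Measure 𝓔) [IsProbabilityMeasure ν]
    (P : (n : ℕ) → TreeProcedure p d (s n) 𝓔)
    (h_honest : ∀ n, (P n).IsHonest)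
    (h_random : ∀ n, ∀ᵐ ω ∂μ, (P n).IsRandomSplit ν π (sample X W Y (s n) ω))
    (h_symm : ∀ n, (P n).IsSymmetric ν x)
    (h_regular : ∀ n, ∀ᵐ ω ∂μ, (P n).IsAlphaRegular ν α κ (sample X W Y (s n) ω))
    -- `Γ n` is the Hájek projection of the causal tree on the first observation
    (Γ : ℕ → Ω → H)
    (hΓ : ∀ n, Γ n = hajek μ (fun ω => causalTree H (P n) ν x (sample X W Y (s n) ω))
      (observed X W Y 0))
    -- `V n w` is `Var(E[S_{1w} | X_1, W_1 = w])`
    (V : ℕ → Bool → ℝ)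
    (hV : ∀ n w, V n w = groupVar μ
      (fun ω => (P n).meanGroupWeight ν x (sample X W Y (s n) ω) w ⟨0, hs_pos n⟩) (X 0) (W 0) w)
    (f : H) (hf : f ≠ 0) :
    (∃ ε : ℝ, 0 < ε ∧
      (fun n => Var[fun ω => inner ℝ (Γ n ω) f; μ] -
          ∫ ω, V n (W 0 ω) * sigmaSqOf Q f x (W 0 ω) ∂μ)
        =o[atTop] (fun n => (s n : ℝ) ^ (-(1 + ε))) ∧
      (fun n => hilbertVar μ (Γ n) - ∫ ω, V n (W 0 ω) * sigmaSq H Q x (W 0 ω) ∂μ)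
        =o[atTop] (fun n => (s n : ℝ) ^ (-(1 + ε)))) ∧
    ∀ c : ℝ≥0∞,
      Tendsto (fun n => ENNReal.ofReal (V n true) / ENNReal.ofReal (V n false)) atTop (𝓝 c) →
      Tendsto (fun n => Var[fun ω => inner ℝ (Γ n ω) f; μ] / hilbertVar μ (Γ n)) atTop
        (𝓝 (limitRatio c (sigmaSqOf Q f x) (sigmaSq H Q x) fun w => μ.real (W 0 ⁻¹' {w}))) := by
  set ρ : Measure (Obs p d) := μ.map (observed X W Y 0)
  have hOm : Measurable (observed X W Y 0) := measurable_observed hX hW hY 0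
  have hρp : IsProbabilityMeasure ρ := Measure.isProbabilityMeasure_map hOm.aemeasurable
  obtain ⟨a, b, ha, hb, hab, hbox, hvol, hq⟩ := exists_boxMass (Y := fun w => Y w 0) (hX 0) (hW 0)
    hOm h_density h_overlap
  have hdis : Disintegrates ρ Q := disintegrates_observed (Y := fun w => Y w 0) (hX 0) (hW 0)
    (fun w => hY w 0) hOm h_unconf Q hQ
  change BoxMass ρ a b at hbox
  change ∀ B : Set (Fin p → ℝ), MeasurableSet B → ρ.real {o | cov o ∈ B} ≤ _ at hvol
  change ∀ w, 0 < ρ.real (TreeProcedure.groupSet w) at hq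
  have hα1 : α < 1 := by norm_num at hα'; linarith
  -- The lower bound on β is used only for positivity, which makes the subsample sizes tend to
  -- infinity; all rates are expressed in the subsample size.
  have hβ0 : 0 < β := by
    refine lt_of_le_of_lt (inv_nonneg.2 ?_) hβ'
    have h1 : 0 ≤ Real.log ((1 - α)⁻¹) := Real.log_nonneg ((one_le_inv₀ (by linarith)).2
      (by linarith))
    have h2 : 0 ≤ Real.log (α⁻¹) := Real.log_nonneg ((one_le_inv₀ hα).2 hα1.le)
    positivity
  have hst : Tendsto s atTop atTop := tendsto_subsample_atTop hβ0 hs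
  have hζ : ∀ n, Measurable (sample X W Y (s n)) := fun n => measurable_sample hX hW hY (s n)
  have hlaw : ∀ n, μ.map (sample X W Y (s n)) = Measure.pi fun _ => ρ := fun n =>
    map_sample hX hW hY h_indep h_ident (s n)
  have hvalid : ∀ n, (P n).Valid μ ν ρ x α κ π (sample X W Y (s n)) := fun n =>
    ⟨h_honest n, h_symm n, hζ n, hlaw n, h_regular n, h_random n⟩
  obtain ⟨ε', M, hε', hM, hrate⟩ := TreeProcedure.exists_rate_integral_spread_add_defect (μ := μ)
    (ν := ν) hp ha hb hab hα hα' hκ hπ hx hbox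
  -- Halved because the expansion takes the decay in the form s^(-2ε), and capped at 1 so that the
  -- 1/s² error from centring the weights is also of order s^(-(1+ε)).
  set ε := min (ε' / 2) 1
  have hε : 0 < ε := lt_min (by linarith) one_pos
  have hε1 : ε ≤ 1 := min_le_right _ _
  have hε2 : ε ≤ ε' / 2 := min_le_left _ _
  -- With γ = 1 - ε/4 the lower bound has exponent γ² - 2 = -1 - ε/2 + ε²/16, which exceeds the
  -- error exponent -(1 + ε).
  obtain ⟨c₀, hc₀, hlow⟩ := TreeProcedure.exists_weightVar_ge (μ := μ) (ν := ν) hp ha hb hab hα hα'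
    hκ hπ hx hbox hvol hq (by linarith : 0 < 1 - ε / 4) (by linarith)
  have hη : ∀ᶠ n in atTop, ∫ z, ((P n).spread ν x z + (P n).defect ν x z)
      ∂(Measure.pi fun _ : Fin (s n) => ρ) ≤ M * (s n : ℝ) ^ (-(2 * ε)) := by
    filter_upwards [hst.eventually hrate] with n hn
    refine (hn (P n) _ (hvalid n)).trans (mul_le_mul_of_nonneg_left ?_ hM.le)
    exact Real.rpow_le_rpow_of_exponent_le (by exact_mod_cast hs_pos n) (by linarith)
  set i₀ : (n : ℕ) → Fin (s n) := fun n => ⟨0, hs_pos n⟩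
  have hV' : ∀ n w, V n w = (P n).weightVar ν x ρ (i₀ n) w /
      ρ.real (TreeProcedure.groupSet w) := fun n w => by
    rw [hV]
    exact groupVar_meanGroupWeight (hζ n) (hlaw n) (h_honest n) (i₀ n) w (hq w)
  -- The expectation over W multiplies each group variance by the mass of its group, cancelling the
  -- normalisation of the conditional law.
  have hVT : ∀ n (T : Bool → ℝ), ∫ ω, V n (W 0 ω) * T (W 0 ω) ∂μ =
      ∑ w, (P n).weightVar ν x ρ (i₀ n) w * T w := fun n T => by
    refine (integral_mul_trt (hζ n) (hlaw n) (i₀ n) fun w => V n w * T w).trans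
      (Finset.sum_congr rfl fun w _ => ?_)
    have := (hq w).ne'
    rw [hV']
    field_simp
  obtain ⟨C, hC⟩ := exists_norm_feature_le hk_bdd
  have hfm : StronglyMeasurable (feature H : (Fin d → ℝ) → H) :=
    (continuous_feature hk_cont).stronglyMeasurable
  have hC0 : 0 ≤ C := (norm_nonneg _).trans (hC 0)
  have hGm : ∀ n, StronglyMeasurable ((P n).weightedSum ν x fun o => feature H (out o)) := fun n =>
    TreeProcedure.stronglyMeasurable_weightedSum (hfm.comp_measurable measurable_out)
  have hGb : ∀ n z, ‖(P n).weightedSum ν x (fun o => feature H (out o)) z‖ ≤ 2 * C := fun n z =>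
    TreeProcedure.norm_weightedSum_le (fun o => hC (out o)) z hC0
  have hΓ' : ∀ n, Γ n = hajek μ (fun ω => (P n).weightedSum ν x (fun o => feature H (out o))
      (sample X W Y (s n) ω)) (fun ω => sample X W Y (s n) ω (i₀ n)) := fun n => by
    rw [hΓ]
    simp only [causalTree_eq_weightedSum]
    rfl
  obtain ⟨L₁, hL₁, hL1⟩ := exists_lipschitz_bound h_lip_mean hx
  obtain ⟨L₂, hL₂, hL2⟩ := exists_lipschitz_bound h_lip_norm hx
  obtain ⟨L₃, hL₃, hL3⟩ := exists_lipschitz_bound (fun w => h_lip_eval w f hf) hx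
  have hevalm : StronglyMeasurable fun y : Fin d → ℝ => f y := by
    simp only [← inner_feature]
    exact stronglyMeasurable_const.inner hfm
  have hevalb : ∀ y : Fin d → ℝ, ‖f y‖ ≤ ‖f‖ * C := fun y => by
    rw [← inner_feature]
    exact (norm_inner_le_norm _ _).trans (mul_le_mul_of_nonneg_left (hC y) (norm_nonneg _))
  let E : ℝ → ℝ → ℝ := fun C L => 8 * C ^ 2 + 4 * (L + C) ^ 2 * M + (L + 2 * C * L) * M +
    4 * C ^ 2 * ∑ w, 1 / ρ.real (TreeProcedure.groupSet w)
  have hHvar : ∃ D, ∀ᶠ n in atTop, |hilbertVar μ (Γ n) -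
      ∑ w, (P n).weightVar ν x ρ (i₀ n) w * sigmaSq H Q x w| ≤ D * (s n : ℝ) ^ (-(1 + ε)) := by
    refine ⟨E C (L₁ + L₂), hη.mono fun n hn => ?_⟩
    rw [hΓ', hilbertVar_hajek (hζ n) (hlaw n) (hGm n) (hGb n) (i₀ n)]
    refine TreeProcedure.abs_projectionVar_sub_le_rpow (L := L₁ + L₂) (hs_pos n) (h_honest n)
      (h_symm n) hdis hx hbox.cube hq hfm hC (by linarith) (fun w t ht => (hL1 w t ht).trans ?_)
      (fun w t ht => (hL2 w t ht).trans ?_) hε hε1 hM hn (i₀ n)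
    · exact mul_le_mul_of_nonneg_right (by linarith) (norm_nonneg _)
    · exact mul_le_mul_of_nonneg_right (by linarith) (norm_nonneg _)
  have hFvar : ∃ D, ∀ᶠ n in atTop, |Var[fun ω => inner ℝ (Γ n ω) f; μ] -
      ∑ w, (P n).weightVar ν x ρ (i₀ n) w * sigmaSqOf Q f x w| ≤ D * (s n : ℝ) ^ (-(1 + ε)) := by
    refine ⟨E (‖f‖ * C) (‖f‖ * L₁ + L₃), hη.mono fun n hn => ?_⟩
    rw [hΓ', variance_inner_hajek (hζ n) (hlaw n) (hGm n) (hGb n) (i₀ n) f,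
      sigmaSqOf_eq_outcomeVar Q hfm hC]
    -- By the reproducing property the scalar statement is the same expansion with the real-valued
    -- function y ↦ f(y) in place of the feature.
    simp only [inner_weightedSum_feature]
    refine TreeProcedure.abs_projectionVar_sub_le_rpow (ξ := fun y => f y) (L := ‖f‖ * L₁ + L₃)
      (hs_pos n) (h_honest n) (h_symm n) hdis hx hbox.cube hq hevalm hevalb (by positivity)
      (fun w t ht => ?_) (fun w t ht => ?_) hε hε1 hM hn (i₀ n)
    · rw [← inner_meanEmbedding Q hfm hC, ← inner_meanEmbedding Q hfm hC, ← inner_sub_right]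
      refine (norm_inner_le_norm _ _).trans ((mul_le_mul_of_nonneg_left (hL1 w t ht)
        (norm_nonneg f)).trans ?_)
      rw [← mul_assoc]
      exact mul_le_mul_of_nonneg_right (by linarith) (norm_nonneg _)
    · refine (hL3 w t ht).trans (mul_le_mul_of_nonneg_right ?_ (norm_nonneg _))
      exact le_add_of_nonneg_left (by positivity)
  obtain ⟨D₁, hD₁⟩ := hFvar
  obtain ⟨D₂, hD₂⟩ := hHvar
  -- The errors are O(s^(-(1+ε))); giving up half of the exponent turns this into a little-o.
  refine ⟨⟨ε / 2, by linarith, ?_, ?_⟩, fun c hc => ?_⟩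
  · simp only [hVT]
    exact isLittleO_of_abs_le_rpow hst (by linarith) hD₁
  · simp only [hVT]
    exact isLittleO_of_abs_le_rpow hst (by linarith) hD₂
  have hqW : ∀ w, ρ.real (TreeProcedure.groupSet w) = μ.real (W 0 ⁻¹' {w}) := fun w =>
    map_measureReal_apply hOm (TreeProcedure.measurableSet_groupSet w)
  have hVq : ∀ n w, V n w * μ.real (W 0 ⁻¹' {w}) = (P n).weightVar ν x ρ (i₀ n) w := fun n w => by
    rw [hV', ← hqW, div_mul_cancel₀ _ (hq w).ne']
  -- Dividing `weightVar` by a group mass of at most 1 can only increase it, so the lower bound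
  -- passes to V, and the errors become negligible relative to each group variance separately.
  have hVge : ∀ w, ∀ᶠ n in atTop, c₀ * (s n : ℝ) ^ ((1 - ε / 4) ^ 2 - 2) ≤ V n w := fun w => by
    filter_upwards [hst.eventually hlow] with n hn
    have h1 := hn (P n) _ (hvalid n) (i₀ n) w
    refine h1.trans ?_
    rw [hV']
    exact le_div_self (le_trans (by positivity) h1) (hq w) measureReal_le_one
  have hexp : -(1 + ε) < (1 - ε / 4) ^ 2 - 2 := by nlinarith [sq_nonneg ε]
  refine tendsto_div_limitRatio (v := V) (fun w => by rw [← hqW]; exact hq w) (fun w => ?_)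
    (fun w => ?_) (fun w => ?_) (fun w => ?_) hc
  · have h1 := h_var w
    change 0 < outcomeVar Q (feature H) w x
    rw [outcomeVar_eq hfm hC]
    exact h1
  · filter_upwards [hVge w] with n hn
    have : (0 : ℝ) < s n := Nat.cast_pos.2 (hs_pos n)
    exact lt_of_lt_of_le (by positivity) hn
  · simp only [hVq]
    exact tendsto_div_of_abs_le_rpow hst hc₀ hexp hD₁ (hVge w)
  · simp only [hVq]
    exact tendsto_div_of_abs_le_rpow hst hc₀ hexp hD₂ (hVge w)
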